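/- Let $\mathbb{K}$ be one of $\mathbb{R}$, $\mathbb{C}$, $\mathbb{H}$, put $k=\dim_{\mathbb{R}}\mathbb{K}\in\{1,2,4\}$, and let $n,m\ge 1$. Regard $\mathbb{K}^n$ as a right $\mathbb{K}$-vector space with its standard real inner product and unit sphere $S^{kn-1}$, and let the group $S^{k-1}\subset\mathbb{K}^\times$ of unit scalars act diagonally on $\mathbb{K}^n\times\mathbb{K}^m$ by right multiplication. Let $$M_{k,n,m}:=S^{kn-1}\times_{S^{k-1}}S^{km-1}=(S^{kn-1}\times S^{km-1})/S^{k-1}$$ be the (closed, smooth) quotient manifold. Let $G(n,m)$ be the normalizer of $S^{k-1}$ in $O(kn)\times O(km)$ and $PG(n,m):=G(n,m)/S^{k-1}$; this group acts on $M_{k,n,m}$ by diffeomorphisms. Then the space of all smooth $PG(n,m)$-invariant Riemannian metrics of positive scalar curvature on $M_{k,n,m}$, with the $C^\infty$-topology, is contractible (in particular nonempty) in each of the following cases: 1. $k=1$ and $n,m\ge 3$; 2. $k=2$ and $n,m\ge 2$; 3. $k=4$ and $n,m\ge 1$. -/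

import Mathlib

open Metric MulAction
open scoped Manifold ContDiff Quaternion RealInnerProductSpace

set_option maxSynthPendingDepth 3
set_option linter.unusedSectionVars false

noncomputable section

namespace PscQuotient

section Scalars

variable {K : Type*} [NormedDivisionRing K] [InnerProductSpace ℝ K]

theorem inner_mul_mul_right (a b z : K) : ⟪a * z, b * z⟫ = ‖z‖ ^ 2 * ⟪a, b⟫ := by
  have h := norm_add_sq_real (a * z) (b * z)
  have h' := norm_add_sq_real a b
  rw [← add_mul, norm_mul, norm_mul, norm_mul] at h
  linear_combination (‖z‖ ^ 2 * h' - h) / 2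

theorem inner_mul_mul_left (a b z : K) : ⟪z * a, z * b⟫ = ‖z‖ ^ 2 * ⟪a, b⟫ := by
  have h := norm_add_sq_real (z * a) (z * b)
  have h' := norm_add_sq_real a b
  rw [← mul_add, norm_mul, norm_mul, norm_mul] at h
  linear_combination (‖z‖ ^ 2 * h' - h) / 2

/-- Conjugation of the scalars: the identity on the reals, minus the identity on the imaginary
part. -/
def conj (x : K) : K := (2 * ⟪1, x⟫) • (1 : K) - x

variable [IsScalarTower ℝ K K]

theorem inner_mul_left_eq (x a b : K) : ⟪x * a, b⟫ = ⟪a, conj x * b⟫ := by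
  have h1 := inner_mul_mul_right x 1 a
  have h := inner_mul_mul_left a b (x + 1)
  have h2 := inner_mul_mul_left a b x
  have h3 : ‖x + 1‖ ^ 2 = ‖x‖ ^ 2 + 2 * ⟪x, 1⟫ + 1 := by
    rw [norm_add_sq_real]; simp
  rw [h3] at h
  simp only [add_mul, one_mul, inner_add_left, inner_add_right] at h
  simp only [conj, sub_mul, smul_mul_assoc, one_mul, inner_sub_right, inner_smul_right]
  rw [real_inner_comm x 1]
  linarith

theorem conj_mul_self (x : K) : conj x * x = (‖x‖ ^ 2) • (1 : K) := by
  refine ext_inner_left ℝ fun b => ?_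
  rw [← inner_mul_left_eq]
  have := inner_mul_mul_left b 1 x
  rw [mul_one] at this
  rw [this, inner_smul_right]

theorem inv_eq_conj (x : K) : x⁻¹ = (‖x‖ ^ 2)⁻¹ • conj x := by
  by_cases hx : x = 0
  · simp [hx, conj]
  · apply inv_eq_of_mul_eq_one_left
    rw [smul_mul_assoc, conj_mul_self, smul_smul, inv_mul_cancel₀ (by simpa using hx), one_smul]

theorem contDiff_conj : ContDiff ℝ ∞ (conj : K → K) := by
  exact ((contDiff_const.mul (contDiff_const.inner ℝ contDiff_id)).smul contDiff_const).sub
    contDiff_id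

theorem contDiff_mul' [SMulCommClass ℝ K K] : ContDiff ℝ ∞ (fun p : K × K => p.1 * p.2) :=
  (ContinuousLinearMap.mul ℝ K).isBoundedBilinearMap.contDiff

theorem contDiffAt_inv' {x : K} (hx : x ≠ 0) : ContDiffAt ℝ ∞ (fun x : K => x⁻¹) x := by
  have : (fun x : K => x⁻¹) = fun x => (‖x‖ ^ 2)⁻¹ • conj x := funext inv_eq_conj
  rw [this]
  exact ((contDiff_norm_sq ℝ).contDiffAt.inv (by simpa using hx)).smul contDiff_conj.contDiffAt

end Scalars

section Groups

variable (K : Type*) [NormedDivisionRing K] [InnerProductSpace ℝ K]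
  [IsScalarTower ℝ K K] (n m : ℕ)

/-- `K ^ n` with its standard (real) inner product. -/
abbrev Vec : Type _ := PiLp 2 (fun _ : Fin n => K)

/-- The orthogonal group of the real inner product space `K ^ n`. -/
abbrev Orth : Type _ := Vec K n ≃ₗᵢ[ℝ] Vec K n

/-- `S(K ^ n) × S(K ^ m)`. -/
abbrev Spheres : Type _ := sphere (0 : Vec K n) 1 × sphere (0 : Vec K m) 1

variable {K} in
/-- Right multiplication by `z⁻¹` on `K`, for a unit scalar `z`. -/
def rightMulScalar (z : sphere (0 : K) 1) : K ≃ₗᵢ[ℝ] K where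
  toFun x := x * (z : K)⁻¹
  invFun x := x * z
  map_add' x y := add_mul _ _ _
  map_smul' c x := smul_mul_assoc _ _ _
  left_inv x := by
    have : (z : K) ≠ 0 := ne_zero_of_mem_unit_sphere z
    simp [this]
  right_inv x := by
    have : (z : K) ≠ 0 := ne_zero_of_mem_unit_sphere z
    simp [this]
  norm_map' x := by simp

/-- The homomorphism `S^{k-1} → O(kn) × O(km)` given by scalar multiplication from the right:
`z` acts by `(v, w) ↦ (v z⁻¹, w z⁻¹)`. -/
def scalarHom : sphere (0 : K) 1 →* Orth K n × Orth K m where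
  toFun z := (LinearIsometryEquiv.piLpCongrRight 2 fun _ => rightMulScalar z,
    LinearIsometryEquiv.piLpCongrRight 2 fun _ => rightMulScalar z)
  map_one' := by
    ext x i <;> simp [rightMulScalar]
  map_mul' z w := by
    ext x i <;> simp [rightMulScalar, mul_assoc]

/-- The group `S^{k-1}` of unit scalars as a subgroup of `O(kn) × O(km)`. -/
def unitScalars : Subgroup (Orth K n × Orth K m) := (scalarHom K n m).range

/-- `G(n,m)`, the normalizer of `S^{k-1}` in `O(kn) × O(km)`. -/
def G : Subgroup (Orth K n × Orth K m) := Subgroup.normalizer (unitScalars K n m)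

instance : ((unitScalars K n m).subgroupOf (G K n m)).Normal := by
  unfold G; infer_instance

/-- `PG(n,m) = G(n,m) / S^{k-1}`. -/
abbrev PG : Type _ := G K n m ⧸ (unitScalars K n m).subgroupOf (G K n m)

variable {K n m} in
/-- The action of `O(kn) × O(km)` on the product of the unit spheres. -/
instance : MulAction (Orth K n × Orth K m) (Spheres K n m) where
  smul A p := (⟨A.1 p.1, by simp⟩, ⟨A.2 p.2, by simp⟩)
  one_smul _ := rfl
  mul_smul _ _ _ := rfl

/-- The manifold `S(K ^ n) ×_{S^{k-1}} S(K ^ m)`: the orbit space of the diagonal action of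
`S^{k-1}` on `S(K ^ n) × S(K ^ m)`, with the quotient topology. -/
def M : Type _ := orbitRel.Quotient (unitScalars K n m) (Spheres K n m)

instance : TopologicalSpace (M K n m) :=
  inferInstanceAs (TopologicalSpace (orbitRel.Quotient (unitScalars K n m) (Spheres K n m)))

variable {K n m}

/-- The quotient map `S(K ^ n) × S(K ^ m) → M`. -/
def M.mk (p : Spheres K n m) : M K n m := Quotient.mk _ p

theorem smul_fst (A : Orth K n × Orth K m) (p : Spheres K n m) :
    ((A • p).1 : Vec K n) = A.1 p.1 := rfl

theorem smul_snd (A : Orth K n × Orth K m) (p : Spheres K n m) :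
    ((A • p).2 : Vec K m) = A.2 p.2 := rfl

instance : ContinuousConstSMul (Orth K n × Orth K m) (Spheres K n m) where
  continuous_const_smul A := by
    refine Continuous.prodMk ?_ ?_
    · exact (A.1.continuous.comp (by fun_prop)).subtype_mk _
    · exact (A.2.continuous.comp (by fun_prop)).subtype_mk _

theorem M.isOpenQuotientMap_mk : IsOpenQuotientMap (M.mk : Spheres K n m → M K n m) :=
  haveI : ContinuousConstSMul (unitScalars K n m) (Spheres K n m) :=
    ⟨fun A => continuous_const_smul (A : Orth K n × Orth K m)⟩
  MulAction.isOpenQuotientMap_quotientMk (Γ := unitScalars K n m)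

theorem M.mk_eq_iff {p q : Spheres K n m} :
    M.mk p = M.mk q ↔ ∃ z ∈ unitScalars K n m, z • q = p := by
  refine (Quotient.eq (r := orbitRel (unitScalars K n m) (Spheres K n m))).trans ?_
  simp [orbitRel_apply, mem_orbit_iff, Subgroup.smul_def]

/-- The action of `G(n,m)` on `M`, `A • [p] = [A • p]`. -/
instance : MulAction (G K n m) (M K n m) where
  smul A := Quotient.lift (fun p => M.mk ((A : Orth K n × Orth K m) • p)) (by
    intro p q h
    obtain ⟨z, hz, rfl⟩ := M.mk_eq_iff.1 (Quotient.sound h : M.mk p = M.mk q)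
    refine M.mk_eq_iff.2 ⟨A * z * (A : Orth K n × Orth K m)⁻¹, (A.2 z).1 hz, ?_⟩
    simp [mul_smul])
  one_smul p := by
    induction p using Quotient.inductionOn
    exact congrArg M.mk (one_smul _ _)
  mul_smul A B p := by
    induction p using Quotient.inductionOn
    exact congrArg M.mk (mul_smul _ _ _)

theorem smul_mk (A : G K n m) (p : Spheres K n m) :
    A • M.mk p = M.mk ((A : Orth K n × Orth K m) • p) := rfl

instance : ContinuousConstSMul (G K n m) (M K n m) where
  continuous_const_smul A := by
    rw [M.isOpenQuotientMap_mk.isQuotientMap.continuous_iff]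
    exact M.isOpenQuotientMap_mk.continuous.comp
      (continuous_const_smul (A : Orth K n × Orth K m))

/-- The subgroup `S^{k-1}` acts trivially on `M`. -/
theorem unitScalars_le_ker :
    (unitScalars K n m).subgroupOf (G K n m) ≤ (toPermHom (G K n m) (M K n m)).ker := by
  intro z hz
  rw [MonoidHom.mem_ker]
  ext p
  induction p using Quotient.inductionOn
  exact M.mk_eq_iff.2 ⟨z, hz, rfl⟩

/-- The induced action of `PG(n,m)` on `M`. -/
instance : MulAction (PG K n m) (M K n m) :=
  MulAction.compHom (M K n m) (QuotientGroup.lift _ _ unitScalars_le_ker)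

theorem coe_smul (A : G K n m) (p : M K n m) : (A : PG K n m) • p = A • p := rfl

end Groups

section Transitivity

variable {K : Type*} [NormedDivisionRing K] [InnerProductSpace ℝ K]
  [IsScalarTower ℝ K K] [SMulCommClass ℝ K K] {n m : ℕ}

/-- Right multiplication of a vector by a scalar. -/
def rmul (x : Vec K n) (z : K) : Vec K n := WithLp.toLp 2 fun i => x i * z

/-- The `K`-valued Hermitian product on `K ^ n`. -/
def herm (u x : Vec K n) : K := ∑ i, conj (u i) * x i

theorem norm_rmul (x : Vec K n) (z : K) : ‖rmul x z‖ = ‖x‖ * ‖z‖ := by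
  rw [← sq_eq_sq₀ (norm_nonneg _) (by positivity), mul_pow, PiLp.norm_sq_eq_of_L2,
    PiLp.norm_sq_eq_of_L2, Finset.sum_mul]
  simp [rmul, mul_pow]

theorem inner_rmul (u x : Vec K n) (t : K) : ⟪rmul u t, x⟫ = ⟪t, herm u x⟫ := by
  simp [PiLp.inner_apply, rmul, herm, inner_mul_left_eq, inner_sum]

theorem herm_rmul (u x : Vec K n) (t : K) : herm u (rmul x t) = herm u x * t := by
  simp [rmul, herm, Finset.sum_mul, mul_assoc]

theorem herm_self (u : Vec K n) : herm u u = (‖u‖ ^ 2) • (1 : K) := by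
  simp [herm, PiLp.norm_sq_eq_of_L2, conj_mul_self, Finset.sum_smul]

theorem herm_sub (u x y : Vec K n) : herm u (x - y) = herm u x - herm u y := by
  simp [herm, mul_sub]

theorem herm_add (u x y : Vec K n) : herm u (x + y) = herm u x + herm u y := by
  simp [herm, mul_add, Finset.sum_add_distrib]

theorem herm_sub_left (u v x : Vec K n) : herm (u - v) x = herm u x - herm v x := by
  have (a b : K) : conj (a - b) = conj a - conj b := by
    simp only [conj, inner_sub_right, mul_sub, sub_smul]
    abel
  simp [herm, sub_mul, this]

theorem herm_smul (u x : Vec K n) (c : ℝ) : herm u (c • x) = c • herm u x := by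
  simp only [herm, Finset.smul_sum, PiLp.smul_apply, mul_smul_comm]

/-- The `K`-linear reflection in the orthogonal complement of the line spanned by `u`. -/
def reflFun (u x : Vec K n) : Vec K n := x - rmul u ((2 * (‖u‖ ^ 2)⁻¹) • herm u x)

theorem norm_reflFun (u x : Vec K n) : ‖reflFun u x‖ = ‖x‖ := by
  rw [← sq_eq_sq₀ (norm_nonneg _) (norm_nonneg _), reflFun, norm_sub_sq_real, real_inner_comm,
    inner_rmul, inner_smul_left, norm_rmul, norm_smul, real_inner_self_eq_norm_sq]
  by_cases hu : ‖u‖ = 0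
  · simp [hu]
  · simp only [Real.norm_eq_abs, mul_pow, sq_abs, conj_trivial]
    field_simp
    ring

theorem reflFun_reflFun (u x : Vec K n) : reflFun u (reflFun u x) = x := by
  by_cases hu : ‖u‖ = 0
  · ext i
    simp [reflFun, rmul, hu]
  have h : herm u (reflFun u x) = - herm u x := by
    rw [reflFun, herm_sub, herm_rmul, herm_self, smul_mul_smul_comm, one_mul,
      show ‖u‖ ^ 2 * (2 * (‖u‖ ^ 2)⁻¹) = 2 by field_simp, two_smul]
    abel
  rw [reflFun, h, reflFun]
  ext i
  simp [rmul]

/-- The reflection as a linear isometry. -/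
def refl (u : Vec K n) : Orth K n where
  toFun := reflFun u
  invFun := reflFun u
  map_add' x y := by
    ext i
    simp only [reflFun, herm_add, rmul, smul_add, mul_add, PiLp.add_apply, PiLp.sub_apply]
    abel
  map_smul' c x := by
    ext i
    simp only [reflFun, herm_smul, rmul, PiLp.smul_apply, PiLp.sub_apply, smul_sub,
      RingHom.id_apply, mul_smul_comm, smul_comm c]
  left_inv := reflFun_reflFun u
  right_inv := reflFun_reflFun u
  norm_map' := norm_reflFun u

theorem refl_rmul (u x : Vec K n) (z : K) : refl u (rmul x z) = rmul (refl u x) z := by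
  change reflFun u (rmul x z) = rmul (reflFun u x) z
  rw [reflFun, reflFun, herm_rmul, ← smul_mul_assoc]
  ext i
  simp only [rmul, PiLp.sub_apply, sub_mul, mul_assoc]

/-- Left multiplication by a unit scalar. -/
def lmul {q : K} (hq : ‖q‖ = 1) : Orth K n :=
  LinearIsometryEquiv.piLpCongrRight 2 fun _ =>
    { toFun := fun x => q * x
      invFun := fun x => q⁻¹ * x
      map_add' := mul_add q
      map_smul' := fun c x => mul_smul_comm c q x
      left_inv := fun x => inv_mul_cancel_left₀ (by rintro rfl; simp at hq) x
      right_inv := fun x => mul_inv_cancel_left₀ (by rintro rfl; simp at hq) x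
      norm_map' := fun x => by simp [hq] }

theorem lmul_apply {q : K} (hq : ‖q‖ = 1) (x : Vec K n) (i : Fin n) :
    lmul hq x i = q * x i := rfl

variable (K n) in
/-- The first standard unit vector. -/
def e₀ [NeZero n] : Vec K n := PiLp.single 2 0 1

theorem norm_e₀ [NeZero n] : ‖e₀ K n‖ = 1 := by simp [e₀]

theorem exists_orth_apply_e₀ [NeZero n] (v : Vec K n) (hv : ‖v‖ = 1) :
    ∃ A : Orth K n, (∀ x z, A (rmul x z) = rmul (A x) z) ∧ A (e₀ K n) = v := by
  obtain ⟨q, hq, hq'⟩ : ∃ q : K, ‖q‖ = 1 ∧ conj (v 0) * q = ‖v 0‖ • (1 : K) := by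
    by_cases h : v 0 = 0
    · exact ⟨1, by simp, by simp [h, conj]⟩
    · have h' : ‖v 0‖ ≠ 0 := by simpa using h
      refine ⟨‖v 0‖⁻¹ • v 0, by simp [norm_smul, h'], ?_⟩
      rw [mul_smul_comm, conj_mul_self, smul_smul]
      congr 1
      field_simp
  have h0 : herm v (rmul (e₀ K n) q) = ‖v 0‖ • (1 : K) := by
    rw [herm_rmul, ← hq']
    congr 1
    simp [herm, e₀]
  set a := rmul (e₀ K n) q with ha
  have hna : ‖a‖ = 1 := by rw [ha, norm_rmul, norm_e₀, hq, one_mul]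
  have hin : ⟪v, a⟫ = ‖v 0‖ := by
    have := inner_rmul v a 1
    rw [h0, inner_smul_right, real_inner_self_eq_norm_sq, norm_one, one_pow, mul_one] at this
    rw [← this]
    congr 1
    ext i
    simp [rmul]
  have hnu : ‖a - v‖ ^ 2 = 2 * (1 - ‖v 0‖) := by
    rw [norm_sub_sq_real, hna, hv, real_inner_comm, hin]
    ring
  have hhu : herm (a - v) a = (1 - ‖v 0‖) • (1 : K) := by
    rw [herm_sub_left, herm_self, h0, hna, sub_smul, one_pow]
  refine ⟨refl (a - v) * lmul hq, fun x z => ?_, ?_⟩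
  · have : lmul hq (rmul x z) = rmul (lmul hq x) z := by
      ext i
      simp [lmul_apply, rmul, mul_assoc]
    change refl (a - v) (lmul hq (rmul x z)) = rmul (refl (a - v) (lmul hq x)) z
    rw [this, refl_rmul]
  · have hla : lmul hq (e₀ K n) = a := by
      ext i
      by_cases hi : i = 0 <;> simp [lmul_apply, ha, rmul, e₀, hi]
    change reflFun (a - v) (lmul hq (e₀ K n)) = v
    rw [hla]
    rw [reflFun, hhu, hnu]
    by_cases h : 1 - ‖v 0‖ = 0
    · have : a - v = 0 := by simpa [h] using hnu
      rw [this]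
      ext i
      simp [rmul, ← sub_eq_zero.1 this]
    · rw [smul_smul, show 2 * (2 * (1 - ‖v 0‖))⁻¹ * (1 - ‖v 0‖) = 1 by field_simp, one_smul]
      ext i
      simp [rmul]

theorem mem_G_of_commute {A : Orth K n × Orth K m}
    (h1 : ∀ x z, A.1 (rmul x z) = rmul (A.1 x) z)
    (h2 : ∀ x z, A.2 (rmul x z) = rmul (A.2 x) z) : A ∈ G K n m := by
  have hc : ∀ z, A * scalarHom K n m z = scalarHom K n m z * A := by
    intro z
    refine Prod.ext ?_ ?_
    · exact LinearIsometryEquiv.ext fun x => h1 x _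
    · exact LinearIsometryEquiv.ext fun x => h2 x _
  rw [G, Subgroup.mem_normalizer_iff]
  have hc' : ∀ B ∈ unitScalars K n m, A * B * A⁻¹ = B := by
    rintro _ ⟨z, rfl⟩
    rw [hc, mul_inv_cancel_right]
  refine fun B => ⟨fun hB => by rwa [hc' B hB], fun hB => ?_⟩
  have := hc' _ hB
  have h3 : A * B * A⁻¹ = B := by
    have := congrArg (fun X => A⁻¹ * X * A) this
    simpa [mul_assoc] using this
  rwa [h3] at hB

end Transitivity

section Charts

variable (K : Type*) [NormedDivisionRing K] [InnerProductSpace ℝ K]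
  [IsScalarTower ℝ K K] [SMulCommClass ℝ K K] (n m : ℕ) [NeZero n] [NeZero m]

/-- The imaginary part of the scalars. -/
abbrev Im : Submodule ℝ K := (ℝ ∙ (1 : K))ᗮ

/-- The model space `K ^ (n - 1) × K ^ (m - 1) × Im K` of `M`; the coordinates of `K ^ (n - 1)` are
indexed by the nonzero elements of `Fin n`. -/
abbrev Model : Type _ := ({i : Fin n // i ≠ 0} → K) × ({i : Fin m // i ≠ 0} → K) × Im K

variable {K n m}

/-- The coordinate functions of the base chart. After multiplying a representative `(x, y)` from the
right by the inverse of the zeroth entry of `x` these are the remaining entries of `x`,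
and the remaining entries and the imaginary part of the zeroth entry of `y`, the latter two divided
by the real part of the zeroth entry of `y`. -/
def coord (p : Vec K n × Vec K m) : Model K n m :=
  (fun i => p.1 i * (p.1 0)⁻¹,
    fun i => ⟪1, p.2 0 * (p.1 0)⁻¹⟫⁻¹ • (p.2 i * (p.1 0)⁻¹),
    ⟪1, p.2 0 * (p.1 0)⁻¹⟫⁻¹ • (Im K).orthogonalProjectionOnto (p.2 0 * (p.1 0)⁻¹))

theorem coord_rmul (p : Vec K n × Vec K m) {z : K} (hz : z ≠ 0) :
    coord (rmul p.1 z, rmul p.2 z) = coord p := by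
  have (a b : K) : a * z * (b * z)⁻¹ = a * b⁻¹ := by
    rw [mul_inv_rev, mul_assoc, mul_inv_cancel_left₀ hz]
  simp only [coord, rmul, this]

/-- The vectors `(1, a)` and `(1 + c, b)` for a point `(a, b, c)` of the model space. -/
def lift (e : Model K n m) : Vec K n × Vec K m :=
  (WithLp.toLp 2 fun i => if h : i ≠ 0 then e.1 ⟨i, h⟩ else 1,
    WithLp.toLp 2 fun i => if h : i ≠ 0 then e.2.1 ⟨i, h⟩ else 1 + (e.2.2 : K))

theorem real_add_im (q : K) :
    ⟪1, q⟫ • (1 : K) + (Im K).orthogonalProjectionOnto q = q := by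
  have h := Submodule.starProjection_add_starProjection_orthogonal (K := ℝ ∙ (1 : K)) q
  rwa [Submodule.starProjection_unit_singleton ℝ (by simp)] at h

theorem inner_one_im (c : Im K) : ⟪(1 : K), c⟫ = 0 :=
  Submodule.mem_orthogonal_singleton_iff_inner_right.1 c.2

theorem lift_fst_ne_zero (e : Model K n m) : (lift e).1 ≠ 0 := by
  intro h
  have := congrArg (fun x : Vec K n => x 0) h
  simp [lift] at this

theorem lift_snd_ne_zero (e : Model K n m) : (lift e).2 ≠ 0 := by
  intro h
  have h0 : (1 : K) + e.2.2 = 0 := by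
    have := congrArg (fun x : Vec K m => x 0) h
    simpa [lift] using this
  have := congrArg (fun x : K => ⟪1, x⟫) h0
  simp [inner_add_right, inner_one_im] at this

/-- The normalization of `lift`. -/
def nlift (e : Model K n m) : Vec K n × Vec K m :=
  (‖(lift e).1‖⁻¹ • (lift e).1, ‖(lift e).2‖⁻¹ • (lift e).2)

/-- The local parametrization of the product of spheres. -/
def param (e : Model K n m) : Spheres K n m :=
  (⟨(nlift e).1, by simp [nlift, norm_smul, lift_fst_ne_zero]⟩,
    ⟨(nlift e).2, by simp [nlift, norm_smul, lift_snd_ne_zero]⟩)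

theorem contDiff_lift : ContDiff ℝ ∞ (lift : Model K n m → _) := by
  refine ContDiff.prodMk ?_ ?_
  · refine (PiLp.contDiff_toLp).comp (contDiff_pi.2 fun i => ?_)
    by_cases h : i ≠ 0
    · simp only [h, ne_eq, not_false_eq_true, dite_true]
      fun_prop
    · simp only [h, dite_false]
      fun_prop
  · refine (PiLp.contDiff_toLp).comp (contDiff_pi.2 fun i => ?_)
    by_cases h : i ≠ 0
    · simp only [h, ne_eq, not_false_eq_true, dite_true]
      fun_prop
    · simp only [h, dite_false]
      exact contDiff_const.add
        ((Im K).subtypeL.contDiff.comp (contDiff_snd.comp contDiff_snd))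

theorem contDiff_nlift : ContDiff ℝ ∞ (nlift : Model K n m → _) := by
  have h1 : ContDiff ℝ ∞ fun e : Model K n m => (lift e).1 := contDiff_fst.comp contDiff_lift
  have h2 : ContDiff ℝ ∞ fun e : Model K n m => (lift e).2 := contDiff_snd.comp contDiff_lift
  exact (((h1.norm ℝ lift_fst_ne_zero).inv fun e => by simp [lift_fst_ne_zero]).smul h1).prodMk
    (((h2.norm ℝ lift_snd_ne_zero).inv fun e => by simp [lift_snd_ne_zero]).smul h2)

theorem continuous_param : Continuous (param : Model K n m → _) :=
  ((continuous_fst.comp contDiff_nlift.continuous).subtype_mk _).prodMk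
    ((continuous_snd.comp contDiff_nlift.continuous).subtype_mk _)

/-- The set of pairs of vectors on which the coordinate functions are smooth. -/
def coordDom : Set (Vec K n × Vec K m) := {p | 0 < ⟪p.1 0, p.2 0⟫}

theorem isOpen_coordDom : IsOpen (coordDom : Set (Vec K n × Vec K m)) := by
  refine isOpen_lt continuous_const (Continuous.inner ?_ ?_) <;> fun_prop

theorem inner_rmul_rmul (p : Vec K n × Vec K m) (z : K) :
    ⟪rmul p.1 z 0, rmul p.2 z 0⟫ = ‖z‖ ^ 2 * ⟪p.1 0, p.2 0⟫ := inner_mul_mul_right _ _ _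

theorem ne_zero_of_mem_coordDom {p : Vec K n × Vec K m} (hp : p ∈ coordDom) : p.1 0 ≠ 0 := by
  intro h
  simp [coordDom, h] at hp

theorem inner_one_pos {p : Vec K n × Vec K m} (hp : p ∈ coordDom) :
    0 < ⟪1, p.2 0 * (p.1 0)⁻¹⟫ := by
  have h0 := ne_zero_of_mem_coordDom hp
  have h := inner_mul_mul_right (p.1 0) (p.2 0) (p.1 0)⁻¹
  rw [mul_inv_cancel₀ h0] at h
  rw [h]
  have : 0 < ‖(p.1 0)⁻¹‖ := by simpa using h0
  exact mul_pos (by positivity) hp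

theorem contDiffOn_coord : ContDiffOn ℝ ∞ (coord : Vec K n × Vec K m → _) coordDom := by
  intro p hp
  refine ContDiffAt.contDiffWithinAt ?_
  have hx (i : Fin n) : ContDiffAt ℝ ∞ (fun p : Vec K n × Vec K m => p.1 i) p := by fun_prop
  have hy (i : Fin m) : ContDiffAt ℝ ∞ (fun p : Vec K n × Vec K m => p.2 i) p := by fun_prop
  have hi : ContDiffAt ℝ ∞ (fun p : Vec K n × Vec K m => (p.1 0)⁻¹) p :=
    ContDiffAt.comp p (contDiffAt_inv' (ne_zero_of_mem_coordDom hp)) (hx 0)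
  have hxi (i : Fin n) : ContDiffAt ℝ ∞ (fun p : Vec K n × Vec K m => p.1 i * (p.1 0)⁻¹) p :=
    contDiff_mul'.contDiffAt.comp p ((hx i).prodMk hi)
  have hyi (i : Fin m) : ContDiffAt ℝ ∞ (fun p : Vec K n × Vec K m => p.2 i * (p.1 0)⁻¹) p :=
    contDiff_mul'.contDiffAt.comp p ((hy i).prodMk hi)
  have hr : ContDiffAt ℝ ∞ (fun p : Vec K n × Vec K m => ⟪1, p.2 0 * (p.1 0)⁻¹⟫⁻¹) p :=
    (contDiffAt_const.inner ℝ (hyi 0)).inv (inner_one_pos hp).ne'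
  refine ContDiffAt.prodMk (contDiffAt_pi.2 fun i => hxi i)
    (ContDiffAt.prodMk (contDiffAt_pi.2 fun i => hr.smul (hyi i)) (hr.smul ?_))
  exact (Im K).orthogonalProjectionOnto.contDiff.contDiffAt.comp p (hyi 0)

theorem nlift_fst_zero (e : Model K n m) : (nlift e).1 0 = ‖(lift e).1‖⁻¹ • (1 : K) := by
  simp [nlift, lift]

theorem nlift_snd_zero (e : Model K n m) :
    (nlift e).2 0 = ‖(lift e).2‖⁻¹ • (1 + (e.2.2 : K)) := by
  simp [nlift, lift]

theorem inner_one_one_add (c : Im K) : ⟪(1 : K), 1 + (c : K)⟫ = 1 := by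
  simp [inner_add_right, inner_one_im]

theorem nlift_mem (e : Model K n m) : nlift e ∈ coordDom := by
  have h1 := lift_fst_ne_zero e
  have h2 := lift_snd_ne_zero e
  change 0 < ⟪(nlift e).1 0, (nlift e).2 0⟫
  rw [nlift_fst_zero, nlift_snd_zero, real_inner_smul_left, real_inner_smul_right,
    inner_one_one_add]
  positivity

theorem coord_nlift (e : Model K n m) : coord (nlift e) = e := by
  have h1 : ‖(lift e).1‖ ≠ 0 := by simpa using lift_fst_ne_zero e
  have h2 : ‖(lift e).2‖ ≠ 0 := by simpa using lift_snd_ne_zero e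
  have hx (i : {i : Fin n // i ≠ 0}) : (nlift e).1 i = ‖(lift e).1‖⁻¹ • e.1 i := by
    simp [nlift, lift, i.2]
  have hy (i : {i : Fin m // i ≠ 0}) : (nlift e).2 i = ‖(lift e).2‖⁻¹ • e.2.1 i := by
    simp [nlift, lift, i.2]
  have hinv : (‖(lift e).1‖⁻¹ • (1 : K))⁻¹ = ‖(lift e).1‖ • (1 : K) := by
    apply inv_eq_of_mul_eq_one_left
    rw [smul_mul_smul_comm, mul_inv_cancel₀ h1, one_smul, one_mul]
  have hp1 : (Im K).orthogonalProjectionOnto (1 : K) = 0 := by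
    have h := real_add_im (1 : K)
    rw [real_inner_self_eq_norm_sq, norm_one, one_pow, one_smul, add_eq_left] at h
    exact Subtype.ext h
  have hp2 : (Im K).orthogonalProjectionOnto (e.2.2 : K) = e.2.2 := by simp
  simp only [coord, nlift_fst_zero, nlift_snd_zero, hx, hy, hinv, smul_mul_smul_comm, mul_one,
    inner_smul_right, inner_one_one_add,
    map_smul, map_add, hp1, hp2, zero_add, smul_smul]
  have h3 : (‖(lift e).2‖⁻¹ * ‖(lift e).1‖)⁻¹ * (‖(lift e).2‖⁻¹ * ‖(lift e).1‖) = 1 :=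
    inv_mul_cancel₀ (by positivity)
  simp only [h3, inv_mul_cancel₀ h1, one_smul]

theorem lift_coord {p : Vec K n × Vec K m} (hp : p ∈ coordDom) :
    lift (coord p) =
      (rmul p.1 (p.1 0)⁻¹, ⟪1, p.2 0 * (p.1 0)⁻¹⟫⁻¹ • rmul p.2 (p.1 0)⁻¹) := by
  have h0 := ne_zero_of_mem_coordDom hp
  have hr := (inner_one_pos hp).ne'
  refine Prod.ext ?_ ?_
  · ext i
    by_cases hi : i = 0 <;> simp [lift, coord, rmul, hi, h0]
  · ext i
    by_cases hi : i = 0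
    · subst hi
      have h := real_add_im (p.2 0 * (p.1 0)⁻¹)
      have h' := congrArg (fun x => ⟪1, p.2 0 * (p.1 0)⁻¹⟫⁻¹ • x) h
      simp only [smul_add, smul_smul, inv_mul_cancel₀ hr, one_smul] at h'
      simpa [lift, coord, rmul] using h'
    · simp [lift, coord, rmul, hi]

theorem nlift_coord {p : Vec K n × Vec K m} (hp : p ∈ coordDom) (h1 : ‖p.1‖ = 1)
    (h2 : ‖p.2‖ = 1) : ∃ z : K, ‖z‖ = 1 ∧ nlift (coord p) = (rmul p.1 z, rmul p.2 z) := by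
  have h0 := ne_zero_of_mem_coordDom hp
  have h0' : ‖p.1 0‖ ≠ 0 := by simpa using h0
  have hr := inner_one_pos hp
  refine ⟨‖p.1 0‖ • (p.1 0)⁻¹, by simp [norm_smul, h0'], ?_⟩
  rw [nlift, lift_coord hp]
  have hs {l : ℕ} (x : Vec K l) : rmul x (‖p.1 0‖ • (p.1 0)⁻¹) = ‖p.1 0‖ • rmul x (p.1 0)⁻¹ := by
    ext i
    simp only [rmul, PiLp.smul_apply, mul_smul_comm]
  refine Prod.ext ?_ ?_
  · simp only [hs, norm_rmul, h1, norm_inv, one_mul, inv_inv]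
  · simp only [hs, norm_smul, norm_rmul, h2, norm_inv, one_mul, smul_smul, Real.norm_eq_abs,
      abs_of_pos hr]
    congr 1
    field_simp

end Charts

section Manifold

variable {K : Type*} [NormedDivisionRing K] [InnerProductSpace ℝ K]
  [IsScalarTower ℝ K K] [SMulCommClass ℝ K K] {n m : ℕ} [NeZero n] [NeZero m]

/-- The pair of ambient vectors of a point of the product of spheres. -/
def amb (p : Spheres K n m) : Vec K n × Vec K m := (p.1, p.2)

theorem continuous_amb : Continuous (amb : Spheres K n m → _) := by
  unfold amb; fun_prop

theorem amb_smul (A : Orth K n × Orth K m) (p : Spheres K n m) :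
    amb (A • p) = (A.1 (amb p).1, A.2 (amb p).2) := rfl

theorem amb_param (e : Model K n m) : amb (param e) = nlift e := rfl

theorem exists_rmul_of_mem {z : Orth K n × Orth K m} (hz : z ∈ unitScalars K n m) :
    ∃ c : K, ‖c‖ = 1 ∧ ∀ p : Spheres K n m, amb (z • p) = (rmul (amb p).1 c, rmul (amb p).2 c) := by
  obtain ⟨w, rfl⟩ := hz
  exact ⟨(w : K)⁻¹, by simp, fun p => rfl⟩

theorem mk_eq_of_rmul {p q : Spheres K n m} {c : K} (hc : ‖c‖ = 1)
    (h : amb p = (rmul (amb q).1 c, rmul (amb q).2 c)) : M.mk p = M.mk q := by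
  have hc' : ‖c⁻¹‖ = 1 := by simp [hc]
  refine M.mk_eq_iff.2 ⟨scalarHom K n m ⟨c⁻¹, by simpa using hc'⟩, ⟨_, rfl⟩, ?_⟩
  have h' : amb (scalarHom K n m ⟨c⁻¹, by simpa using hc'⟩ • q) = amb p := by
    have : amb (scalarHom K n m ⟨c⁻¹, by simpa using hc'⟩ • q) =
        (rmul (amb q).1 c⁻¹⁻¹, rmul (amb q).2 c⁻¹⁻¹) := rfl
    rw [this, h, inv_inv]
  refine Prod.ext (Subtype.ext ?_) (Subtype.ext ?_)
  · exact congrArg Prod.fst h'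
  · exact congrArg Prod.snd h'

/-- The coordinate functions on `M`. -/
def M.coord : M K n m → Model K n m :=
  Quotient.lift (fun p => PscQuotient.coord (amb p)) (by
    intro p q h
    obtain ⟨z, hz, rfl⟩ := M.mk_eq_iff.1 (Quotient.sound h : M.mk p = M.mk q)
    obtain ⟨c, hc, h⟩ := exists_rmul_of_mem hz
    change PscQuotient.coord (amb (z • q)) = PscQuotient.coord (amb q)
    rw [h]
    exact coord_rmul (amb q) (by rintro rfl; simp at hc))

theorem M.coord_mk (p : Spheres K n m) : M.coord (M.mk p) = PscQuotient.coord (amb p) := rfl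

/-- The domain of the base chart: the classes `[x, y]` such that the zeroth entries of `x` and `y`
have positive real inner product. -/
def M.dom : Set (M K n m) := M.mk '' (amb ⁻¹' coordDom)

theorem M.mk_mem_dom {p : Spheres K n m} : M.mk p ∈ (M.dom : Set (M K n m)) ↔ amb p ∈ coordDom := by
  refine ⟨?_, fun h => ⟨p, h, rfl⟩⟩
  rintro ⟨q, hq, h⟩
  obtain ⟨z, hz, rfl⟩ := M.mk_eq_iff.1 h
  obtain ⟨c, hc, h'⟩ := exists_rmul_of_mem hz
  rw [Set.mem_preimage, h' p] at hq
  change 0 < ⟪rmul (amb p).1 c 0, rmul (amb p).2 c 0⟫ at hq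
  rw [inner_rmul_rmul, hc, one_pow, one_mul] at hq
  exact hq

/-- The chart of `M` at `[e₀, e₀]`. -/
def baseChart : OpenPartialHomeomorph (M K n m) (Model K n m) where
  toFun := M.coord
  invFun e := M.mk (param e)
  source := M.dom
  target := Set.univ
  map_source' _ _ := trivial
  map_target' e _ := M.mk_mem_dom.2 (nlift_mem e)
  left_inv' := by
    rintro _ ⟨p, hp, rfl⟩
    obtain ⟨z, hz, h⟩ := nlift_coord hp (by simp [amb]) (by simp [amb])
    exact mk_eq_of_rmul hz h
  right_inv' e _ := coord_nlift e
  open_source := M.isOpenQuotientMap_mk.isOpenMap _ (isOpen_coordDom.preimage continuous_amb)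
  open_target := isOpen_univ
  continuousOn_toFun := by
    rintro _ ⟨p, hp, rfl⟩
    refine ContinuousAt.continuousWithinAt ?_
    rw [← M.isOpenQuotientMap_mk.continuousAt_comp_iff]
    exact ((contDiffOn_coord.continuousOn.continuousAt (isOpen_coordDom.mem_nhds hp)).comp
      continuous_amb.continuousAt)
  continuousOn_invFun :=
    (M.isOpenQuotientMap_mk.continuous.comp continuous_param).continuousOn

variable (K n m) in
/-- The base point `[e₀, e₀]` of `M`. -/
def basePoint : M K n m := M.mk (⟨e₀ K n, by simp [norm_e₀]⟩, ⟨e₀ K m, by simp [norm_e₀]⟩)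

theorem basePoint_mem : basePoint K n m ∈ baseChart.source := by
  refine M.mk_mem_dom.2 ?_
  simp [coordDom, amb, e₀]

theorem exists_smul_basePoint (p : M K n m) : ∃ A : G K n m, A • basePoint K n m = p := by
  induction p using Quotient.inductionOn with | _ p
  obtain ⟨A, hA, hA'⟩ := exists_orth_apply_e₀ (p.1 : Vec K n) (by simp)
  obtain ⟨B, hB, hB'⟩ := exists_orth_apply_e₀ (p.2 : Vec K m) (by simp)
  refine ⟨⟨(A, B), mem_G_of_commute hA hB⟩, ?_⟩
  exact congrArg M.mk (Prod.ext (Subtype.ext hA') (Subtype.ext hB'))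

/-- The base chart translated by an element of `G(n,m)`. -/
def chart (A : G K n m) : OpenPartialHomeomorph (M K n m) (Model K n m) :=
  (Homeomorph.smul A⁻¹).toOpenPartialHomeomorph.trans baseChart

theorem chart_source (A : G K n m) : (chart A).source = {p | A⁻¹ • p ∈ M.dom} := by
  ext p
  simp [chart, baseChart]

theorem chart_apply (A : G K n m) (p : M K n m) : chart A p = M.coord (A⁻¹ • p) := rfl

theorem chart_symm_apply (A : G K n m) (e : Model K n m) :
    (chart A).symm e = A • M.mk (param e) := by
  change (A⁻¹)⁻¹ • M.mk (param e) = _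
  rw [inv_inv]

/-- An element of `G(n,m)` which maps the base point to `p`. -/
def moveTo (p : M K n m) : G K n m := (exists_smul_basePoint p).choose

theorem moveTo_smul (p : M K n m) : moveTo p • basePoint K n m = p :=
  (exists_smul_basePoint p).choose_spec

/-- The smooth atlas of `M`: the translates of the base chart under `G(n,m)`. The preferred chart
at `p` is centered at `p`. -/
instance : ChartedSpace (Model K n m) (M K n m) where
  atlas := Set.range chart
  chartAt p := chart (moveTo p)
  mem_chart_source p := by
    have : (moveTo p)⁻¹ • p = basePoint K n m := by
      rw [inv_smul_eq_iff, moveTo_smul]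
    simp [chart, this, basePoint_mem]
  chart_mem_atlas p := ⟨_, rfl⟩

theorem contDiffOn_coord_smul (A : Orth K n × Orth K m) :
    ContDiffOn ℝ ∞ (fun e : Model K n m => coord (amb (A • param e)))
      {e | amb (A • param e) ∈ coordDom} := by
  refine contDiffOn_coord.comp (t := coordDom) (f := fun e : Model K n m => amb (A • param e))
    ?_ fun e he => he
  refine ContDiff.contDiffOn ?_
  have h := contDiff_nlift (K := K) (n := n) (m := m)
  exact (A.1.toContinuousLinearEquiv.contDiff.comp (contDiff_fst.comp h)).prodMk
    (A.2.toContinuousLinearEquiv.contDiff.comp (contDiff_snd.comp h))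

instance : IsManifold 𝓘(ℝ, Model K n m) ∞ (M K n m) := by
  refine isManifold_of_contDiffOn _ _ _ ?_
  rintro _ _ ⟨A, rfl⟩ ⟨B, rfl⟩
  refine (contDiffOn_coord_smul ((B⁻¹ * A : G K n m) : Orth K n × Orth K m)).congr_mono ?_ ?_
  · intro e he
    change chart B ((chart A).symm e) = _
    rw [chart_symm_apply, chart_apply, smul_smul, smul_mk, M.coord_mk]
  · rintro e ⟨⟨-, he⟩, -⟩
    have he' : e ∈ (chart A).symm ⁻¹' (chart B).source := he
    rw [chart_source, Set.mem_preimage, chart_symm_apply, Set.mem_ofPred_eq, smul_smul, smul_mk,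
      M.mk_mem_dom] at he'
    exact he'

end Manifold

section Curvature

variable {E : Type*} [NormedAddCommGroup E] [NormedSpace ℝ E]

/-- The Koszul form of a metric `g` on an open subset of `E`,
`(u, v) ↦ (w ↦ (D_u g(v, w) + D_v g(u, w) - D_w g(u, v)) / 2)`. -/
def koszul (g : E → E →L[ℝ] E →L[ℝ] ℝ) (x : E) : E →L[ℝ] E →L[ℝ] E →L[ℝ] ℝ :=
  let D : E →L[ℝ] E →L[ℝ] E →L[ℝ] ℝ := fderiv ℝ g x
  let F : (E →L[ℝ] E →L[ℝ] ℝ) →L[ℝ] E →L[ℝ] E →L[ℝ] ℝ :=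
    (ContinuousLinearMap.flipₗᵢ ℝ E E ℝ).toContinuousLinearEquiv.toContinuousLinearMap
  (2⁻¹ : ℝ) • (D + D.flip - F.comp D.flip)

theorem koszul_apply (g : E → E →L[ℝ] E →L[ℝ] ℝ) (x u v w : E) :
    koszul g x u v w =
      2⁻¹ * (fderiv ℝ g x u v w + fderiv ℝ g x v u w - fderiv ℝ g x w u v) := rfl

/-- The Christoffel symbols `Γ(u, v)` of `g`, so that `∇_u V = D_u V + Γ(u, V)` is the Levi-Civita
connection. They are determined by `g(Γ(u, v), w) = koszul g (u, v, w)`. -/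
def christoffel (g : E → E →L[ℝ] E →L[ℝ] ℝ) (x : E) : E →L[ℝ] E →L[ℝ] E :=
  (ContinuousLinearMap.compL ℝ E (E →L[ℝ] ℝ) E (g x).inverse).comp (koszul g x)

theorem christoffel_apply (g : E → E →L[ℝ] E →L[ℝ] ℝ) (x u v : E) :
    christoffel g x u v = (g x).inverse (koszul g x u v) := rfl

/-- The Riemann curvature tensor, `R(u, v) w = ∇_u ∇_v w - ∇_v ∇_u w` for constant vector fields
`u`, `v`, `w`, as a linear map in `u`. -/
def riemann (g : E → E →L[ℝ] E →L[ℝ] ℝ) (x v w : E) : E →ₗ[ℝ] E where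
  toFun u := fderiv ℝ (christoffel g) x u v w - fderiv ℝ (christoffel g) x v u w +
    christoffel g x u (christoffel g x v w) - christoffel g x v (christoffel g x u w)
  map_add' a b := by
    simp only [map_add, add_apply]
    abel
  map_smul' c a := by
    simp only [map_smul, smul_apply, RingHom.id_apply, smul_sub, smul_add]

/-- The Ricci tensor `Ric(v, w)`, the trace of `u ↦ R(u, v) w`. -/
def ricci (g : E → E →L[ℝ] E →L[ℝ] ℝ) (x : E) : E →ₗ[ℝ] E →ₗ[ℝ] ℝ :=
  LinearMap.mk₂ ℝ (fun v w => LinearMap.trace ℝ E (riemann g x v w))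
    (fun a b w => by
      rw [← map_add]
      congr 1
      ext u
      simp only [riemann, LinearMap.coe_mk, AddHom.coe_mk, LinearMap.add_apply, map_add,
        add_apply]
      abel)
    (fun c a w => by
      rw [← map_smul]
      congr 1
      ext u
      simp only [riemann, LinearMap.coe_mk, AddHom.coe_mk, LinearMap.smul_apply, map_smul,
        smul_apply, smul_sub, smul_add])
    (fun v a b => by
      rw [← map_add]
      congr 1
      ext u
      simp only [riemann, LinearMap.coe_mk, AddHom.coe_mk, LinearMap.add_apply, map_add]
      abel)
    (fun c v a => by
      rw [← map_smul]
      congr 1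
      ext u
      simp only [riemann, LinearMap.coe_mk, AddHom.coe_mk, LinearMap.smul_apply, map_smul,
        smul_sub, smul_add])

variable [FiniteDimensional ℝ E]

/-- The scalar curvature at `x` of a metric `g` on an open subset of `E`: the trace with respect to
`g` of the Ricci tensor, that is the trace of the endomorphism `S` with `g(S v, w) = Ric(v, w)`. -/
def scalarCurvatureAt (g : E → E →L[ℝ] E →L[ℝ] ℝ) (x : E) : ℝ :=
  LinearMap.trace ℝ E ((g x).inverse.toLinearMap ∘ₗ
    LinearMap.toContinuousLinearMap.toLinearMap ∘ₗ ricci g x)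

end Curvature

section Metrics

variable {E : Type*} [NormedAddCommGroup E] [NormedSpace ℝ E]
  {X : Type*} [TopologicalSpace X] [ChartedSpace E X] [IsManifold 𝓘(ℝ, E) ∞ X]

variable (E X) in
/-- Smooth Riemannian metrics on the manifold `X`. -/
abbrev Metrics : Type _ :=
  Bundle.ContMDiffRiemannianMetric 𝓘(ℝ, E) ∞ E (fun x : X => TangentSpace 𝓘(ℝ, E) x)

/-- The expression of the metric `g` in the preferred chart at `p`: the pullback of `g` under the
inverse of this chart. -/
def inChart (g : Metrics E X) (p : X) (y : E) : E →L[ℝ] E →L[ℝ] ℝ :=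
  let B : E →L[ℝ] E →L[ℝ] ℝ := g.inner ((chartAt E p).symm y)
  let T : E →L[ℝ] E := mfderiv 𝓘(ℝ, E) 𝓘(ℝ, E) (chartAt E p).symm y
  B.bilinearComp T T

theorem inChart_apply (g : Metrics E X) (p : X) (y u v : E) :
    inChart g p y u v = g.inner ((chartAt E p).symm y)
      (mfderiv 𝓘(ℝ, E) 𝓘(ℝ, E) (chartAt E p).symm y u)
      (mfderiv 𝓘(ℝ, E) 𝓘(ℝ, E) (chartAt E p).symm y v) := rfl

/-- The scalar curvature of `g` at `p`, computed in the preferred chart at `p`. (The scalar curvature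
at a point does not depend on the chart.) -/
def scalarCurvature [FiniteDimensional ℝ E] (g : Metrics E X) (p : X) : ℝ :=
  scalarCurvatureAt (inChart g p) (chartAt E p p)

/-- The `C^∞` topology on the space of Riemannian metrics: uniform convergence of all derivatives of
the local expressions of the metrics on all compact subsets of the chart domains. -/
instance : TopologicalSpace (Metrics E X) :=
  ⨅ (p : X) (j : ℕ), TopologicalSpace.induced
    (fun g => UniformOnFun.ofFun {C | IsCompact C ∧ C ⊆ (chartAt E p).target}
      (iteratedFDeriv ℝ j (inChart g p)))
    inferInstance

/-- `g` is invariant under the action of the group `Γ` on `X`, that is every element of `Γ` acts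
isometrically. -/
def IsInvariant (Γ : Type*) [SMul Γ X] (g : Metrics E X) : Prop :=
  ∀ (γ : Γ) (p : X) (u v : TangentSpace 𝓘(ℝ, E) p),
    g.inner (γ • p) (mfderiv 𝓘(ℝ, E) 𝓘(ℝ, E) (fun q : X => γ • q) p u)
      (mfderiv 𝓘(ℝ, E) 𝓘(ℝ, E) (fun q : X => γ • q) p v) = g.inner p u v

variable (E X) in
/-- The space of `Γ`-invariant metrics of positive scalar curvature on `X`, with the
`C^∞` topology. -/
abbrev InvariantPscMetrics [FiniteDimensional ℝ E] (Γ : Type*) [SMul Γ X] : Type _ :=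
  {g : Metrics E X // IsInvariant Γ g ∧ ∀ p, 0 < scalarCurvature g p}

end Metrics

section Final

variable {K : Type*} [NormedDivisionRing K] [InnerProductSpace ℝ K]
  [IsScalarTower ℝ K K] [SMulCommClass ℝ K K] {n m : ℕ} [NeZero n] [NeZero m]

/-- The group `PG(n,m)` acts on `M` by smooth maps. -/
theorem contMDiff_smul (A : PG K n m) :
    ContMDiff 𝓘(ℝ, Model K n m) 𝓘(ℝ, Model K n m) ∞ (fun p : M K n m => A • p) := by
  induction A using QuotientGroup.induction_on with | _ A
  rw [contMDiff_iff]
  refine ⟨continuous_const_smul A, fun p q => ?_⟩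
  refine (contDiffOn_coord_smul
    (((moveTo q)⁻¹ * A * moveTo p : G K n m) : Orth K n × Orth K m)).congr_mono ?_ ?_
  · intro e he
    change chart (moveTo q) (A • (chart (moveTo p)).symm e) = _
    rw [chart_symm_apply, chart_apply, smul_smul, smul_smul, smul_mk, M.coord_mk]
  · rintro e ⟨-, he⟩
    rw [Set.mem_preimage, Set.mem_preimage, extChartAt_source] at he
    change A • (chart (moveTo p)).symm e ∈ (chart (moveTo q)).source at he
    rw [chart_source, chart_symm_apply, Set.mem_ofPred_eq, smul_smul, smul_smul, smul_mk,
      M.mk_mem_dom] at he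
    exact he

end Final

end PscQuotient

end

/-!
The group `PG(n,m)` acts transitively on `M`, so an invariant metric is determined by its value at
the base point `[e₀, e₀]`, an inner product on `Model = K ^ (n - 1) × K ^ (m - 1) × Im K` which is
invariant under the isotropy group. The isotropy group contains the sign changes of the first two
blocks, and up to sign it is transitive on the unit sphere of each block: on the first two blocks
because of the `K`-linear isometries fixing `e₀`, on `Im K` because of the conjugations by unit
scalars. Hence the inner product is a block form, `a`, `b` and `c` times the standard inner products
of the blocks with `a, b, c > 0` (`formAt_eq_blockForm`). Conversely, the normalizer of the unit
scalars preserves the `K`-lines of `e₀`, so every block form is invariant under the isotropy group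
(`blockForm_isotropy`). It extends to a smooth invariant metric, `homMetric`, because its
expression in the base chart can be computed by moving points to the base point with `K`-linear
isometries, which yields the explicit smooth formula `localForm` (`blockForm_fderiv_eq_localForm`).
The preferred charts of `M` are translates of the base chart, so this is the expression of the metric
in all of them.

The scalar curvature of such a metric is constant. At the base point it is a sum over pairs of basis
vectors of terms in the 2-jet of the metric (`scalarCurvatureAt_eq`), which is read off from
`localForm` (`linForm`, `quadForm`, `christoffel_localMetric`). The result is
`scalarCurvatureAt_localMetric`: for `k = dim K`, `N = k (n - 1)` and `N' = k (m - 1)`, the scalar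
curvature times `c` is

`N (N + 3 k - 4) s + N' (N' + 3 k - 4) t + (k - 1) (k - 2) - (k - 1) (N s ^ 2 + N' t ^ 2)`

with `s = c / a` and `t = c / b`. This is a concave function of `(s, t)`, so in the coordinates
`(c, s, t)` the parameters of the metrics of positive scalar curvature form a convex set
(`convex_pscParams`). The metric depends continuously on the parameters in the `C^∞` topology, since
its expression in the charts is linear in `a`, `b`, `c`; the parameters depend continuously on the
metric, since they are values of the metric at the base point. So the space of metrics is a retract
of a convex set, and it is contractible as soon as this set is nonempty
(`contractibleSpace_invariantPscMetrics`). (It is a retract only, because the parameter of a zero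
block, such as `Im K` for the real scalars, is not determined by the metric.) The convex set contains
the point `s = t = 1` if

`N (N + 2 k - 3) + N' (N' + 2 k - 3) + (k - 1) (k - 2) > 0`,

which holds for `n, m ≥ 3` if `k = 1`, for `n, m ≥ 2` if `k = 2`, and always if `k = 4`.
-/

noncomputable section

namespace PscQuotient

/-! ### Curvature in terms of the 2-jet of a metric -/

section CurvatureFormula

variable {E : Type*} [NormedAddCommGroup E] [NormedSpace ℝ E]

/-- Coordinates with respect to a basis which is orthogonal for the form `B`. -/
theorem apply_basis_of_orthogonal {ι : Type*} [Fintype ι] [DecidableEq ι]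
    (e : Module.Basis ι ℝ E) (B : E →L[ℝ] E →L[ℝ] ℝ) (l : ι → ℝ)
    (hB : ∀ i j, B (e i) (e j) = if i = j then l i else 0) (x : E) (i : ι) :
    B x (e i) = e.repr x i * l i := by
  conv_lhs => rw [← e.sum_repr x]
  simp only [map_sum, map_smul, sum_apply, smul_apply, hB, smul_eq_mul, mul_ite,
    mul_zero, Finset.sum_ite_eq', Finset.mem_univ, if_true]

/-- The trace in an orthogonal basis. The form `B` need not be symmetric or positive: only `l i ≠ 0`
is used. -/
theorem trace_eq_sum_of_orthogonal {ι : Type*} [Fintype ι] [DecidableEq ι]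
    (e : Module.Basis ι ℝ E) (B : E →L[ℝ] E →L[ℝ] ℝ) (l : ι → ℝ) (hl : ∀ i, l i ≠ 0)
    (hB : ∀ i j, B (e i) (e j) = if i = j then l i else 0) (f : E →ₗ[ℝ] E) :
    LinearMap.trace ℝ E f = ∑ i, (l i)⁻¹ * B (f (e i)) (e i) := by
  rw [LinearMap.trace_eq_matrix_trace ℝ e, Matrix.trace]
  refine Finset.sum_congr rfl fun i _ => ?_
  rw [apply_basis_of_orthogonal e B l hB, mul_comm (e.repr _ _), inv_mul_cancel_left₀ (hl i)]
  exact LinearMap.toMatrix_apply e e f i i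

theorem isInvertible_of_orthogonal [FiniteDimensional ℝ E] {ι : Type*} [Fintype ι] [DecidableEq ι]
    (e : Module.Basis ι ℝ E) (B : E →L[ℝ] E →L[ℝ] ℝ) (l : ι → ℝ) (hl : ∀ i, l i ≠ 0)
    (hB : ∀ i j, B (e i) (e j) = if i = j then l i else 0) : B.IsInvertible := by
  have hinj : Function.Injective B := by
    rw [injective_iff_map_eq_zero]
    intro x hx
    rw [← e.sum_repr x]
    refine Finset.sum_eq_zero fun i _ => ?_
    have h := apply_basis_of_orthogonal e B l hB x i
    rw [hx] at h
    have : e.repr x i = 0 := by simpa [hl i] using h.symm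
    simp [this]
  have hdim : Module.finrank ℝ E = Module.finrank ℝ (E →L[ℝ] ℝ) := by
    rw [← (LinearMap.toContinuousLinearMap (𝕜 := ℝ) (E := E) (F' := ℝ)).finrank_eq]
    exact (Subspace.dual_finrank_eq).symm
  refine ⟨(LinearEquiv.ofInjectiveOfFinrankEq B.toLinearMap hinj hdim).toContinuousLinearEquiv, ?_⟩
  ext x y
  rfl

section Christoffel

variable {g : E → E →L[ℝ] E →L[ℝ] ℝ} {x : E}

/-- The Christoffel symbols are defined with `ContinuousLinearMap.inverse`, which is zero at forms
that are not invertible; hence the hypothesis. -/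
theorem inner_christoffel (hinv : (g x).IsInvertible) (u v w : E) :
    g x (christoffel g x u v) w = koszul g x u v w := by
  rw [christoffel_apply, hinv.self_apply_inverse]

theorem fderiv_metric_symm (hg : DifferentiableAt ℝ g x) (hs : ∀ y u v, g y u v = g y v u)
    (z u v : E) : fderiv ℝ g x z u v = fderiv ℝ g x z v u := by
  have h (u v : E) : HasFDerivAt (fun y => g y u v)
      (((fderiv ℝ g x).flip u).flip v) x :=
    (hg.hasFDerivAt.clm_apply (hasFDerivAt_const u x)).clm_apply (hasFDerivAt_const v x)
      |>.congr_fderiv (by ext; simp)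
  have := (h u v).unique ((h v u).congr_of_eventuallyEq (.of_forall fun y => hs y u v))
  exact congrArg (fun f => f z) this

/-- The Levi-Civita connection is metric. -/
theorem fderiv_metric_eq (hg : DifferentiableAt ℝ g x) (hs : ∀ y u v, g y u v = g y v u)
    (hinv : (g x).IsInvertible) (z u v : E) :
    fderiv ℝ g x z u v = g x (christoffel g x z u) v + g x (christoffel g x z v) u := by
  rw [inner_christoffel hinv, inner_christoffel hinv, koszul_apply, koszul_apply,
    fderiv_metric_symm hg hs z v u, fderiv_metric_symm hg hs u z v, fderiv_metric_symm hg hs v z u]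
  ring

theorem koszul_symm (hg : DifferentiableAt ℝ g x) (hs : ∀ y u v, g y u v = g y v u) (u v w : E) :
    koszul g x u v w = koszul g x v u w := by
  rw [koszul_apply, koszul_apply, fderiv_metric_symm hg hs w u v]
  ring

theorem differentiableAt_koszul (hg : ContDiffAt ℝ 2 g x) : DifferentiableAt ℝ (koszul g) x := by
  have h : DifferentiableAt ℝ (fderiv ℝ g) x :=
    (hg.fderiv_right (m := 1) (by norm_num)).differentiableAt one_ne_zero
  have h2 : DifferentiableAt ℝ (fun y => (fderiv ℝ g y).flip) x :=
    (ContinuousLinearMap.flipₗᵢ ℝ E E (E →L[ℝ] ℝ)).toContinuousLinearEquiv.differentiableAt.comp x h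
  have h3 := (h.add h2).sub ((differentiableAt_const
    (ContinuousLinearMap.flipₗᵢ ℝ E E ℝ).toContinuousLinearEquiv.toContinuousLinearMap).clm_comp h2)
  exact h3.const_smul (2⁻¹ : ℝ)

theorem differentiableAt_christoffel [CompleteSpace E] (hg : ContDiffAt ℝ 2 g x)
    (hinv : (g x).IsInvertible) : DifferentiableAt ℝ (christoffel g) x := by
  unfold christoffel
  have h1 : DifferentiableAt ℝ (fun y => (g y).inverse) x :=
    ((hinv.contDiffAt_map_inverse (n := 1)).differentiableAt one_ne_zero).comp x
      (hg.differentiableAt two_ne_zero)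
  exact (((ContinuousLinearMap.compL ℝ E (E →L[ℝ] ℝ) E).differentiableAt).comp x h1).clm_comp
    (differentiableAt_koszul hg)

/-- The derivative of the Koszul form in terms of the second derivative of the metric. It is
symmetric in `u`, `v` even before the two derivatives are interchanged. -/
theorem fderiv_koszul_apply (hg : ContDiffAt ℝ 2 g x) (z u v w : E) :
    fderiv ℝ (fun y => koszul g y u v w) x z =
      2⁻¹ * (fderiv ℝ (fderiv ℝ g) x z u v w + fderiv ℝ (fderiv ℝ g) x z v u w -
        fderiv ℝ (fderiv ℝ g) x z w u v) := by
  have h : DifferentiableAt ℝ (fderiv ℝ g) x :=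
    (hg.fderiv_right (m := 1) (by norm_num)).differentiableAt one_ne_zero
  have h' (u v w : E) : HasFDerivAt (fun y => fderiv ℝ g y u v w)
      ((((fderiv ℝ (fderiv ℝ g) x).flip u).flip v).flip w) x :=
    ((h.hasFDerivAt.clm_apply (hasFDerivAt_const u x)).clm_apply
      (hasFDerivAt_const v x)).clm_apply (hasFDerivAt_const w x) |>.congr_fderiv
      (by ext; simp)
  have := (((h' u v w).add (h' v u w)).sub (h' w u v)).const_mul 2⁻¹
  change HasFDerivAt (fun y => koszul g y u v w) _ x at this
  rw [this.fderiv]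
  rfl

/-- The derivative of the identity `g(Γ(u, v), w) = koszul g (u, v, w)`, which expresses the
derivative of the Christoffel symbols by the second derivative of the metric. -/
theorem inner_fderiv_christoffel [CompleteSpace E] (hg : ContDiffAt ℝ 2 g x)
    (hinv : (g x).IsInvertible) (z u v w : E) :
    fderiv ℝ g x z (christoffel g x u v) w + g x (fderiv ℝ (christoffel g) x z u v) w =
      2⁻¹ * (fderiv ℝ (fderiv ℝ g) x z u v w + fderiv ℝ (fderiv ℝ g) x z v u w -
        fderiv ℝ (fderiv ℝ g) x z w u v) := by
  rw [← fderiv_koszul_apply hg]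
  have hd := (differentiableAt_christoffel hg hinv).hasFDerivAt
  have h := (((hg.differentiableAt two_ne_zero).hasFDerivAt).clm_apply
    ((hd.clm_apply (hasFDerivAt_const u x)).clm_apply (hasFDerivAt_const v x))).clm_apply
    (hasFDerivAt_const w x)
  -- the identity to be differentiated holds only where `g` is invertible, which is an open
  -- condition
  have hev : ∀ᶠ y in nhds x, (g y).IsInvertible := by
    obtain ⟨f, hf⟩ := hinv
    have hn : Set.range ((↑) : (E ≃L[ℝ] (E →L[ℝ] ℝ)) → _) ∈ nhds (g x) :=
      hf ▸ ContinuousLinearEquiv.nhds f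
    exact hg.continuousAt.eventually hn
  have h2 := h.congr_of_eventuallyEq (f₁ := fun y => koszul g y u v w)
    (hev.mono fun y hy => (inner_christoffel hy u v w).symm)
  rw [h2.fderiv]
  simp
  ring

/-- The curvature tensor in terms of the `2`-jet of the metric. -/
theorem inner_riemann [CompleteSpace E] (hg : ContDiffAt ℝ 2 g x)
    (hs : ∀ y u v, g y u v = g y v u) (hinv : (g x).IsInvertible) (u v w z : E) :
    g x (riemann g x v w u) z =
      2⁻¹ * (fderiv ℝ (fderiv ℝ g) x u w v z - fderiv ℝ (fderiv ℝ g) x u z v w -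
        fderiv ℝ (fderiv ℝ g) x v w u z + fderiv ℝ (fderiv ℝ g) x v z u w) -
      g x (christoffel g x v w) (christoffel g x u z) +
      g x (christoffel g x u w) (christoffel g x v z) := by
  have hd := hg.differentiableAt two_ne_zero
  have h1 := inner_fderiv_christoffel hg hinv u v w z
  have h2 := inner_fderiv_christoffel hg hinv v u w z
  rw [fderiv_metric_eq hd hs hinv] at h1 h2
  have hsym := (hg.isSymmSndFDerivAt (by simp)).eq u v
  have e1 : fderiv ℝ (fderiv ℝ g) x v u w z = fderiv ℝ (fderiv ℝ g) x u v w z := by rw [hsym]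
  rw [e1] at h2
  rw [hs x (christoffel g x u z)] at h1
  rw [hs x (christoffel g x v z)] at h2
  simp only [riemann, LinearMap.coe_mk, AddHom.coe_mk, map_add, map_sub, add_apply, sub_apply]
  linarith

end Christoffel

/-- The scalar curvature in terms of the `2`-jet of the metric at a point and a basis which is
orthogonal at this point. -/
theorem scalarCurvatureAt_eq [FiniteDimensional ℝ E] {g : E → E →L[ℝ] E →L[ℝ] ℝ} {x : E}
    (hg : ContDiffAt ℝ 2 g x) (hs : ∀ y u v, g y u v = g y v u)
    {ι : Type*} [Fintype ι] [DecidableEq ι] (e : Module.Basis ι ℝ E) (l : ι → ℝ)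
    (hl : ∀ i, l i ≠ 0) (hB : ∀ i j, g x (e i) (e j) = if i = j then l i else 0) :
    scalarCurvatureAt g x = ∑ i, ∑ j, (l i)⁻¹ * (l j)⁻¹ *
      (fderiv ℝ (fderiv ℝ g) x (e i) (e j) (e i) (e j) -
        fderiv ℝ (fderiv ℝ g) x (e i) (e i) (e j) (e j) +
        g x (christoffel g x (e i) (e j)) (christoffel g x (e i) (e j)) -
        g x (christoffel g x (e i) (e i)) (christoffel g x (e j) (e j))) := by
  have : CompleteSpace E := FiniteDimensional.complete ℝ E
  have hinv := isInvertible_of_orthogonal e (g x) l hl hB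
  have hΓ (u v : E) : christoffel g x u v = christoffel g x v u := by
    rw [christoffel_apply, christoffel_apply]
    congr 1
    ext w
    exact koszul_symm (hg.differentiableAt two_ne_zero) hs u v w
  -- `D² g` is symmetric in the two directions (`hsym`) and in the two arguments (`hsym'`)
  have hsym (u v w z : E) : fderiv ℝ (fderiv ℝ g) x u v w z = fderiv ℝ (fderiv ℝ g) x v u w z := by
    rw [(hg.isSymmSndFDerivAt (by simp)).eq u v]
  have hsym' (u v w z : E) :
      fderiv ℝ (fderiv ℝ g) x u v w z = fderiv ℝ (fderiv ℝ g) x u v z w := by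
    have hd : DifferentiableAt ℝ (fderiv ℝ g) x :=
      (hg.fderiv_right (m := 1) (by norm_num)).differentiableAt one_ne_zero
    have hev : ∀ᶠ y in nhds x, DifferentiableAt ℝ g y :=
      (hg.eventually (by simp)).mono fun y hy => hy.differentiableAt two_ne_zero
    have h (w z : E) : HasFDerivAt (fun y => fderiv ℝ g y v w z)
        ((((fderiv ℝ (fderiv ℝ g) x).flip v).flip w).flip z) x :=
      ((hd.hasFDerivAt.clm_apply (hasFDerivAt_const v x)).clm_apply
        (hasFDerivAt_const w x)).clm_apply (hasFDerivAt_const z x) |>.congr_fderiv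
        (by ext; simp)
    have := (h w z).unique ((h z w).congr_of_eventuallyEq
      (hev.mono fun y hy => fderiv_metric_symm hy hs v w z))
    exact congrArg (fun f => f u) this
  have h1 : scalarCurvatureAt g x = ∑ j, ∑ i, (l i)⁻¹ * (l j)⁻¹ *
      g x (riemann g x (e j) (e j) (e i)) (e i) := by
    rw [scalarCurvatureAt, trace_eq_sum_of_orthogonal e (g x) l hl hB]
    refine Finset.sum_congr rfl fun j _ => ?_
    have : g x (((g x).inverse.toLinearMap ∘ₗ
        LinearMap.toContinuousLinearMap.toLinearMap ∘ₗ ricci g x) (e j)) (e j) =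
        ricci g x (e j) (e j) := by
      simp only [LinearMap.comp_apply, ContinuousLinearMap.coe_coe, hinv.self_apply_inverse]
      rfl
    rw [this, show ricci g x (e j) (e j) = LinearMap.trace ℝ E (riemann g x (e j) (e j)) from rfl,
      trace_eq_sum_of_orthogonal e (g x) l hl hB, Finset.mul_sum]
    refine Finset.sum_congr rfl fun i _ => ?_
    ring
  rw [h1]
  simp only [inner_riemann hg hs hinv]
  -- the curvature involves the mean of `D² g (eᵢ, eᵢ)(eⱼ, eⱼ)` and `D² g (eⱼ, eⱼ)(eᵢ, eᵢ)`, whose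
  -- double sums agree
  have h2 : (∑ i, ∑ j, (l i)⁻¹ * (l j)⁻¹ * fderiv ℝ (fderiv ℝ g) x (e i) (e i) (e j) (e j)) =
      ∑ i, ∑ j, (l i)⁻¹ * (l j)⁻¹ * (2⁻¹ * (fderiv ℝ (fderiv ℝ g) x (e i) (e i) (e j) (e j) +
        fderiv ℝ (fderiv ℝ g) x (e j) (e j) (e i) (e i))) := by
    have h3 : (∑ i, ∑ j, (l i)⁻¹ * (l j)⁻¹ * fderiv ℝ (fderiv ℝ g) x (e i) (e i) (e j) (e j)) =
      ∑ i, ∑ j, (l i)⁻¹ * (l j)⁻¹ * fderiv ℝ (fderiv ℝ g) x (e j) (e j) (e i) (e i) := by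
      rw [Finset.sum_comm]
      refine Finset.sum_congr rfl fun i _ => Finset.sum_congr rfl fun j _ => ?_
      ring
    have h4 := congrArg (fun t => 2⁻¹ * t) h3
    simp only [Finset.mul_sum] at h4
    simp only [mul_add, Finset.sum_add_distrib]
    have h5 (f : ι → ι → ℝ) : (∑ i, ∑ j, (l i)⁻¹ * (l j)⁻¹ * (2⁻¹ * f i j)) =
        2⁻¹ * ∑ i, ∑ j, (l i)⁻¹ * (l j)⁻¹ * f i j := by
      simp only [Finset.mul_sum]
      refine Finset.sum_congr rfl fun i _ => Finset.sum_congr rfl fun j _ => ?_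
      ring
    rw [h5, h5, ← h3]
    ring
  rw [Finset.sum_comm]
  simp only [mul_add, mul_sub, Finset.sum_add_distrib, Finset.sum_sub_distrib] at h2 ⊢
  rw [h2]
  simp only [← Finset.sum_add_distrib, ← Finset.sum_sub_distrib]
  refine Finset.sum_congr rfl fun i _ => Finset.sum_congr rfl fun j _ => ?_
  rw [hsym (e j) (e i) (e i) (e j), hsym' (e i) (e j) (e j) (e i), hΓ (e j) (e i),
    hs x (christoffel g x (e j) (e j))]
  ring

end CurvatureFormula

/-! ### Linearization of the base chart and of the action -/

section Linearization

variable {K : Type*} [NormedDivisionRing K] [InnerProductSpace ℝ K]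
  [IsScalarTower ℝ K K] [SMulCommClass ℝ K K] [FiniteDimensional ℝ K]
  {n m : ℕ} [NeZero n] [NeZero m]

/-- The linear part of the affine map `lift`. -/
def dlift : Model K n m →L[ℝ] Vec K n × Vec K m :=
  LinearMap.toContinuousLinearMap
    { toFun := fun u => (WithLp.toLp 2 fun i => if h : i ≠ 0 then u.1 ⟨i, h⟩ else 0,
        WithLp.toLp 2 fun i => if h : i ≠ 0 then u.2.1 ⟨i, h⟩ else (u.2.2 : K))
      map_add' := fun u v => by
        refine Prod.ext ?_ ?_ <;> ext i <;> by_cases h : i = 0 <;> simp [h]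
      map_smul' := fun c v => by
        refine Prod.ext ?_ ?_ <;> ext i <;> by_cases h : i = 0 <;> simp [h] }

theorem dlift_apply (u : Model K n m) :
    dlift u = (WithLp.toLp 2 fun i => if h : i ≠ 0 then u.1 ⟨i, h⟩ else 0,
        WithLp.toLp 2 fun i => if h : i ≠ 0 then u.2.1 ⟨i, h⟩ else (u.2.2 : K)) := rfl

@[simp] theorem dlift_fst_zero (u : Model K n m) : (dlift u).1 0 = 0 := by simp [dlift_apply]

@[simp] theorem dlift_snd_zero (u : Model K n m) : (dlift u).2 0 = u.2.2 := by simp [dlift_apply]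

@[simp] theorem dlift_fst_coe (u : Model K n m) (i : {i : Fin n // i ≠ 0}) :
    (dlift u).1 i = u.1 i := by simp [dlift_apply, i.2]

@[simp] theorem dlift_snd_coe (u : Model K n m) (i : {i : Fin m // i ≠ 0}) :
    (dlift u).2 i = u.2.1 i := by simp [dlift_apply, i.2]

theorem e₀_zero : e₀ K n 0 = 1 := by simp [e₀]

theorem e₀_of_ne {i : Fin n} (h : i ≠ 0) : e₀ K n i = 0 := by simp [e₀, h]

theorem lift_eq (e : Model K n m) : lift e = (e₀ K n, e₀ K m) + dlift e := by
  refine Prod.ext ?_ ?_ <;> ext i <;> by_cases h : i = 0 <;> simp [lift, dlift_apply, h, e₀]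

/-- The derivative of the coordinate functions `coord` at the pair `(e₀, e₀)`. -/
def dcoord : Vec K n × Vec K m →L[ℝ] Model K n m :=
  LinearMap.toContinuousLinearMap
    { toFun := fun p => (fun i => p.1 i, fun i => p.2 i,
        (Im K).orthogonalProjectionOnto (p.2 0 - p.1 0))
      map_add' := fun u v => by
        refine Prod.ext rfl (Prod.ext rfl ?_)
        simp only [Prod.fst_add, Prod.snd_add, PiLp.add_apply]
        rw [← map_add]
        congr 1
        abel
      map_smul' := fun c v => by
        refine Prod.ext rfl (Prod.ext rfl ?_)
        simp only [Prod.smul_fst, Prod.smul_snd, PiLp.smul_apply, ← smul_sub, map_smul]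
        rfl }

theorem dcoord_apply (p : Vec K n × Vec K m) :
    dcoord p = (fun i : {i : Fin n // i ≠ 0} => p.1 i, fun i : {i : Fin m // i ≠ 0} => p.2 i,
        (Im K).orthogonalProjectionOnto (p.2 0 - p.1 0)) := rfl

/-- `dlift` identifies the model space with a complement of the kernel of `dcoord`. -/
theorem dcoord_dlift (u : Model K n m) : dcoord (dlift u) = u := by
  refine Prod.ext ?_ (Prod.ext ?_ ?_)
  · funext i; simp [dcoord_apply]
  · funext i; simp [dcoord_apply]
  · simp [dcoord_apply]

theorem conj_smul (r : ℝ) (x : K) : conj (r • x) = r • conj x := by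
  simp only [conj, inner_smul_right, smul_sub, smul_smul]
  congr 2
  ring

theorem herm_smul_left (r : ℝ) (u x : Vec K n) : herm (r • u) x = r • herm u x := by
  simp only [herm, PiLp.smul_apply, conj_smul, smul_mul_assoc, Finset.smul_sum]

theorem conj_one : conj (1 : K) = 1 := by
  simp [conj, two_smul]

theorem herm_e₀ (x : Vec K n) : herm (e₀ K n) x = x 0 := by
  rw [herm, Finset.sum_eq_single 0]
  · rw [e₀_zero, conj_one, one_mul]
  · intro i _ hi
    rw [e₀_of_ne hi]
    simp [conj]
  · simp

/-- `K`-linear isometries preserve the Hermitian product, since it is determined by the real inner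
product and the scalar multiplication. -/
theorem herm_map {A : Orth K n} (hA : ∀ x z, A (rmul x z) = rmul (A x) z) (u x : Vec K n) :
    herm (A u) (A x) = herm u x := by
  refine ext_inner_left ℝ fun t => ?_
  rw [← inner_rmul, ← inner_rmul, ← hA, LinearIsometryEquiv.inner_map_map]

/-- The coordinate functions do not change under independent real rescalings of the two vectors. -/
theorem coord_smul_smul (p : Vec K n × Vec K m) {s t : ℝ} (hs : s ≠ 0) (ht : t ≠ 0) :
    coord (s • p.1, t • p.2) = coord p := by
  have hinv : (s • p.1 0)⁻¹ = s⁻¹ • (p.1 0)⁻¹ := by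
    by_cases h : p.1 0 = 0
    · simp [h]
    · apply inv_eq_of_mul_eq_one_left
      rw [smul_mul_smul_comm, inv_mul_cancel₀ hs, inv_mul_cancel₀ h, one_smul]
  have key (x : ℝ) : (t * s⁻¹ * x)⁻¹ * (t * s⁻¹) = x⁻¹ := by
    rw [mul_inv, mul_comm, mul_inv_cancel_left₀ (mul_ne_zero ht (inv_ne_zero hs))]
  refine Prod.ext ?_ (Prod.ext ?_ ?_)
  · funext i
    simp [coord, hinv, smul_mul_smul_comm, hs]
  · funext i
    simp only [coord, PiLp.smul_apply, hinv, smul_mul_smul_comm, inner_smul_right, smul_smul, key]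
  · simp only [coord, PiLp.smul_apply, hinv, smul_mul_smul_comm, inner_smul_right, smul_smul, key,
      map_smul]

/-- The normalization in `nlift` is invisible to `coord`, so that the action can be computed on the
affine section `lift`. -/
theorem coord_nlift_map (A : Orth K n × Orth K m) (e : Model K n m) :
    coord (A.1 (nlift e).1, A.2 (nlift e).2) = coord (A.1 (lift e).1, A.2 (lift e).2) := by
  rw [nlift, map_smul, map_smul]
  exact coord_smul_smul (A.1 (lift e).1, A.2 (lift e).2)
    (inv_ne_zero (norm_ne_zero_iff.2 (lift_fst_ne_zero e)))
    (inv_ne_zero (norm_ne_zero_iff.2 (lift_snd_ne_zero e)))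

theorem e₀_mem_coordDom : ((e₀ K n, e₀ K m) : Vec K n × Vec K m) ∈ coordDom := by
  simp [coordDom, e₀]

theorem coord_lift (e : Model K n m) : coord (lift e) = e := by
  have := coord_nlift_map (1 : Orth K n × Orth K m) e
  exact this.symm.trans (coord_nlift e)

/-- The derivative of `coord` at `(e₀, e₀)` is `dcoord`: both are left inverse to `dlift`, and both
vanish on the tangent space of the orbit of `(e₀, e₀)` under the scalars and the real rescalings. -/
theorem hasFDerivAt_coord :
    HasFDerivAt (coord : Vec K n × Vec K m → Model K n m) dcoord (e₀ K n, e₀ K m) := by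
  have hd : DifferentiableAt ℝ (coord : Vec K n × Vec K m → Model K n m) (e₀ K n, e₀ K m) :=
    (contDiffOn_coord.contDiffAt (isOpen_coordDom.mem_nhds e₀_mem_coordDom)).differentiableAt
      (by simp)
  have hline (w : Vec K n × Vec K m) :
      HasDerivAt (fun t : ℝ => coord ((e₀ K n, e₀ K m) + t • w))
        (fderiv ℝ (coord : _ → Model K n m) (e₀ K n, e₀ K m) w) 0 := by
    have h : HasDerivAt (fun t : ℝ => (e₀ K n, e₀ K m) + t • w) w 0 := by
      simpa using ((hasDerivAt_id (0 : ℝ)).smul_const w).const_add (e₀ K n, e₀ K m)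
    exact HasFDerivAt.comp_hasDerivAt_of_eq 0 hd.hasFDerivAt h (by simp)
  have h1 (u : Model K n m) :
      fderiv ℝ (coord : _ → Model K n m) (e₀ K n, e₀ K m) (dlift u) = u := by
    refine (hline (dlift u)).unique ?_
    have h : (fun t : ℝ => coord ((e₀ K n, e₀ K m) + t • dlift u)) = fun t : ℝ => t • u := by
      funext t
      rw [← map_smul, ← lift_eq, coord_lift]
    rw [h]
    simpa using (hasDerivAt_id (0 : ℝ)).smul_const u
  have h2 (z : K) : fderiv ℝ (coord : _ → Model K n m) (e₀ K n, e₀ K m)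
      (rmul (e₀ K n) z, rmul (e₀ K m) z) = 0 := by
    refine (hline _).unique ?_
    refine (hasDerivAt_const (0 : ℝ) (coord (e₀ K n, e₀ K m))).congr_of_eventuallyEq ?_
    have : ∀ᶠ t : ℝ in nhds 0, (1 : K) + t • z ≠ 0 := by
      refine ContinuousAt.eventually_ne (by fun_prop) ?_
      simp
    filter_upwards [this] with t ht
    rw [← coord_rmul (e₀ K n, e₀ K m) ht]
    congr 1
    refine Prod.ext ?_ ?_ <;> ext i <;> simp [rmul, mul_add, mul_smul_comm]
  have h3 (r : ℝ) : fderiv ℝ (coord : _ → Model K n m) (e₀ K n, e₀ K m)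
      (0, r • e₀ K m) = 0 := by
    refine (hline _).unique ?_
    refine (hasDerivAt_const (0 : ℝ) (coord (e₀ K n, e₀ K m))).congr_of_eventuallyEq ?_
    have : ∀ᶠ t : ℝ in nhds 0, 1 + t * r ≠ 0 := by
      refine ContinuousAt.eventually_ne (by fun_prop) ?_
      simp
    filter_upwards [this] with t ht
    rw [← coord_smul_smul (e₀ K n, e₀ K m) one_ne_zero ht]
    congr 1
    refine Prod.ext ?_ ?_
    · simp
    · simp [add_smul, smul_smul]
  refine hd.hasFDerivAt.congr_fderiv (ContinuousLinearMap.ext fun p => ?_)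
  -- split `p` into a vector along the orbit of the scalars, a rescaling of the second vector, and a
  -- vector tangent to the affine section `lift`
  have hp : p = (rmul (e₀ K n) (p.1 0), rmul (e₀ K m) (p.1 0)) +
      (0, ⟪1, p.2 0 - p.1 0⟫ • e₀ K m) + dlift (dcoord p) := by
    refine Prod.ext ?_ ?_
    · ext i
      by_cases h : i = 0
      · subst h; simp [rmul, e₀_zero]
      · simp [rmul, e₀_of_ne h, dlift_apply, h, dcoord_apply]
    · ext i
      by_cases h : i = 0
      · subst h
        have := real_add_im (p.2 0 - p.1 0)
        simp only [Prod.snd_add, PiLp.add_apply, rmul, e₀_zero, one_mul, PiLp.smul_apply,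
          dlift_snd_zero, dcoord_apply, add_assoc, this]
        abel
      · simp [rmul, e₀_of_ne h, dlift_apply, h, dcoord_apply]
  conv_lhs => rw [hp]
  rw [map_add, map_add, h1, h2, h3, zero_add, zero_add]

/-- The action of a pair of orthogonal maps in the coordinates of the base chart. -/
def coordAct (A : Orth K n × Orth K m) (e : Model K n m) : Model K n m := coord (amb (A • param e))

theorem coordAct_eq (A : Orth K n × Orth K m) (e : Model K n m) :
    coordAct A e = coord (A.1 (lift e).1, A.2 (lift e).2) := coord_nlift_map A e

/-- A pair of linear isometries as a linear map of the ambient space. -/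
def pairMap (A : Orth K n × Orth K m) : Vec K n × Vec K m →L[ℝ] Vec K n × Vec K m :=
  (A.1.toContinuousLinearEquiv : Vec K n →L[ℝ] Vec K n).prodMap
    (A.2.toContinuousLinearEquiv : Vec K m →L[ℝ] Vec K m)

theorem pairMap_apply (A : Orth K n × Orth K m) (p : Vec K n × Vec K m) :
    pairMap A p = (A.1 p.1, A.2 p.2) := rfl

/-- A pair of linear isometries followed by independent rescalings. -/
def scaledMap (A : Orth K n × Orth K m) (r s : ℝ) : Vec K n × Vec K m →L[ℝ] Vec K n × Vec K m :=
  (r • (A.1.toContinuousLinearEquiv : Vec K n →L[ℝ] Vec K n)).prodMap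
    (s • (A.2.toContinuousLinearEquiv : Vec K m →L[ℝ] Vec K m))

theorem scaledMap_apply (A : Orth K n × Orth K m) (r s : ℝ) (p : Vec K n × Vec K m) :
    scaledMap A r s p = (r • A.1 p.1, s • A.2 p.2) := rfl

/-- The derivative of the coordinate action at a point which is mapped to the base point. -/
theorem hasFDerivAt_coordAct (A : Orth K n × Orth K m) (y : Model K n m) {r s : ℝ} (hr : r ≠ 0)
    (hs : s ≠ 0) (h1 : A.1 (lift y).1 = r • e₀ K n) (h2 : A.2 (lift y).2 = s • e₀ K m) :
    HasFDerivAt (coordAct A) (dcoord ∘L scaledMap A r⁻¹ s⁻¹ ∘L dlift) y := by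
  have he : coordAct A = fun e => coord (scaledMap A r⁻¹ s⁻¹ ((e₀ K n, e₀ K m) + dlift e)) := by
    funext e
    rw [coordAct_eq, ← lift_eq, scaledMap_apply]
    exact (coord_smul_smul (A.1 (lift e).1, A.2 (lift e).2) (inv_ne_zero hr) (inv_ne_zero hs)).symm
  have hy : scaledMap A r⁻¹ s⁻¹ ((e₀ K n, e₀ K m) + dlift y) = (e₀ K n, e₀ K m) := by
    rw [← lift_eq, scaledMap_apply, h1, h2, smul_smul, smul_smul, inv_mul_cancel₀ hr,
      inv_mul_cancel₀ hs, one_smul, one_smul]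
  generalize scaledMap A r⁻¹ s⁻¹ = W at he hy
  have h0 : HasFDerivAt (fun e : Model K n m => (e₀ K n, e₀ K m) + dlift e) dlift y :=
    ((dlift (K := K) (n := n) (m := m)).hasFDerivAt (x := y)).const_add (e₀ K n, e₀ K m)
  have hl : HasFDerivAt (fun e : Model K n m => W ((e₀ K n, e₀ K m) + dlift e)) (W ∘L dlift) y :=
    (W.hasFDerivAt (x := (e₀ K n, e₀ K m) + dlift y)).comp y h0
  have hc : HasFDerivAt (coord : Vec K n × Vec K m → Model K n m) dcoord
      (W ((e₀ K n, e₀ K m) + dlift y)) := by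
    have h := hasFDerivAt_coord (K := K) (n := n) (m := m)
    rwa [← hy] at h
  rw [he]
  exact hc.comp y hl

theorem lift_zero : lift (0 : Model K n m) = (e₀ K n, e₀ K m) := by simp [lift_eq]

/-- A pair of isometries which fixes the pair `(e₀, e₀)` acts on the chart with derivative
`dcoord ∘ A ∘ dlift` at the origin. -/
theorem hasFDerivAt_coordAct_zero (A : Orth K n × Orth K m) (h1 : A.1 (e₀ K n) = e₀ K n)
    (h2 : A.2 (e₀ K m) = e₀ K m) :
    HasFDerivAt (coordAct A) (dcoord ∘L pairMap A ∘L dlift) 0 := by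
  have h := hasFDerivAt_coordAct A 0 one_ne_zero one_ne_zero (by simp [lift_zero, h1])
    (by simp [lift_zero, h2])
  have hA : scaledMap A 1⁻¹ 1⁻¹ = pairMap A := by
    refine ContinuousLinearMap.ext fun p => ?_
    simp [scaledMap_apply, pairMap_apply]
  rwa [hA] at h

end Linearization

/-! ### Block forms and the isotropy representation -/

section BlockForm

variable {K : Type*} [NormedDivisionRing K] [InnerProductSpace ℝ K]
  [IsScalarTower ℝ K K] [SMulCommClass ℝ K K] [FiniteDimensional ℝ K]
  {n m : ℕ} [NeZero n] [NeZero m]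

variable (K n m) in
/-- The inner product on the model space whose restrictions to the three blocks are the multiples
by `a`, `b` and `c` of the standard inner products. -/
def blockForm (a b c : ℝ) : Model K n m →L[ℝ] Model K n m →L[ℝ] ℝ :=
  LinearMap.toContinuousLinearMap (LinearMap.toContinuousLinearMap.toLinearMap ∘ₗ
    LinearMap.mk₂ ℝ (fun u v : Model K n m =>
        a * ∑ i, ⟪u.1 i, v.1 i⟫ + b * ∑ i, ⟪u.2.1 i, v.2.1 i⟫ + c * ⟪u.2.2, v.2.2⟫)
      (fun u u' v => by
        simp only [Prod.fst_add, Prod.snd_add, Pi.add_apply, inner_add_left,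
          Finset.sum_add_distrib]
        ring)
      (fun r u v => by
        simp only [Prod.smul_fst, Prod.smul_snd, Pi.smul_apply, real_inner_smul_left,
          ← Finset.mul_sum, smul_eq_mul]
        ring)
      (fun u v v' => by
        simp only [Prod.fst_add, Prod.snd_add, Pi.add_apply, inner_add_right,
          Finset.sum_add_distrib]
        ring)
      (fun r u v => by
        simp only [Prod.smul_fst, Prod.smul_snd, Pi.smul_apply, real_inner_smul_right,
          ← Finset.mul_sum, smul_eq_mul]
        ring))

theorem blockForm_apply (a b c : ℝ) (u v : Model K n m) :
    blockForm K n m a b c u v =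
      a * ∑ i, ⟪u.1 i, v.1 i⟫ + b * ∑ i, ⟪u.2.1 i, v.2.1 i⟫ + c * ⟪u.2.2, v.2.2⟫ := rfl

/-- A sum over the nonzero indices as a sum over all indices minus the zeroth term. -/
theorem sum_ne_zero_add {l : ℕ} [NeZero l] (f : Fin l → ℝ) :
    ∑ i : {i : Fin l // i ≠ 0}, f i = ∑ i, f i - f 0 := by
  have h := Fintype.sum_subtype_add_sum_subtype (fun i : Fin l => i ≠ 0) f
  have : ∑ i : {i : Fin l // ¬ i ≠ 0}, f i = f 0 := by
    have : Unique {i : Fin l // ¬ i ≠ 0} :=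
      ⟨⟨⟨0, by simp⟩⟩, fun i => Subtype.ext (by simpa using i.2)⟩
    rw [Fintype.sum_unique]
    congr 1
    simpa using (default : {i : Fin l // ¬ i ≠ 0}).2
  rw [this] at h
  linarith

/-- Block forms in terms of ambient vectors. -/
theorem blockForm_dcoord (a b c : ℝ) (p q : Vec K n × Vec K m) :
    blockForm K n m a b c (dcoord p) (dcoord q) =
      a * (⟪p.1, q.1⟫ - ⟪p.1 0, q.1 0⟫) + b * (⟪p.2, q.2⟫ - ⟪p.2 0, q.2 0⟫) +
      c * ⟪(Im K).orthogonalProjectionOnto (p.2 0 - p.1 0),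
        (Im K).orthogonalProjectionOnto (q.2 0 - q.1 0)⟫ := by
  rw [blockForm_apply, dcoord_apply, dcoord_apply, PiLp.inner_apply, PiLp.inner_apply]
  rw [sum_ne_zero_add (fun i => ⟪p.1 i, q.1 i⟫), sum_ne_zero_add (fun i => ⟪p.2 i, q.2 i⟫)]

/-- An element of the normalizer which fixes `(e₀, e₀)` preserves the pair of lines spanned by
`e₀`. -/
theorem exists_map_rmul_e₀ {A : Orth K n × Orth K m} (hA : A ∈ G K n m)
    (h1 : A.1 (e₀ K n) = e₀ K n) (h2 : A.2 (e₀ K m) = e₀ K m) (z : K) :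
    ∃ w : K, A.1 (rmul (e₀ K n) z) = rmul (e₀ K n) w ∧
      A.2 (rmul (e₀ K m) z) = rmul (e₀ K m) w := by
  by_cases hz : z = 0
  · refine ⟨0, ?_⟩
    have (l : ℕ) [NeZero l] : rmul (e₀ K l) (0 : K) = 0 := by ext i; simp [rmul]
    rw [hz, this, this, map_zero, map_zero]
    exact ⟨rfl, rfl⟩
  -- Up to a real factor, `z` is a unit scalar `z'⁻¹`, and multiplication by it is the element of
  -- `S^{k-1}` given by `z'`; conjugation by `A` turns this element into that of another scalar `w`.
  set z' : sphere (0 : K) 1 := ⟨‖z‖ • z⁻¹, by simp [norm_smul, hz]⟩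
  obtain ⟨w, hw⟩ := (hA (scalarHom K n m z')).1 ⟨z', rfl⟩
  have hzz : z = ‖z‖ • (z' : K)⁻¹ := by
    have h : (z' : K)⁻¹ = ‖z‖⁻¹ • z := by
      apply inv_eq_of_mul_eq_one_left
      change (‖z‖⁻¹ • z) * (‖z‖ • z⁻¹) = 1
      rw [smul_mul_smul_comm, inv_mul_cancel₀ (by simpa using hz), mul_inv_cancel₀ hz, one_smul]
    rw [h, smul_smul, mul_inv_cancel₀ (by simpa using hz), one_smul]
  have hs (l : ℕ) (x : Vec K l) (r : ℝ) (q : K) : rmul x (r • q) = r • rmul x q := by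
    ext i; simp [rmul, mul_smul_comm]
  have h1' : A⁻¹.1 (e₀ K n) = e₀ K n := by
    conv_lhs => rw [← h1]
    exact A.1.symm_apply_apply _
  have h2' : A⁻¹.2 (e₀ K m) = e₀ K m := by
    conv_lhs => rw [← h2]
    exact A.2.symm_apply_apply _
  refine ⟨‖z‖ • (w : K)⁻¹, ?_, ?_⟩
  · have h : (scalarHom K n m w).1 (e₀ K n) = (A * scalarHom K n m z' * A⁻¹).1 (e₀ K n) := by
      rw [hw]
    change rmul (e₀ K n) (w : K)⁻¹ = A.1 (rmul (A⁻¹.1 (e₀ K n)) (z' : K)⁻¹) at h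
    rw [hs, h, h1', ← map_smul, ← hs, ← hzz]
  · have h : (scalarHom K n m w).2 (e₀ K m) = (A * scalarHom K n m z' * A⁻¹).2 (e₀ K m) := by
      rw [hw]
    change rmul (e₀ K m) (w : K)⁻¹ = A.2 (rmul (A⁻¹.2 (e₀ K m)) (z' : K)⁻¹) at h
    rw [hs, h, h2', ← map_smul, ← hs, ← hzz]

/-- The isotropy group of the base point acts on the tangent space by block isometries. -/
theorem blockForm_isotropy {A : Orth K n × Orth K m} (hA : A ∈ G K n m)
    (h1 : A.1 (e₀ K n) = e₀ K n) (h2 : A.2 (e₀ K m) = e₀ K m) (a b c : ℝ) (u v : Model K n m) :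
    blockForm K n m a b c (dcoord (pairMap A (dlift u))) (dcoord (pairMap A (dlift v))) =
      blockForm K n m a b c u v := by
  have hA' : A⁻¹ ∈ G K n m := inv_mem hA
  have h1' : A⁻¹.1 (e₀ K n) = e₀ K n := by
    conv_lhs => rw [← h1]
    exact A.1.symm_apply_apply _
  have h2' : A⁻¹.2 (e₀ K m) = e₀ K m := by
    conv_lhs => rw [← h2]
    exact A.2.symm_apply_apply _
  have hin1 (l : ℕ) [NeZero l] (x : Vec K l) (z : K) : ⟪rmul (e₀ K l) z, x⟫ = ⟪z, x 0⟫ := by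
    rw [inner_rmul, herm_e₀]
  -- By `exists_map_rmul_e₀`, `A` preserves the lines of `e₀` in both factors, hence also their
  -- orthogonal complements.
  have hz1 (u : Model K n m) : (A.1 (dlift u).1) 0 = 0 := by
    refine ext_inner_left ℝ fun z => ?_
    obtain ⟨w, hw, -⟩ := exists_map_rmul_e₀ hA' h1' h2' z
    rw [← hin1]
    have : ⟪rmul (e₀ K n) z, A.1 (dlift u).1⟫ = ⟪A⁻¹.1 (rmul (e₀ K n) z), (dlift u).1⟫ := by
      rw [← LinearIsometryEquiv.inner_map_map A.1 (A⁻¹.1 _)]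
      congr 1
      exact (A.1.apply_symm_apply _).symm
    rw [this, hw, hin1, dlift_fst_zero, inner_zero_right, inner_zero_right]
  -- on the line of `e₀` in the second factor, `A` acts on the imaginary multiples of `e₀`
  have hz2 (u : Model K n m) :
      A.2 (rmul (e₀ K m) (u.2.2 : K)) = rmul (e₀ K m) ((A.2 (dlift u).2) 0) := by
    obtain ⟨w, -, hw⟩ := exists_map_rmul_e₀ hA h1 h2 (u.2.2 : K)
    have : w = (A.2 (dlift u).2) 0 := by
      refine ext_inner_left ℝ fun z => ?_
      obtain ⟨w', -, hw'⟩ := exists_map_rmul_e₀ hA' h1' h2' z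
      have e1 (x : Vec K m) : ⟪rmul (e₀ K m) z, A.2 x⟫ = ⟪A⁻¹.2 (rmul (e₀ K m) z), x⟫ := by
        rw [← LinearIsometryEquiv.inner_map_map A.2 (A⁻¹.2 _)]
        congr 1
        exact (A.2.apply_symm_apply _).symm
      rw [← hin1, e1, hw', hin1, dlift_snd_zero]
      have e2 := e1 (rmul (e₀ K m) (u.2.2 : K))
      rw [hw, hw', hin1, hin1] at e2
      simpa [rmul, e₀_zero] using e2
    rw [hw, this]
  -- as `A` fixes `e₀`, it maps imaginary multiples of `e₀` to imaginary ones
  have him (u : Model K n m) : ((Im K).orthogonalProjectionOnto ((A.2 (dlift u).2) 0) : K) =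
      (A.2 (dlift u).2) 0 := by
    have h := real_add_im ((A.2 (dlift u).2) 0)
    have h0 : ⟪(1 : K), (A.2 (dlift u).2) 0⟫ = 0 := by
      have e1 := LinearIsometryEquiv.inner_map_map A.2 (e₀ K m) (rmul (e₀ K m) (u.2.2 : K))
      rw [h2, hz2] at e1
      have e2 : rmul (e₀ K m) (1 : K) = e₀ K m := by ext i; simp [rmul]
      rw [← e2, hin1, e2, ← e2, hin1] at e1
      simpa [rmul, e₀_zero, inner_one_im] using e1
    rwa [h0, zero_smul, zero_add] at h
  have hnn : ⟪(A.2 (dlift u).2) 0, (A.2 (dlift v).2) 0⟫ = ⟪(u.2.2 : K), (v.2.2 : K)⟫ := by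
    have e1 := LinearIsometryEquiv.inner_map_map A.2 (rmul (e₀ K m) (u.2.2 : K))
      (rmul (e₀ K m) (v.2.2 : K))
    rw [hz2, hz2, hin1, hin1] at e1
    simpa [rmul, e₀_zero] using e1
  conv_rhs => rw [← dcoord_dlift u, ← dcoord_dlift v]
  rw [blockForm_dcoord, blockForm_dcoord]
  simp only [pairMap_apply, LinearIsometryEquiv.inner_map_map, hz1, dlift_fst_zero, sub_zero,
    Submodule.coe_inner, him, hnn, dlift_snd_zero]
  simp

end BlockForm

/-! ### The homogeneous metrics in the base chart -/

section LocalForm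

variable {K : Type*} [NormedDivisionRing K] [InnerProductSpace ℝ K]
  [IsScalarTower ℝ K K] [SMulCommClass ℝ K K] [FiniteDimensional ℝ K]
  {n m : ℕ} [NeZero n] [NeZero m]

theorem coordAct_eq_coord_mk (A : Orth K n × Orth K m) (e : Model K n m) :
    coordAct A e = M.coord (M.mk (A • param e)) := rfl

theorem coordAct_unitScalars_mul {z : Orth K n × Orth K m} (hz : z ∈ unitScalars K n m)
    (A : Orth K n × Orth K m) : coordAct (z * A) = coordAct A := by
  funext e
  rw [coordAct_eq_coord_mk, coordAct_eq_coord_mk, mul_smul]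
  congr 1
  exact M.mk_eq_iff.2 ⟨z, hz, rfl⟩

/-- The coordinate action is multiplicative as long as the intermediate point stays in the chart. As
`param ∘ coord` changes the representative by a scalar, `s` has to act on the quotient. -/
theorem coordAct_mul {s : Orth K n × Orth K m} (hs : s ∈ G K n m) (C : Orth K n × Orth K m)
    {e : Model K n m} (he : amb (C • param e) ∈ coordDom) :
    coordAct (s * C) e = coordAct s (coordAct C e) := by
  have h : M.mk (param (coordAct C e)) = M.mk (C • param e) := by
    obtain ⟨z, hz, h⟩ := nlift_coord he (by simp [amb]) (by simp [amb])
    exact mk_eq_of_rmul hz h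
  have h1 := congrArg (fun p => M.coord ((⟨s, hs⟩ : G K n m) • p)) h
  exact (h1.trans (by rw [coordAct, mul_smul]; rfl)).symm

theorem coordAct_one (e : Model K n m) : coordAct (1 : Orth K n × Orth K m) e = e := by
  rw [coordAct, one_smul]
  exact coord_nlift e

/-- The pair of points `(e₀, e₀)` of the spheres. -/
def basePair : Spheres K n m := (⟨e₀ K n, by simp [norm_e₀]⟩, ⟨e₀ K m, by simp [norm_e₀]⟩)

theorem amb_basePair : amb (basePair : Spheres K n m) = (e₀ K n, e₀ K m) := rfl

theorem mk_basePair : M.mk (basePair : Spheres K n m) = basePoint K n m := rfl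

theorem contDiffAt_coordAct (A : Orth K n × Orth K m) {y : Model K n m}
    (hy : amb (A • param y) ∈ coordDom) : ContDiffAt ℝ ∞ (coordAct A) y := by
  refine (contDiffOn_coord_smul A).contDiffAt (IsOpen.mem_nhds ?_ hy)
  refine isOpen_coordDom.preimage (continuous_amb.comp ?_)
  exact (continuous_const_smul A).comp continuous_param

theorem param_zero : param (0 : Model K n m) = basePair := by
  have h : amb (param (0 : Model K n m)) = amb (basePair : Spheres K n m) := by
    rw [amb_param, amb_basePair, nlift, lift_zero, norm_e₀, norm_e₀, inv_one, one_smul, one_smul]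
  exact Prod.ext (Subtype.ext (congrArg Prod.fst h)) (Subtype.ext (congrArg Prod.snd h))

theorem coord_base : coord ((e₀ K n, e₀ K m) : Vec K n × Vec K m) = 0 := by
  rw [← lift_zero, coord_lift]

theorem basePair_mem : amb (basePair : Spheres K n m) ∈ coordDom := by
  rw [amb_basePair]; exact e₀_mem_coordDom

/-- Two coordinate changes which both move the same point to the base point pull back block forms
to the same form, since they differ by an element of the isotropy group. -/
theorem blockForm_fderiv_coordAct {C C' : Orth K n × Orth K m} (hC : C ∈ G K n m)
    (hC' : C' ∈ G K n m) {y : Model K n m} (h : M.mk (C • param y) = basePoint K n m)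
    (h' : C' • param y = basePair) (a b c : ℝ) (u v : Model K n m) :
    blockForm K n m a b c (fderiv ℝ (coordAct C) y u) (fderiv ℝ (coordAct C) y v) =
      blockForm K n m a b c (fderiv ℝ (coordAct C') y u) (fderiv ℝ (coordAct C') y v) := by
  obtain ⟨z, hz, hzC⟩ := M.mk_eq_iff.1 (h.trans mk_basePair.symm).symm
  set s : Orth K n × Orth K m := z * C * C'⁻¹ with hs
  have hzG : z ∈ G K n m := Subgroup.le_normalizer hz
  have hsG : s ∈ G K n m := mul_mem (mul_mem hzG hC) (inv_mem hC')
  have hsb : s • (basePair : Spheres K n m) = basePair := by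
    rw [hs, ← h', mul_smul, inv_smul_smul, mul_smul, hzC, h']
  have hs1 : s.1 (e₀ K n) = e₀ K n := congrArg (fun p => (amb p).1) hsb
  have hs2 : s.2 (e₀ K m) = e₀ K m := congrArg (fun p => (amb p).2) hsb
  have hy' : amb (C' • param y) ∈ coordDom := h' ▸ basePair_mem
  have hev : coordAct C =ᶠ[nhds y] fun e => coordAct s (coordAct C' e) := by
    have ho : ∀ᶠ e in nhds y, amb (C' • param e) ∈ coordDom :=
      ((continuous_amb.comp ((continuous_const_smul C').comp continuous_param)).continuousAt
        (x := y)).eventually (isOpen_coordDom.mem_nhds hy')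
    filter_upwards [ho] with e he
    rw [← coordAct_mul hsG C' he, hs, inv_mul_cancel_right, coordAct_unitScalars_mul hz]
  have h0 : coordAct C' y = 0 := by
    rw [coordAct, h', amb_basePair, coord_base]
  have hd : HasFDerivAt (coordAct s) (dcoord ∘L pairMap s ∘L dlift) (coordAct C' y) := by
    rw [h0]
    exact hasFDerivAt_coordAct_zero s hs1 hs2
  have hd' := ((contDiffAt_coordAct C' hy').differentiableAt (by simp)).hasFDerivAt
  have hf := (hd.comp y hd').congr_of_eventuallyEq hev
  rw [hf.fderiv]
  exact blockForm_isotropy hsG hs1 hs2 a b c _ _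

/-- The expression in the base chart of the invariant metric which is `blockForm a b c` at the base
point. -/
def localForm (a b c : ℝ) (y u v : Model K n m) : ℝ :=
  a * ((‖(lift y).1‖ ^ 2)⁻¹ * ⟪(dlift u).1, (dlift v).1⟫ - ((‖(lift y).1‖ ^ 2)⁻¹) ^ 2 *
      ⟪herm (lift y).1 (dlift u).1, herm (lift y).1 (dlift v).1⟫) +
    b * ((‖(lift y).2‖ ^ 2)⁻¹ * ⟪(dlift u).2, (dlift v).2⟫ - ((‖(lift y).2‖ ^ 2)⁻¹) ^ 2 *
      ⟪herm (lift y).2 (dlift u).2, herm (lift y).2 (dlift v).2⟫) +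
    c * ⟪(Im K).orthogonalProjectionOnto ((‖(lift y).2‖ ^ 2)⁻¹ • herm (lift y).2 (dlift u).2 -
        (‖(lift y).1‖ ^ 2)⁻¹ • herm (lift y).1 (dlift u).1),
      (Im K).orthogonalProjectionOnto ((‖(lift y).2‖ ^ 2)⁻¹ • herm (lift y).2 (dlift v).2 -
        (‖(lift y).1‖ ^ 2)⁻¹ • herm (lift y).1 (dlift v).1)⟫

/-- Transitivity on `S(K ^ n) × S(K ^ m)` of the pairs of `K`-linear isometries. -/
theorem exists_mem_G_smul_eq_basePair (p : Spheres K n m) :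
    ∃ C : Orth K n × Orth K m, C ∈ G K n m ∧ (∀ x z, C.1 (rmul x z) = rmul (C.1 x) z) ∧
      (∀ x z, C.2 (rmul x z) = rmul (C.2 x) z) ∧ C • p = basePair := by
  obtain ⟨A, hA, hA'⟩ := exists_orth_apply_e₀ (p.1 : Vec K n) (by simp)
  obtain ⟨B, hB, hB'⟩ := exists_orth_apply_e₀ (p.2 : Vec K m) (by simp)
  have hinv {l : ℕ} {A : Orth K l} (hA : ∀ x z, A (rmul x z) = rmul (A x) z) (x : Vec K l)
      (z : K) : A⁻¹ (rmul x z) = rmul (A⁻¹ x) z := by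
    apply A.injective
    rw [hA]
    change A (A.symm _) = rmul (A (A.symm _)) z
    rw [A.apply_symm_apply, A.apply_symm_apply]
  refine ⟨(A⁻¹, B⁻¹), mem_G_of_commute (hinv hA) (hinv hB), hinv hA, hinv hB, ?_⟩
  have h : (A, B) • (basePair : Spheres K n m) = p :=
    Prod.ext (Subtype.ext hA') (Subtype.ext hB')
  rw [← h, ← Prod.inv_mk, inv_smul_smul]

/-- The pullback of a block form by any transformation in `G(n,m)` which moves the point with
coordinate `y` to the base point. Since the result does not depend on the transformation, it is the
expression of a well-defined invariant metric. -/
theorem blockForm_fderiv_eq_localForm {C : Orth K n × Orth K m} (hC : C ∈ G K n m)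
    {y : Model K n m} (h : M.mk (C • param y) = basePoint K n m) (a b c : ℝ) (u v : Model K n m) :
    blockForm K n m a b c (fderiv ℝ (coordAct C) y u) (fderiv ℝ (coordAct C) y v) =
      localForm a b c y u v := by
  -- by the isotropy invariance of block forms, `C` may be replaced by a pair `B` of `K`-linear
  -- isometries, for which Hermitian products are preserved
  obtain ⟨B, hB, hB1, hB2, hBy⟩ := exists_mem_G_smul_eq_basePair (param y)
  rw [blockForm_fderiv_coordAct hC hB h hBy]
  have hr : ‖(lift y).1‖ ≠ 0 := norm_ne_zero_iff.2 (lift_fst_ne_zero y)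
  have hs : ‖(lift y).2‖ ≠ 0 := norm_ne_zero_iff.2 (lift_snd_ne_zero y)
  have h1 : B.1 (lift y).1 = ‖(lift y).1‖ • e₀ K n := by
    have := congrArg (fun p => ‖(lift y).1‖ • (amb p).1) hBy
    rw [← show (amb (basePair : Spheres K n m)).1 = e₀ K n from rfl, ← this]
    change _ = ‖(lift y).1‖ • B.1 (‖(lift y).1‖⁻¹ • (lift y).1)
    rw [map_smul, smul_smul, mul_inv_cancel₀ hr, one_smul]
  have h2 : B.2 (lift y).2 = ‖(lift y).2‖ • e₀ K m := by
    have := congrArg (fun p => ‖(lift y).2‖ • (amb p).2) hBy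
    rw [← show (amb (basePair : Spheres K n m)).2 = e₀ K m from rfl, ← this]
    change _ = ‖(lift y).2‖ • B.2 (‖(lift y).2‖⁻¹ • (lift y).2)
    rw [map_smul, smul_smul, mul_inv_cancel₀ hs, one_smul]
  have e1 : e₀ K n = ‖(lift y).1‖⁻¹ • B.1 (lift y).1 := by
    rw [h1, smul_smul, inv_mul_cancel₀ hr, one_smul]
  have e2 : e₀ K m = ‖(lift y).2‖⁻¹ • B.2 (lift y).2 := by
    rw [h2, smul_smul, inv_mul_cancel₀ hs, one_smul]
  have z1 (x : Vec K n) : (B.1 x) 0 = ‖(lift y).1‖⁻¹ • herm (lift y).1 x := by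
    rw [← herm_e₀, e1, herm_smul_left, herm_map hB1]
  have z2 (x : Vec K m) : (B.2 x) 0 = ‖(lift y).2‖⁻¹ • herm (lift y).2 x := by
    rw [← herm_e₀, e2, herm_smul_left, herm_map hB2]
  have hd := hasFDerivAt_coordAct B y hr hs h1 h2
  rw [hd.fderiv]
  simp only [ContinuousLinearMap.comp_apply]
  rw [blockForm_dcoord]
  simp only [scaledMap_apply, PiLp.smul_apply, z1, z2, real_inner_smul_left, real_inner_smul_right,
    LinearIsometryEquiv.inner_map_map, localForm, smul_smul, ← sq, inv_pow]
  ring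

end LocalForm

/-! ### Derivatives of the charts and of the action -/

section Derivatives

variable {K : Type*} [NormedDivisionRing K] [InnerProductSpace ℝ K]
  [IsScalarTower ℝ K K] [SMulCommClass ℝ K K] [FiniteDimensional ℝ K]
  {n m : ℕ} [NeZero n] [NeZero m]

/-- The charts are onto the model space, so that their inverses are smooth everywhere. -/
theorem contMDiff_chart_symm (A : G K n m) :
    ContMDiff 𝓘(ℝ, Model K n m) 𝓘(ℝ, Model K n m) ∞ (chart A).symm := by
  have h : chart A ∈ IsManifold.maximalAtlas 𝓘(ℝ, Model K n m) ∞ (M K n m) :=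
    IsManifold.subset_maximalAtlas ⟨A, rfl⟩
  have := contMDiffOn_symm_of_mem_maximalAtlas h
  rwa [show (chart A).target = Set.univ by simp [chart, baseChart], contMDiffOn_univ] at this

/-- The derivative of the inverse of a chart, the tangent spaces of `M` being identified with the
model space by the preferred charts. -/
theorem mfderiv_chart_symm (A : G K n m) (y : Model K n m) :
    (mfderiv 𝓘(ℝ, Model K n m) 𝓘(ℝ, Model K n m) (chart A).symm y :
      Model K n m →L[ℝ] Model K n m) =
      fderiv ℝ (coordAct (((moveTo ((chart A).symm y))⁻¹ * A : G K n m) :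
        Orth K n × Orth K m)) y := by
  have hd : MDifferentiableAt 𝓘(ℝ, Model K n m) 𝓘(ℝ, Model K n m) (chart A).symm y :=
    (contMDiff_chart_symm A).mdifferentiable (by simp) y
  refine hd.mfderiv.trans ?_
  simp only [mfld_simps, fderivWithin_univ]
  congr 1

theorem chartAt_self (p : M K n m) : chartAt (Model K n m) p p = 0 := by
  change chart (moveTo p) p = 0
  have : (moveTo p)⁻¹ • p = basePoint K n m := by rw [inv_smul_eq_iff, moveTo_smul]
  rw [chart_apply, this, ← mk_basePair, M.coord_mk, amb_basePair, coord_base]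

/-- The derivative of the action, the tangent spaces of `M` being identified with the model space by
the preferred charts. -/
theorem mfderiv_smul (A : G K n m) (p : M K n m) :
    (mfderiv 𝓘(ℝ, Model K n m) 𝓘(ℝ, Model K n m) (fun q : M K n m => (A : PG K n m) • q) p :
      Model K n m →L[ℝ] Model K n m) =
      fderiv ℝ (coordAct (((moveTo (A • p))⁻¹ * A * moveTo p : G K n m) :
        Orth K n × Orth K m)) 0 := by
  have hd : MDifferentiableAt 𝓘(ℝ, Model K n m) 𝓘(ℝ, Model K n m)
      (fun q : M K n m => (A : PG K n m) • q) p :=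
    (contMDiff_smul (A : PG K n m)).mdifferentiable (by simp) p
  refine hd.mfderiv.trans ?_
  simp only [mfld_simps, fderivWithin_univ, chartAt_self]
  congr 1

end Derivatives

/-! ### Smoothness of metrics -/

section SmoothMetric

variable {E : Type*} [NormedAddCommGroup E] [NormedSpace ℝ E]
  {X : Type*} [TopologicalSpace X] [ChartedSpace E X] [IsManifold 𝓘(ℝ, E) ∞ X]

/-- A field of bilinear forms on the tangent spaces is smooth if its expressions in the preferred
charts are. -/
theorem contMDiff_metric_of_chart
    (B : ∀ p : X, TangentSpace 𝓘(ℝ, E) p →L[ℝ] TangentSpace 𝓘(ℝ, E) p →L[ℝ] ℝ)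
    (F : X → E → E →L[ℝ] E →L[ℝ] ℝ) (hF : ∀ p, ContDiff ℝ ∞ (F p))
    (hBF : ∀ p, ∀ y ∈ (chartAt E p).target, ∀ u v : E,
      F p y u v = B ((chartAt E p).symm y) (mfderiv 𝓘(ℝ, E) 𝓘(ℝ, E) (chartAt E p).symm y u)
        (mfderiv 𝓘(ℝ, E) 𝓘(ℝ, E) (chartAt E p).symm y v)) :
    ContMDiff 𝓘(ℝ, E) (𝓘(ℝ, E).prod 𝓘(ℝ, E →L[ℝ] E →L[ℝ] ℝ)) ∞
      (fun p : X => Bundle.TotalSpace.mk' (E →L[ℝ] E →L[ℝ] ℝ) p (B p)) := by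
  intro p
  rw [contMDiffAt_hom_bundle]
  refine ⟨contMDiffAt_id, ?_⟩
  have h1 : ContMDiffAt 𝓘(ℝ, E) 𝓘(ℝ, E →L[ℝ] E →L[ℝ] ℝ) ∞
      (fun q => F p (chartAt E p q)) p := by
    refine ContMDiffAt.comp p (hF p).contMDiff.contMDiffAt ?_
    exact contMDiffAt_of_mem_maximalAtlas
      (IsManifold.chart_mem_maximalAtlas p) (mem_chart_source _ p)
  refine h1.congr_of_eventuallyEq ?_
  filter_upwards [(chartAt E p).open_source.mem_nhds (mem_chart_source _ p)] with q hq
  refine ContinuousLinearMap.ext fun u => ContinuousLinearMap.ext fun v => ?_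
  have hb : q ∈ (trivializationAt E (TangentSpace 𝓘(ℝ, E) : X → Type _) p).baseSet := hq
  refine (inCoordinates_apply_eq₂ hb hb (Set.mem_univ _)).trans ?_
  rw [hBF p _ ((chartAt E p).map_source hq), (chartAt E p).left_inv hq]
  -- the inverse of the trivialization of the tangent bundle is the derivative of the inverse chart
  have hs (w : E) : (trivializationAt E (TangentSpace 𝓘(ℝ, E) : X → Type _) p).symm q w =
      mfderiv 𝓘(ℝ, E) 𝓘(ℝ, E) (chartAt E p).symm (chartAt E p q) w := by
    have := TangentBundle.symmL_trivializationAt (I := 𝓘(ℝ, E)) hq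
    simp only [mfld_simps, mfderivWithin_univ] at this
    rw [← this]
    exact (Bundle.Trivialization.symmL_apply (hb := hb) ..).symm
  rw [hs, hs, Bundle.Trivialization.coe_linearMapAt_of_mem _ (Set.mem_univ _)]
  rfl

end SmoothMetric

/-! ### The homogeneous metrics on the quotient manifold -/

section HomogeneousMetric

variable {K : Type*} [NormedDivisionRing K] [InnerProductSpace ℝ K]
  [IsScalarTower ℝ K K] [SMulCommClass ℝ K K] [FiniteDimensional ℝ K]
  {n m : ℕ} [NeZero n] [NeZero m]

theorem fderiv_coordAct_one (y : Model K n m) :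
    fderiv ℝ (coordAct (1 : Orth K n × Orth K m)) y = ContinuousLinearMap.id ℝ (Model K n m) := by
  rw [show coordAct (1 : Orth K n × Orth K m) = id from funext coordAct_one, fderiv_id]

/-- The origin is the coordinate of the base point, where the identity is an admissible
transformation. -/
theorem localForm_zero (a b c : ℝ) (u v : Model K n m) :
    localForm a b c 0 u v = blockForm K n m a b c u v := by
  have h : M.mk ((1 : Orth K n × Orth K m) • param (0 : Model K n m)) = basePoint K n m := by
    rw [one_smul, param_zero, mk_basePair]
  rw [← blockForm_fderiv_eq_localForm (one_mem _) h, fderiv_coordAct_one]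
  rfl

theorem blockForm_symm (a b c : ℝ) (u v : Model K n m) :
    blockForm K n m a b c u v = blockForm K n m a b c v u := by
  simp only [blockForm_apply, real_inner_comm]

variable (K n m) in
/-- `localForm`, as a function with values in the continuous bilinear forms. It is written as a
pullback of `blockForm`, which makes bilinearity and continuity automatic. -/
def localMetric (a b c : ℝ) (y : Model K n m) : Model K n m →L[ℝ] Model K n m →L[ℝ] ℝ :=
  let D := fderiv ℝ (coordAct (((moveTo (M.mk (param y)))⁻¹ : G K n m) : Orth K n × Orth K m)) y
  (blockForm K n m a b c).bilinearComp D D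

theorem localMetric_apply (a b c : ℝ) (y u v : Model K n m) :
    localMetric K n m a b c y u v = localForm a b c y u v := by
  have h : M.mk ((((moveTo (M.mk (param y)))⁻¹ : G K n m) : Orth K n × Orth K m) • param y) =
      basePoint K n m := by
    rw [← smul_mk, inv_smul_eq_iff, moveTo_smul]
  rw [← blockForm_fderiv_eq_localForm (Subtype.property _) h]
  rfl

theorem localMetric_symm (a b c : ℝ) (y u v : Model K n m) :
    localMetric K n m a b c y u v = localMetric K n m a b c y v u := by
  exact blockForm_symm a b c _ _

theorem contDiff_localForm (a b c : ℝ) (u v : Model K n m) :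
    ContDiff ℝ ∞ fun y => localForm a b c y u v := by
  have h1 : ContDiff ℝ ∞ fun y : Model K n m => (lift y).1 := contDiff_fst.comp contDiff_lift
  have h2 : ContDiff ℝ ∞ fun y : Model K n m => (lift y).2 := contDiff_snd.comp contDiff_lift
  have n1 : ContDiff ℝ ∞ fun y : Model K n m => (‖(lift y).1‖ ^ 2)⁻¹ :=
    (h1.norm_sq ℝ).inv fun y => by simpa using lift_fst_ne_zero y
  have n2 : ContDiff ℝ ∞ fun y : Model K n m => (‖(lift y).2‖ ^ 2)⁻¹ :=
    (h2.norm_sq ℝ).inv fun y => by simpa using lift_snd_ne_zero y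
  have hh (l : ℕ) (x : Vec K l) : ContDiff ℝ ∞ fun y : Vec K l => herm y x := by
    refine ContDiff.sum fun i _ => ?_
    exact contDiff_mul'.comp ((contDiff_conj.comp (contDiff_piLp_apply (p := 2) (i := i))).prodMk
      contDiff_const)
  have k1 (x : Vec K n) : ContDiff ℝ ∞ fun y : Model K n m => herm (lift y).1 x := (hh n x).comp h1
  have k2 (x : Vec K m) : ContDiff ℝ ∞ fun y : Model K n m => herm (lift y).2 x := (hh m x).comp h2
  have hP {f : Model K n m → K} (hf : ContDiff ℝ ∞ f) :
      ContDiff ℝ ∞ fun y => (Im K).orthogonalProjectionOnto (f y) :=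
    (Im K).orthogonalProjectionOnto.contDiff.comp hf
  unfold localForm
  refine ((contDiff_const.mul ?_).add (contDiff_const.mul ?_)).add (contDiff_const.mul ?_)
  · exact (n1.mul contDiff_const).sub ((n1.pow 2).mul ((k1 _).inner ℝ (k1 _)))
  · exact (n2.mul contDiff_const).sub ((n2.pow 2).mul ((k2 _).inner ℝ (k2 _)))
  · exact (hP ((n2.smul (k2 _)).sub (n1.smul (k1 _)))).inner ℝ
      (hP ((n2.smul (k2 _)).sub (n1.smul (k1 _))))

theorem contDiff_localMetric (a b c : ℝ) : ContDiff ℝ ∞ (localMetric K n m a b c) := by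
  refine contDiff_clm_apply_iff.2 fun u => contDiff_clm_apply_iff.2 fun v => ?_
  simp only [localMetric_apply]
  exact contDiff_localForm a b c u v

theorem mk_smul_param_eq {A : G K n m} {y : Model K n m} :
    M.mk ((((moveTo ((chart A).symm y))⁻¹ * A : G K n m) : Orth K n × Orth K m) • param y) =
      basePoint K n m := by
  rw [← smul_mk, mul_smul, inv_smul_eq_iff, moveTo_smul, chart_symm_apply]

theorem blockForm_mfderiv_chart_symm (a b c : ℝ) (A : G K n m) (y u v : Model K n m) :
    blockForm K n m a b c
      ((mfderiv 𝓘(ℝ, Model K n m) 𝓘(ℝ, Model K n m) (chart A).symm y :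
        Model K n m →L[ℝ] Model K n m) u)
      ((mfderiv 𝓘(ℝ, Model K n m) 𝓘(ℝ, Model K n m) (chart A).symm y :
        Model K n m →L[ℝ] Model K n m) v) = localMetric K n m a b c y u v := by
  rw [mfderiv_chart_symm, localMetric_apply]
  exact blockForm_fderiv_eq_localForm (Subtype.property _) mk_smul_param_eq a b c u v

theorem blockForm_pos {a b c : ℝ} (ha : 0 < a) (hb : 0 < b) (hc : 0 < c) {u : Model K n m}
    (hu : u ≠ 0) : 0 < blockForm K n m a b c u u := by
  simp only [blockForm_apply, real_inner_self_eq_norm_sq]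
  have h1 : 0 ≤ ∑ i, ‖u.1 i‖ ^ 2 := Finset.sum_nonneg fun i _ => by positivity
  have h2 : 0 ≤ ∑ i, ‖u.2.1 i‖ ^ 2 := Finset.sum_nonneg fun i _ => by positivity
  by_contra! h
  have t1 := mul_nonneg ha.le h1
  have t2 := mul_nonneg hb.le h2
  have t3 : 0 ≤ c * ‖u.2.2‖ ^ 2 := by positivity
  have s1 : ∑ i, ‖u.1 i‖ ^ 2 = 0 := by
    rcases mul_eq_zero.1 (by linarith : a * ∑ i, ‖u.1 i‖ ^ 2 = 0) with h | h
    · exact absurd h ha.ne'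
    · exact h
  have s2 : ∑ i, ‖u.2.1 i‖ ^ 2 = 0 := by
    rcases mul_eq_zero.1 (by linarith : b * ∑ i, ‖u.2.1 i‖ ^ 2 = 0) with h | h
    · exact absurd h hb.ne'
    · exact h
  have s3 : ‖u.2.2‖ ^ 2 = 0 := by
    rcases mul_eq_zero.1 (by linarith : c * ‖u.2.2‖ ^ 2 = 0) with h | h
    · exact absurd h hc.ne'
    · exact h
  rw [Finset.sum_eq_zero_iff_of_nonneg (fun i _ => by positivity)] at s1 s2
  refine hu (Prod.ext (funext fun i => ?_) (Prod.ext (funext fun i => ?_) ?_))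
  · simpa using s1 i (Finset.mem_univ i)
  · simpa using s2 i (Finset.mem_univ i)
  · simpa using s3

/-- The unit ball of a block form is bounded in the given (maximum) norm of the model space. -/
theorem isVonNBounded_blockForm {a b c : ℝ} (ha : 0 < a) (hb : 0 < b) (hc : 0 < c) :
    Bornology.IsVonNBounded ℝ {u : Model K n m | blockForm K n m a b c u u < 1} := by
  rw [NormedSpace.isVonNBounded_iff, isBounded_iff_forall_norm_le]
  have hR (d : ℝ) (hd : 0 < d) (hdR : 1 / d ≤ 1 + 1 / a + 1 / b + 1 / c) (t : ℝ)
      (h : d * t ^ 2 ≤ 1) : t ≤ 1 + 1 / a + 1 / b + 1 / c := by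
    have : t ^ 2 ≤ 1 / d := by rw [le_div_iff₀ hd]; linarith
    have hR1 : 1 ≤ 1 + 1 / a + 1 / b + 1 / c := by
      have := one_div_pos.2 ha; have := one_div_pos.2 hb; have := one_div_pos.2 hc; linarith
    refine le_of_sq_le_sq ?_ (by linarith)
    nlinarith
  have pa := one_div_pos.2 ha
  have pb := one_div_pos.2 hb
  have pc := one_div_pos.2 hc
  refine ⟨1 + 1 / a + 1 / b + 1 / c, fun u hu => ?_⟩
  rw [Set.mem_ofPred_eq, blockForm_apply] at hu
  simp only [real_inner_self_eq_norm_sq] at hu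
  have h1 : 0 ≤ a * ∑ i, ‖u.1 i‖ ^ 2 :=
    mul_nonneg ha.le (Finset.sum_nonneg fun i _ => by positivity)
  have h2 : 0 ≤ b * ∑ i, ‖u.2.1 i‖ ^ 2 :=
    mul_nonneg hb.le (Finset.sum_nonneg fun i _ => by positivity)
  have h3 : 0 ≤ c * ‖u.2.2‖ ^ 2 := by positivity
  refine norm_prod_le_iff.2 ⟨?_, norm_prod_le_iff.2 ⟨?_, ?_⟩⟩
  · refine (pi_norm_le_iff_of_nonneg (by positivity)).2 fun i => hR a ha (by linarith) _ ?_
    have := Finset.single_le_sum (f := fun i => ‖u.1 i‖ ^ 2) (fun i _ => by positivity)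
      (Finset.mem_univ i)
    have := mul_le_mul_of_nonneg_left this ha.le
    linarith
  · refine (pi_norm_le_iff_of_nonneg (by positivity)).2 fun i => hR b hb (by linarith) _ ?_
    have := Finset.single_le_sum (f := fun i => ‖u.2.1 i‖ ^ 2) (fun i _ => by positivity)
      (Finset.mem_univ i)
    have := mul_le_mul_of_nonneg_left this hb.le
    linarith
  · exact hR c hc (by linarith) _ (by linarith)

variable (K n m) in
/-- The invariant metric on `M` which is `blockForm a b c` at the base point. As the preferred
charts are translates of the base chart by `G(n,m)`, it is the constant `blockForm a b c` when the
tangent spaces are identified with the model space by the preferred charts. -/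
def homMetric {a b c : ℝ} (ha : 0 < a) (hb : 0 < b) (hc : 0 < c) :
    Metrics (Model K n m) (M K n m) where
  inner _ := blockForm K n m a b c
  symm _ u v := blockForm_symm a b c u v
  pos _ _ hu := blockForm_pos ha hb hc hu
  isVonNBounded _ := isVonNBounded_blockForm ha hb hc
  contMDiff := contMDiff_metric_of_chart (E := Model K n m) (X := M K n m)
    (fun _ => blockForm K n m a b c) (fun _ => localMetric K n m a b c)
    (fun _ => contDiff_localMetric a b c)
    (fun p y _ u v => (blockForm_mfderiv_chart_symm a b c (moveTo p) y u v).symm)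

/-- A metric which is the same block form at every point has the same expression in all preferred
charts. -/
theorem inChart_eq_localMetric {g : Metrics (Model K n m) (M K n m)} {a b c : ℝ}
    (hg : ∀ p, (g.inner p : Model K n m →L[ℝ] Model K n m →L[ℝ] ℝ) = blockForm K n m a b c)
    (p : M K n m) : inChart g p = localMetric K n m a b c := by
  funext y
  refine ContinuousLinearMap.ext fun u => ContinuousLinearMap.ext fun v => ?_
  rw [← blockForm_mfderiv_chart_symm a b c (moveTo p), inChart_apply]
  rw [← hg ((chart (moveTo p)).symm y)]
  rfl

/-- A metric which is the same block form at every point is invariant: in the preferred charts at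
`p` and `A • p`, the derivative of the action of `A` is an isotropy transformation. -/
theorem isInvariant_of_inner_eq {g : Metrics (Model K n m) (M K n m)} {a b c : ℝ}
    (hg : ∀ p, (g.inner p : Model K n m →L[ℝ] Model K n m →L[ℝ] ℝ) = blockForm K n m a b c) :
    IsInvariant (PG K n m) g := by
  intro γ p u v
  induction γ using QuotientGroup.induction_on with | _ A
  have h : M.mk ((((moveTo (A • p))⁻¹ * A * moveTo p : G K n m) : Orth K n × Orth K m) •
      param (0 : Model K n m)) = basePoint K n m := by
    rw [← smul_mk, mul_smul, mul_smul, param_zero, mk_basePair, moveTo_smul, inv_smul_eq_iff,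
      moveTo_smul]
  have key (u v : Model K n m) := (blockForm_fderiv_eq_localForm (Subtype.property _) h a b c
    u v).trans (localForm_zero a b c u v)
  rw [← mfderiv_smul, ← hg p] at key
  refine Eq.trans ?_ (key u v)
  exact congrArg (fun B : Model K n m →L[ℝ] Model K n m →L[ℝ] ℝ => B
      ((mfderiv 𝓘(ℝ, Model K n m) 𝓘(ℝ, Model K n m) (fun q : M K n m => (A : PG K n m) • q) p :
        Model K n m →L[ℝ] Model K n m) u)
      ((mfderiv 𝓘(ℝ, Model K n m) 𝓘(ℝ, Model K n m) (fun q : M K n m => (A : PG K n m) • q) p :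
        Model K n m →L[ℝ] Model K n m) v)) ((hg (A • p)).trans (hg p).symm)

end HomogeneousMetric

/-! ### Isotropy transformations transitive on spheres of the blocks -/

section Transitivity

variable {K : Type*} [NormedDivisionRing K] [InnerProductSpace ℝ K]
  [IsScalarTower ℝ K K] [SMulCommClass ℝ K K] [FiniteDimensional ℝ K]
  {n m : ℕ} [NeZero n] [NeZero m]

/-- The inclusion of `K ^ (n - 1)` into `K ^ n` as the orthogonal complement of the line of `e₀`. -/
def emb (x : {i : Fin n // i ≠ 0} → K) : Vec K n :=
  WithLp.toLp 2 fun i => if h : i ≠ 0 then x ⟨i, h⟩ else 0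

@[simp] theorem emb_zero (x : {i : Fin n // i ≠ 0} → K) : emb x 0 = 0 := by simp [emb]

@[simp] theorem emb_coe (x : {i : Fin n // i ≠ 0} → K) (i : {i : Fin n // i ≠ 0}) :
    emb x i = x i := by simp [emb, i.2]

theorem emb_of_ne (x : {i : Fin n // i ≠ 0} → K) {i : Fin n} (hi : i ≠ 0) :
    emb x i = x ⟨i, hi⟩ := by simp [emb, hi]

theorem norm_emb_sq (x : {i : Fin n // i ≠ 0} → K) : ‖emb x‖ ^ 2 = ∑ i, ‖x i‖ ^ 2 := by
  rw [PiLp.norm_sq_eq_of_L2]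
  have := sum_ne_zero_add (fun i => ‖emb x i‖ ^ 2)
  simp only [emb_coe, emb_zero, norm_zero] at this
  rw [this]
  simp

theorem herm_emb (x y : {i : Fin n // i ≠ 0} → K) :
    herm (emb x) (emb y) = ∑ i, conj (x i) * y i := by
  refine ext_inner_left ℝ fun t => ?_
  rw [herm, inner_sum, inner_sum]
  have := sum_ne_zero_add (fun i => ⟪t, conj (emb x i) * emb y i⟫)
  simp only [emb_coe, emb_zero, mul_zero, inner_zero_right, sub_zero] at this
  exact this.symm

theorem dlift_eq_emb (u : Model K n m) :
    dlift u = (emb u.1, emb u.2.1 + rmul (e₀ K m) (u.2.2 : K)) := by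
  refine Prod.ext rfl ?_
  ext i
  by_cases h : i = 0
  · subst h; simp [rmul, e₀_zero]
  · simp [dlift_apply, h, emb, rmul, e₀_of_ne]

/-- The reflection in `a - v` exchanges two vectors of the same length whose Hermitian product is
real. -/
theorem refl_sub_apply {a v : Vec K n} (hn : ‖a‖ = ‖v‖) {r : ℝ} (h : herm v a = r • (1 : K)) :
    refl (a - v) a = v := by
  have hin : ⟪v, a⟫ = r := by
    have := inner_rmul v a 1
    rw [h, inner_smul_right, real_inner_self_eq_norm_sq, norm_one, one_pow, mul_one] at this
    rw [← this]
    congr 1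
    ext i
    simp [rmul]
  have hnu : ‖a - v‖ ^ 2 = 2 * (‖v‖ ^ 2 - r) := by
    rw [norm_sub_sq_real, hn, real_inner_comm, hin]
    ring
  have hhu : herm (a - v) a = (‖v‖ ^ 2 - r) • (1 : K) := by
    rw [herm_sub_left, herm_self, h, hn, sub_smul]
  change reflFun (a - v) a = v
  rw [reflFun, hhu, hnu]
  by_cases h0 : ‖v‖ ^ 2 - r = 0
  · have : a - v = 0 := by simpa [h0] using hnu
    rw [this]
    ext i
    simp [rmul, ← sub_eq_zero.1 this]
  · rw [smul_smul, show 2 * (2 * (‖v‖ ^ 2 - r))⁻¹ * (‖v‖ ^ 2 - r) = 1 by field_simp, one_smul]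
    ext i
    simp [rmul]

/-- The reflection in a vector orthogonal to `e₀` belongs to the isotropy group. -/
theorem refl_emb_e₀ (x : {i : Fin n // i ≠ 0} → K) : refl (emb x) (e₀ K n) = e₀ K n := by
  change reflFun (emb x) (e₀ K n) = e₀ K n
  have : herm (emb x) (e₀ K n) = 0 := by
    refine Finset.sum_eq_zero fun i _ => ?_
    by_cases h : i = 0
    · subst h; simp [conj]
    · simp [e₀_of_ne h]
  rw [reflFun, this]
  ext i
  simp [rmul]

/-- Left multiplication by a unit scalar on the orthogonal complement of the line of `e₀`. -/
def lmulCompl {q : K} (hq : ‖q‖ = 1) : Orth K n :=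
  LinearIsometryEquiv.piLpCongrRight 2 fun i : Fin n =>
    if i = 0 then LinearIsometryEquiv.refl ℝ K else
    { toFun := fun x => q * x
      invFun := fun x => q⁻¹ * x
      map_add' := mul_add q
      map_smul' := fun c x => mul_smul_comm c q x
      left_inv := fun x => inv_mul_cancel_left₀ (by rintro rfl; simp at hq) x
      right_inv := fun x => mul_inv_cancel_left₀ (by rintro rfl; simp at hq) x
      norm_map' := fun x => by simp [hq] }

theorem lmulCompl_zero {q : K} (hq : ‖q‖ = 1) (x : Vec K n) : lmulCompl hq x 0 = x 0 := by
  simp [lmulCompl]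

theorem lmulCompl_of_ne {q : K} (hq : ‖q‖ = 1) (x : Vec K n) {i : Fin n} (hi : i ≠ 0) :
    lmulCompl hq x i = q * x i := by
  simp only [lmulCompl, LinearIsometryEquiv.piLpCongrRight_apply, hi, if_false]
  rfl

theorem lmulCompl_rmul {q : K} (hq : ‖q‖ = 1) (x : Vec K n) (z : K) :
    lmulCompl hq (rmul x z) = rmul (lmulCompl hq x) z := by
  ext i
  by_cases h : i = 0
  · subst h; simp [lmulCompl_zero, rmul]
  · simp [lmulCompl_of_ne hq _ h, rmul, mul_assoc]

theorem lmulCompl_e₀ {q : K} (hq : ‖q‖ = 1) : lmulCompl hq (e₀ K n) = e₀ K n := by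
  ext i
  by_cases h : i = 0
  · subst h; simp [lmulCompl_zero]
  · simp [lmulCompl_of_ne hq _ h, e₀_of_ne h]

theorem lmulCompl_emb {q : K} (hq : ‖q‖ = 1) (x : {i : Fin n // i ≠ 0} → K) :
    lmulCompl hq (emb x) = emb fun i => q * x i := by
  ext i
  by_cases h : i = 0
  · subst h; simp [lmulCompl_zero]
  · simp [lmulCompl_of_ne hq _ h, emb_of_ne _ h]

/-- A quadratic function on `K ^ (n - 1)` which is invariant under the `K`-linear isometries is a
multiple of the square of the norm. -/
theorem eq_mul_norm_sq_of_invariant (Q : ({i : Fin n // i ≠ 0} → K) → ℝ)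
    (hQ : ∀ (r : ℝ) x, Q (r • x) = r ^ 2 * Q x)
    (hinv : ∀ A : Orth K n, (∀ x z, A (rmul x z) = rmul (A x) z) → A (e₀ K n) = e₀ K n →
      ∀ x y, A (emb x) = emb y → Q x = Q y)
    (i : {i : Fin n // i ≠ 0}) (x : {i : Fin n // i ≠ 0} → K) :
    Q x = Q (Pi.single i 1) * ∑ j, ‖x j‖ ^ 2 := by
  -- With `q` the direction of `x i`, the Hermitian product of `x` and `y = ‖x‖ q eᵢ` is real. So a
  -- reflection maps `y` to `x`, and left multiplication by `q` maps `eᵢ` to `q eᵢ`.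
  obtain ⟨q, hq, hq'⟩ : ∃ q : K, ‖q‖ = 1 ∧ conj (x i) * q = ‖x i‖ • (1 : K) := by
    by_cases h : x i = 0
    · exact ⟨1, by simp, by simp [h, conj]⟩
    · have h' : ‖x i‖ ≠ 0 := by simpa using h
      refine ⟨‖x i‖⁻¹ • x i, by simp [norm_smul, h'], ?_⟩
      rw [mul_smul_comm, conj_mul_self, smul_smul]
      congr 1
      field_simp
  obtain ⟨y, hy⟩ : ∃ y : {i : Fin n // i ≠ 0} → K, y = ‖emb x‖ • Pi.single i q := ⟨_, rfl⟩
  have hyi : y i = ‖emb x‖ • q := by rw [hy]; simp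
  have hyj (j : {i : Fin n // i ≠ 0}) (hj : j ≠ i) : y j = 0 := by
    rw [hy, Pi.smul_apply, Pi.single_eq_of_ne hj, smul_zero]
  have hnorm : ‖emb y‖ = ‖emb x‖ := by
    rw [← sq_eq_sq₀ (norm_nonneg _) (norm_nonneg _), norm_emb_sq y, Finset.sum_eq_single i]
    · rw [hyi, norm_smul, hq, norm_norm, mul_one]
    · intro j _ hj
      rw [hyj j hj, norm_zero, sq, zero_mul]
    · exact fun h => absurd (Finset.mem_univ i) h
  have hherm : herm (emb x) (emb y) = (‖emb x‖ * ‖x i‖) • (1 : K) := by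
    rw [herm_emb, Finset.sum_eq_single i]
    · rw [hyi, mul_smul_comm, hq', smul_smul]
    · intro j _ hj
      rw [hyj j hj, mul_zero]
    · exact fun h => absurd (Finset.mem_univ i) h
  have hsub : emb y - emb x = emb (y - x) := by
    ext j
    by_cases h : j = 0
    · subst h; simp
    · simp [emb_of_ne _ h]
  have h1 : Q y = Q x :=
    hinv (refl (emb y - emb x)) (refl_rmul _) (by rw [hsub, refl_emb_e₀]) _ _
      (refl_sub_apply hnorm hherm)
  have h2 : Q (Pi.single i 1) = Q (Pi.single i q) := by
    refine hinv (lmulCompl hq) (lmulCompl_rmul hq) (lmulCompl_e₀ hq) _ _ ?_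
    rw [lmulCompl_emb]
    congr 1
    funext j
    by_cases h : j = i
    · subst h; simp
    · simp [Pi.single_eq_of_ne h]
  rw [← h1, hy, hQ, h2, ← norm_emb_sq]
  ring

theorem conj_im (c : Im K) : conj (c : K) = -c := by
  rw [conj, inner_one_im]
  simp

theorem im_mul_self (c : Im K) : (c : K) * c = -((‖c‖ ^ 2) • (1 : K)) := by
  have := conj_mul_self (c : K)
  rw [conj_im, neg_mul] at this
  rw [← neg_neg ((c : K) * c), this]
  rfl

/-- The unit scalars act transitively by conjugation on the imaginary scalars of a given length. -/
theorem exists_conj_eq {c d : Im K} (h : ‖c‖ = ‖d‖) (hcd : c + d ≠ 0) :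
    ∃ q : K, ‖q‖ = 1 ∧ q * c * q⁻¹ = d := by
  have h0 : (c : K) + d ≠ 0 := by
    intro h
    exact hcd (Subtype.ext h)
  have h0' : ‖(c : K) + d‖⁻¹ ≠ 0 := inv_ne_zero (norm_ne_zero_iff.2 h0)
  -- `(c + d) c = d (c + d)`, because `c ^ 2 = -‖c‖ ^ 2 = -‖d‖ ^ 2 = d ^ 2`
  refine ⟨‖(c : K) + d‖⁻¹ • ((c : K) + d), ?_, ?_⟩
  · rw [norm_smul, norm_inv, norm_norm, inv_mul_cancel₀ (norm_ne_zero_iff.2 h0)]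
  rw [mul_inv_eq_iff_eq_mul₀ (smul_ne_zero h0' h0), smul_mul_assoc, mul_smul_comm, add_mul, mul_add,
    im_mul_self, im_mul_self, h]
  abel_nf

end Transitivity

/-! ### The isotropy action on an invariant metric -/

section Classification

variable {K : Type*} [NormedDivisionRing K] [InnerProductSpace ℝ K]
  [IsScalarTower ℝ K K] [SMulCommClass ℝ K K] [FiniteDimensional ℝ K]
  {n m : ℕ} [NeZero n] [NeZero m]

/-- The form on the model space which a metric induces by the preferred chart at `p`. -/
def formAt (g : Metrics (Model K n m) (M K n m)) (p : M K n m) :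
    Model K n m →L[ℝ] Model K n m →L[ℝ] ℝ := g.inner p

/-- Invariance in terms of the forms on the model space. -/
theorem formAt_smul {g : Metrics (Model K n m) (M K n m)} (hg : IsInvariant (PG K n m) g)
    (A : G K n m) (p : M K n m) (u v : Model K n m) :
    formAt g (A • p)
      (fderiv ℝ (coordAct (((moveTo (A • p))⁻¹ * A * moveTo p : G K n m) :
        Orth K n × Orth K m)) 0 u)
      (fderiv ℝ (coordAct (((moveTo (A • p))⁻¹ * A * moveTo p : G K n m) :
        Orth K n × Orth K m)) 0 v) = formAt g p u v := by
  rw [← mfderiv_smul]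
  exact hg (A : PG K n m) p u v

/-- An invariant metric induces the same form at all points: the preferred charts are translates of
each other. -/
theorem formAt_eq {g : Metrics (Model K n m) (M K n m)} (hg : IsInvariant (PG K n m) g)
    (p : M K n m) : formAt g p = formAt g (basePoint K n m) := by
  refine ContinuousLinearMap.ext fun u => ContinuousLinearMap.ext fun v => ?_
  have h := formAt_smul hg (moveTo p * (moveTo (basePoint K n m))⁻¹) (basePoint K n m) u v
  have hp : (moveTo p * (moveTo (basePoint K n m))⁻¹) • basePoint K n m = p := by
    rw [mul_smul, inv_smul_eq_iff.2 (moveTo_smul _).symm, moveTo_smul]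
  rw [hp, inv_mul_cancel_left, inv_mul_cancel, Subgroup.coe_one, fderiv_coordAct_one] at h
  exact h

/-- The form induced by an invariant metric at the base point is invariant under the isotropy
representation. -/
theorem formAt_isotropy {g : Metrics (Model K n m) (M K n m)} (hg : IsInvariant (PG K n m) g)
    {s : Orth K n × Orth K m} (hs : s ∈ G K n m) (h1 : s.1 (e₀ K n) = e₀ K n)
    (h2 : s.2 (e₀ K m) = e₀ K m) (u v : Model K n m) :
    formAt g (basePoint K n m) (dcoord (pairMap s (dlift u))) (dcoord (pairMap s (dlift v))) =
      formAt g (basePoint K n m) u v := by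
  set b := basePoint K n m with hb
  set t : G K n m := ⟨s, hs⟩
  have ht : t • b = b := by
    rw [hb, ← mk_basePair, smul_mk]
    exact congrArg M.mk (Prod.ext (Subtype.ext h1) (Subtype.ext h2))
  -- the preferred chart at `b` is translated by `moveTo b`, which need not be the identity
  have h := formAt_smul hg (moveTo b * t * (moveTo b)⁻¹) b u v
  have hp : (moveTo b * t * (moveTo b)⁻¹) • b = b := by
    rw [mul_smul, mul_smul, inv_smul_eq_iff.2 (moveTo_smul b).symm, ht, moveTo_smul]
  rw [hp, show (moveTo b)⁻¹ * (moveTo b * t * (moveTo b)⁻¹) * moveTo b = t by group,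
    (hasFDerivAt_coordAct_zero s h1 h2).fderiv] at h
  exact h

theorem formAt_symm (g : Metrics (Model K n m) (M K n m)) (p : M K n m) (u v : Model K n m) :
    formAt g p u v = formAt g p v u := g.symm p u v

theorem formAt_pos (g : Metrics (Model K n m) (M K n m)) (p : M K n m) {u : Model K n m}
    (hu : u ≠ 0) : 0 < formAt g p u u := g.pos p u hu

theorem rmul_one (x : Vec K n) : rmul x (1 : K) = x := by ext i; simp [rmul]

/-- `K`-linear isometries of the first factor which fix `e₀` act on the first block only. -/
theorem dcoord_fst (A : Orth K n) {x y : {i : Fin n // i ≠ 0} → K} (h : A (emb x) = emb y)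
    (w : ({i : Fin m // i ≠ 0} → K) × Im K) :
    dcoord (pairMap (A, 1) (dlift ((x, w) : Model K n m))) = (y, w) := by
  rw [← dcoord_dlift ((y, w) : Model K n m)]
  congr 1
  rw [pairMap_apply, dlift_eq_emb, dlift_eq_emb]
  exact Prod.ext h rfl

/-- `K`-linear isometries of the second factor which fix `e₀` act on the second block only. -/
theorem dcoord_snd {A : Orth K m} (hA : ∀ x z, A (rmul x z) = rmul (A x) z)
    (h0 : A (e₀ K m) = e₀ K m) {x y : {i : Fin m // i ≠ 0} → K} (h : A (emb x) = emb y)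
    (w : {i : Fin n // i ≠ 0} → K) (c : Im K) :
    dcoord (pairMap (1, A) (dlift ((w, x, c) : Model K n m))) = (w, y, c) := by
  rw [← dcoord_dlift ((w, y, c) : Model K n m)]
  congr 1
  rw [pairMap_apply, dlift_eq_emb, dlift_eq_emb]
  refine Prod.ext rfl ?_
  change A (emb x + rmul (e₀ K m) (c : K)) = _
  rw [map_add, hA, h0, h]

theorem lmul_mem_G {q : K} (hq : ‖q‖ = 1) :
    ((lmul hq, lmul hq) : Orth K n × Orth K m) ∈ G K n m := by
  refine mem_G_of_commute (fun x z => ?_) (fun x z => ?_) <;>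
  · ext i
    simp [lmul_apply, rmul, mul_assoc]

/-- Left multiplication by `q` followed by right multiplication by `q⁻¹` is an element of the
isotropy group, which conjugates the imaginary block. -/
theorem formAt_conj {g : Metrics (Model K n m) (M K n m)} (hg : IsInvariant (PG K n m) g)
    {q : K} (hq : ‖q‖ = 1) {c d : Im K} (h : q * c * q⁻¹ = d) :
    formAt g (basePoint K n m) (0, 0, c) (0, 0, c) =
      formAt g (basePoint K n m) (0, 0, d) (0, 0, d) := by
  have hq0 : q ≠ 0 := by rintro rfl; simp at hq
  set z : Orth K n × Orth K m := scalarHom K n m ⟨q, by simpa using hq⟩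
  have hz (x : Vec K n) : z.1 x = rmul x q⁻¹ := rfl
  have hz' (x : Vec K m) : z.2 x = rmul x q⁻¹ := rfl
  have hs : z * (lmul hq, lmul hq) ∈ G K n m :=
    mul_mem (Subgroup.le_normalizer ⟨_, rfl⟩) (lmul_mem_G hq)
  have key := formAt_isotropy hg hs ?_ ?_ (0, 0, c) (0, 0, c)
  · have hd : dcoord (pairMap (z * (lmul hq, lmul hq)) (dlift ((0, 0, c) : Model K n m))) =
        (0, 0, d) := by
      rw [← dcoord_dlift ((0, 0, d) : Model K n m)]
      congr 1
      rw [pairMap_apply]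
      refine Prod.ext ?_ ?_
      · change z.1 (lmul hq (dlift ((0, 0, c) : Model K n m)).1) = _
        rw [hz]
        ext i
        by_cases hi : i = 0 <;> simp [rmul, lmul_apply, dlift_apply, hi]
      · change z.2 (lmul hq (dlift ((0, 0, c) : Model K n m)).2) = _
        rw [hz']
        ext i
        by_cases hi : i = 0 <;> simp [rmul, lmul_apply, dlift_apply, hi, h]
    rw [← key, hd]
  · change z.1 (lmul hq (e₀ K n)) = _
    rw [hz]
    ext i
    by_cases hi : i = 0
    · subst hi; simp [rmul, lmul_apply, e₀_zero, hq0]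
    · simp [rmul, lmul_apply, e₀_of_ne hi]
  · change z.2 (lmul hq (e₀ K m)) = _
    rw [hz']
    ext i
    by_cases hi : i = 0
    · subst hi; simp [rmul, lmul_apply, e₀_zero, hq0]
    · simp [rmul, lmul_apply, e₀_of_ne hi]

end Classification

/-! ### Invariant metrics are block forms -/

section Coefficients

variable {K : Type*} [NormedDivisionRing K] [InnerProductSpace ℝ K]
  [IsScalarTower ℝ K K] [SMulCommClass ℝ K K] [FiniteDimensional ℝ K]
  {n m : ℕ} [NeZero n] [NeZero m]

open Classical in
/-- The coefficient of a block form on the first block. If this block is zero, the coefficient is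
immaterial and `1` is taken, so that it is positive. -/
def coef₁ (B : Model K n m →L[ℝ] Model K n m →L[ℝ] ℝ) : ℝ :=
  if h : Nonempty {i : Fin n // i ≠ 0} then B (Pi.single h.some 1, 0) (Pi.single h.some 1, 0) else 1

open Classical in
/-- The coefficient of a block form on the second block, with value `1` if this block is zero, as
for `coef₁`. -/
def coef₂ (B : Model K n m →L[ℝ] Model K n m →L[ℝ] ℝ) : ℝ :=
  if h : Nonempty {i : Fin m // i ≠ 0} then
    B (0, Pi.single h.some 1, 0) (0, Pi.single h.some 1, 0) else 1

open Classical in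
/-- The coefficient of a block form on the imaginary scalars, with value `1` if there are none, that
is for the real scalars. -/
def coef₃ (B : Model K n m →L[ℝ] Model K n m →L[ℝ] ℝ) : ℝ :=
  if h : ∃ c : Im K, ‖c‖ = 1 then B (0, 0, h.choose) (0, 0, h.choose) else 1

theorem continuous_coef₁ :
    Continuous (coef₁ : (Model K n m →L[ℝ] Model K n m →L[ℝ] ℝ) → ℝ) := by
  unfold coef₁
  split_ifs with h
  · exact (continuous_id.clm_apply continuous_const).clm_apply continuous_const
  · exact continuous_const

theorem continuous_coef₂ :
    Continuous (coef₂ : (Model K n m →L[ℝ] Model K n m →L[ℝ] ℝ) → ℝ) := by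
  unfold coef₂
  split_ifs with h
  · exact (continuous_id.clm_apply continuous_const).clm_apply continuous_const
  · exact continuous_const

theorem continuous_coef₃ :
    Continuous (coef₃ : (Model K n m →L[ℝ] Model K n m →L[ℝ] ℝ) → ℝ) := by
  unfold coef₃
  split_ifs with h
  · exact (continuous_id.clm_apply continuous_const).clm_apply continuous_const
  · exact continuous_const

variable {B : Model K n m →L[ℝ] Model K n m →L[ℝ] ℝ}

theorem coef₁_pos (hB : ∀ u, u ≠ 0 → 0 < B u u) : 0 < coef₁ B := by
  unfold coef₁
  split_ifs with h
  · refine hB _ fun h0 => ?_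
    have := congrFun (congrArg Prod.fst h0) h.some
    simp at this
  · exact one_pos

theorem coef₂_pos (hB : ∀ u, u ≠ 0 → 0 < B u u) : 0 < coef₂ B := by
  unfold coef₂
  split_ifs with h
  · refine hB _ fun h0 => ?_
    have := congrFun (congrArg (fun u => u.2.1) h0) h.some
    simp at this
  · exact one_pos

theorem coef₃_pos (hB : ∀ u, u ≠ 0 → 0 < B u u) : 0 < coef₃ B := by
  unfold coef₃
  split_ifs with h
  · refine hB _ fun h0 => ?_
    have h1 := h.choose_spec
    have : h.choose = 0 := congrArg (fun u => u.2.2) h0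
    rw [this, norm_zero] at h1
    exact zero_ne_one h1
  · exact one_pos

variable {g : Metrics (Model K n m) (M K n m)}

/-- The sign change on the first block is an isotropy transformation, so that this block is
orthogonal to the other two. -/
theorem formAt_fst_snd (hg : IsInvariant (PG K n m) g) (x : {i : Fin n // i ≠ 0} → K)
    (w : ({i : Fin m // i ≠ 0} → K) × Im K) :
    formAt g (basePoint K n m) (x, 0) (0, w) = 0 := by
  have hq : ‖(-1 : K)‖ = 1 := by simp
  have h := formAt_isotropy hg (s := (lmulCompl hq, 1))
    (mem_G_of_commute (lmulCompl_rmul hq) fun _ _ => rfl) (lmulCompl_e₀ hq) rfl (x, 0) (0, w)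
  have e1 : lmulCompl hq (emb x) = emb (-x) := by
    rw [lmulCompl_emb]; congr 1; funext j; simp
  have e2 : lmulCompl hq (emb (0 : {i : Fin n // i ≠ 0} → K)) = emb 0 := by
    rw [lmulCompl_emb]; congr 1; funext j; simp
  rw [dcoord_fst _ e1, dcoord_fst _ e2,
    show ((-x, 0) : Model K n m) = -(x, 0) by simp, map_neg, neg_apply] at h
  linarith

/-- The sign change on the second block is an isotropy transformation, so that this block is
orthogonal to the imaginary scalars. -/
theorem formAt_snd_im (hg : IsInvariant (PG K n m) g) (y : {i : Fin m // i ≠ 0} → K) (c : Im K) :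
    formAt g (basePoint K n m) (0, y, 0) (0, 0, c) = 0 := by
  have hq : ‖(-1 : K)‖ = 1 := by simp
  have h := formAt_isotropy hg (s := (1, lmulCompl hq))
    (mem_G_of_commute (fun _ _ => rfl) (lmulCompl_rmul hq)) rfl (lmulCompl_e₀ hq)
    (0, y, 0) (0, 0, c)
  have e1 : lmulCompl hq (emb y) = emb (-y) := by
    rw [lmulCompl_emb]; congr 1; funext j; simp
  have e2 : lmulCompl hq (emb (0 : {i : Fin m // i ≠ 0} → K)) = emb 0 := by
    rw [lmulCompl_emb]; congr 1; funext j; simp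
  rw [dcoord_snd (lmulCompl_rmul hq) (lmulCompl_e₀ hq) e1,
    dcoord_snd (lmulCompl_rmul hq) (lmulCompl_e₀ hq) e2,
    show ((0, -y, 0) : Model K n m) = -(0, y, 0) by simp, map_neg, neg_apply] at h
  linarith

theorem formAt_fst (hg : IsInvariant (PG K n m) g) (x : {i : Fin n // i ≠ 0} → K) :
    formAt g (basePoint K n m) (x, 0) (x, 0) =
      coef₁ (formAt g (basePoint K n m)) * ∑ i, ‖x i‖ ^ 2 := by
  by_cases h : Nonempty {i : Fin n // i ≠ 0}
  · rw [coef₁, dif_pos h]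
    refine eq_mul_norm_sq_of_invariant
      (fun x => formAt g (basePoint K n m) (x, 0) (x, 0)) ?_ ?_ h.some x
    · intro r x
      rw [show ((r • x, 0) : Model K n m) = r • (x, 0) by simp, map_smul, map_smul, smul_apply,
        smul_eq_mul, smul_eq_mul]
      ring
    · intro A hA h0 x y hxy
      have h := formAt_isotropy hg (s := (A, 1)) (mem_G_of_commute hA fun _ _ => rfl) h0 rfl
        (x, 0) (x, 0)
      rw [dcoord_fst _ hxy] at h
      exact h.symm
  · rw [not_nonempty_iff] at h
    rw [show ((x, 0) : Model K n m) = 0 from Prod.ext (Subsingleton.elim _ _) rfl]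
    simp

theorem formAt_snd (hg : IsInvariant (PG K n m) g) (y : {i : Fin m // i ≠ 0} → K) :
    formAt g (basePoint K n m) (0, y, 0) (0, y, 0) =
      coef₂ (formAt g (basePoint K n m)) * ∑ i, ‖y i‖ ^ 2 := by
  by_cases h : Nonempty {i : Fin m // i ≠ 0}
  · rw [coef₂, dif_pos h]
    refine eq_mul_norm_sq_of_invariant
      (fun y => formAt g (basePoint K n m) (0, y, 0) (0, y, 0)) ?_ ?_ h.some y
    · intro r x
      rw [show ((0, r • x, 0) : Model K n m) = r • (0, x, 0) by simp, map_smul, map_smul,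
        smul_apply, smul_eq_mul, smul_eq_mul]
      ring
    · intro A hA h0 x y hxy
      have h := formAt_isotropy hg (s := (1, A)) (mem_G_of_commute (fun _ _ => rfl) hA) rfl h0
        (0, x, 0) (0, x, 0)
      rw [dcoord_snd hA h0 hxy] at h
      exact h.symm
  · rw [not_nonempty_iff] at h
    rw [show ((0, y, 0) : Model K n m) = 0 from
      Prod.ext rfl (Prod.ext (Subsingleton.elim _ _) rfl)]
    simp

/-- The isotropy group is transitive on imaginary scalars of the same length, up to sign. -/
theorem formAt_im_congr (hg : IsInvariant (PG K n m) g) {c d : Im K} (h : ‖c‖ = ‖d‖) :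
    formAt g (basePoint K n m) (0, 0, c) (0, 0, c) =
      formAt g (basePoint K n m) (0, 0, d) (0, 0, d) := by
  -- `d = -c` need not be conjugate to `c` (over `ℂ` it is not), but the form is even
  by_cases hcd : c + d = 0
  · rw [eq_neg_of_add_eq_zero_left hcd, show ((0, 0, -d) : Model K n m) = -(0, 0, d) by simp,
      map_neg, map_neg, neg_apply, neg_neg]
  · obtain ⟨q, hq, hq'⟩ := exists_conj_eq h hcd
    exact formAt_conj hg hq hq'

theorem formAt_im (hg : IsInvariant (PG K n m) g) (c : Im K) :
    formAt g (basePoint K n m) (0, 0, c) (0, 0, c) =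
      coef₃ (formAt g (basePoint K n m)) * ‖c‖ ^ 2 := by
  by_cases h : ∃ c : Im K, ‖c‖ = 1
  · rw [coef₃, dif_pos h]
    rw [formAt_im_congr hg (d := ‖c‖ • h.choose) (by rw [norm_smul, h.choose_spec]; simp),
      show ((0, 0, ‖c‖ • h.choose) : Model K n m) = ‖c‖ • (0, 0, h.choose) by simp, map_smul,
      map_smul, smul_apply, smul_eq_mul, smul_eq_mul]
    ring
  · have hc : c = 0 := by
      by_contra hc
      exact h ⟨‖c‖⁻¹ • c, by rw [norm_smul, norm_inv, norm_norm,
        inv_mul_cancel₀ (norm_ne_zero_iff.2 hc)]⟩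
    subst hc
    rw [show ((0, 0, 0) : Model K n m) = 0 from rfl]
    simp

/-- An invariant metric is a block form at every point: the isotropy group contains the sign changes
of the first two blocks and acts transitively on the unit sphere of each block. -/
theorem formAt_eq_blockForm (hg : IsInvariant (PG K n m) g) (p : M K n m) :
    formAt g p = blockForm K n m (coef₁ (formAt g (basePoint K n m)))
      (coef₂ (formAt g (basePoint K n m))) (coef₃ (formAt g (basePoint K n m))) := by
  rw [formAt_eq hg p]
  set B := formAt g (basePoint K n m) with hB
  have hs (u v : Model K n m) : B u v = B v u := formAt_symm g _ u v
  have hquad (u : Model K n m) : B u u = blockForm K n m (coef₁ B) (coef₂ B) (coef₃ B) u u := by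
    obtain ⟨x, y, c⟩ := u
    have hu : ((x, y, c) : Model K n m) = (x, 0) + ((0, y, 0) + (0, 0, c)) := by simp
    have e1 : B (x, 0) (0, y, 0) = 0 := formAt_fst_snd hg x (y, 0)
    have e2 : B (x, 0) (0, 0, c) = 0 := formAt_fst_snd hg x (0, c)
    have e3 : B (0, y, 0) (0, 0, c) = 0 := formAt_snd_im hg y c
    rw [blockForm_apply, hu]
    simp only [map_add, add_apply, hs (0, y, 0) (x, 0), hs (0, 0, c) (x, 0),
      hs (0, 0, c) (0, y, 0), e1, e2, e3]
    rw [hB, formAt_fst hg, formAt_snd hg, formAt_im hg, ← hB]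
    simp
    ring
  refine ContinuousLinearMap.ext fun u => ContinuousLinearMap.ext fun v => ?_
  -- polarization
  have h := hquad (u + v)
  simp only [map_add, add_apply, hquad u, hquad v, hs v u,
    blockForm_symm _ _ _ v u] at h
  linarith

end Coefficients

/-! ### Continuity in the smooth topology -/

section Topology

variable {K : Type*} [NormedDivisionRing K] [InnerProductSpace ℝ K]
  [IsScalarTower ℝ K K] [SMulCommClass ℝ K K] [FiniteDimensional ℝ K]
  {n m : ℕ} [NeZero n] [NeZero m]

/-- Evaluation at a point is continuous: convergence in the `C^∞` topology implies pointwise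
convergence of the local expressions, by the derivative of order `0` and the compact set `{y}`. -/
theorem continuous_inChart_apply {E : Type*} [NormedAddCommGroup E] [NormedSpace ℝ E]
    {X : Type*} [TopologicalSpace X] [ChartedSpace E X] [IsManifold 𝓘(ℝ, E) ∞ X] (p : X) {y : E}
    (hy : y ∈ (chartAt E p).target) : Continuous fun g : Metrics E X => inChart g p y := by
  have h1 : Continuous fun g : Metrics E X =>
      UniformOnFun.ofFun {C | IsCompact C ∧ C ⊆ (chartAt E p).target}
        (iteratedFDeriv ℝ 0 (inChart g p)) :=
    continuous_iff_le_induced.2 ((iInf_le _ p).trans (iInf_le _ 0))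
  have h2 := (UniformOnFun.uniformContinuous_eval_of_mem (β := E [×0]→L[ℝ] (E →L[ℝ] E →L[ℝ] ℝ))
    {C | IsCompact C ∧ C ⊆ (chartAt E p).target} (Set.mem_singleton y)
    ⟨isCompact_singleton, Set.singleton_subset_iff.2 hy⟩).continuous.comp h1
  have h3 := (continuousMultilinearCurryFin0 ℝ E (E →L[ℝ] E →L[ℝ] ℝ)).continuous.comp h2
  exact h3

/-- A family of metrics depends continuously on a parameter if their expressions in the charts are
linear combinations of fixed smooth functions with continuous coefficients. -/
theorem continuous_metrics_of_inChart_eq {E : Type*} [NormedAddCommGroup E] [NormedSpace ℝ E]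
    {X : Type*} [TopologicalSpace X] [ChartedSpace E X] [IsManifold 𝓘(ℝ, E) ∞ X]
    {P ι : Type*} [TopologicalSpace P] [Fintype ι] (Φ : P → Metrics E X)
    (r : ι → P → ℝ) (hr : ∀ i, Continuous (r i)) (F : ι → E → E →L[ℝ] E →L[ℝ] ℝ)
    (hF : ∀ i, ContDiff ℝ ∞ (F i)) (h : ∀ t p, inChart (Φ t) p = fun y => ∑ i, r i t • F i y) :
    Continuous Φ := by
  refine continuous_iInf_rng.2 fun p => continuous_iInf_rng.2 fun j => continuous_induced_rng.2 ?_
  rw [continuous_iff_continuousAt]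
  intro t
  rw [ContinuousAt, UniformOnFun.tendsto_iff_tendstoUniformlyOn]
  rintro C ⟨hC, -⟩
  have hj (t : P) (y : E) : iteratedFDeriv ℝ j (inChart (Φ t) p) y =
      ∑ i, r i t • iteratedFDeriv ℝ j (F i) y := by
    have hc (i : ι) : ContDiff ℝ j (F i) := (hF i).of_le (by exact_mod_cast le_top)
    rw [h, iteratedFDeriv_fun_sum_apply fun i _ => ((hc i).contDiffAt.const_smul (r i t))]
    exact Finset.sum_congr rfl fun i _ => iteratedFDeriv_const_smul_apply' (hc i).contDiffAt
  have : CompactSpace C := isCompact_iff_compactSpace.1 hC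
  have hG (i : ι) : Continuous (iteratedFDeriv ℝ j (F i)) :=
    (hF i).continuous_iteratedFDeriv (by exact_mod_cast le_top)
  -- joint continuity in the coefficients and the point yields uniform convergence on the compact
  -- `C`
  have hcont : Continuous ↿(fun (a : ι → ℝ) (y : C) => ∑ i, a i • iteratedFDeriv ℝ j (F i) y) := by
    refine continuous_finsetSum _ fun i _ => ?_
    exact ((continuous_apply i).comp continuous_fst).smul
      ((hG i).comp (continuous_subtype_val.comp continuous_snd))
  have hu := Continuous.tendstoUniformly _ hcont (fun i => r i t)
  intro U hU
  have ht : Filter.Tendsto (fun t i => r i t) (nhds t) (nhds fun i => r i t) :=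
    (continuous_pi hr).continuousAt
  filter_upwards [ht.eventually (hu U hU)] with t' ht' y hy
  have := ht' ⟨y, hy⟩
  simp only [← hj] at this
  exact this

end Topology

/-! ### Derivatives of order two along lines -/

section Jets

/-- `f` is differentiable with `2`-jet `c₀ + c₁ t + c₂ t ^ 2` at `0`. -/
def HasJet (f : ℝ → ℝ) (c₀ c₁ c₂ : ℝ) : Prop :=
  ∃ f' : ℝ → ℝ, (∀ t, HasDerivAt f (f' t) t) ∧ f 0 = c₀ ∧ f' 0 = c₁ ∧ HasDerivAt f' (2 * c₂) 0

namespace HasJet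

variable {f g : ℝ → ℝ} {c₀ c₁ c₂ d₀ d₁ d₂ : ℝ}

theorem const (c : ℝ) : HasJet (fun _ => c) c 0 0 :=
  ⟨fun _ => 0, fun t => hasDerivAt_const t c, rfl, rfl,
    by simpa using hasDerivAt_const (0 : ℝ) (0 : ℝ)⟩

theorem id : HasJet (fun t => t) 0 1 0 :=
  ⟨fun _ => 1, fun t => hasDerivAt_id t, rfl, rfl, by simpa using hasDerivAt_const (0 : ℝ) (1 : ℝ)⟩

theorem add (hf : HasJet f c₀ c₁ c₂) (hg : HasJet g d₀ d₁ d₂) :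
    HasJet (fun t => f t + g t) (c₀ + d₀) (c₁ + d₁) (c₂ + d₂) := by
  obtain ⟨f', h1, h2, h3, h4⟩ := hf
  obtain ⟨g', k1, k2, k3, k4⟩ := hg
  exact ⟨fun t => f' t + g' t, fun t => (h1 t).add (k1 t), by simp only [h2, k2],
    by simp only [h3, k3], (h4.add k4).congr_deriv (by ring)⟩

theorem sub (hf : HasJet f c₀ c₁ c₂) (hg : HasJet g d₀ d₁ d₂) :
    HasJet (fun t => f t - g t) (c₀ - d₀) (c₁ - d₁) (c₂ - d₂) := by
  obtain ⟨f', h1, h2, h3, h4⟩ := hf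
  obtain ⟨g', k1, k2, k3, k4⟩ := hg
  exact ⟨fun t => f' t - g' t, fun t => (h1 t).sub (k1 t), by simp only [h2, k2],
    by simp only [h3, k3], (h4.sub k4).congr_deriv (by ring)⟩

theorem mul (hf : HasJet f c₀ c₁ c₂) (hg : HasJet g d₀ d₁ d₂) :
    HasJet (fun t => f t * g t) (c₀ * d₀) (c₁ * d₀ + c₀ * d₁) (c₂ * d₀ + c₁ * d₁ + c₀ * d₂) := by
  obtain ⟨f', h1, h2, h3, h4⟩ := hf
  obtain ⟨g', k1, k2, k3, k4⟩ := hg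
  refine ⟨fun t => f' t * g t + f t * g' t, fun t => (h1 t).mul (k1 t), by simp only [h2, k2],
    by simp only [h2, h3, k2, k3], ((h4.mul (k1 0)).add ((h1 0).mul k4)).congr_deriv ?_⟩
  rw [h2, h3, k2, k3]
  ring

/-- The expansion `1 - s t ^ 2` of `1 / (1 + s t ^ 2)`. -/
theorem inv_one_add (s : ℝ) (hs : 0 ≤ s) : HasJet (fun t => (1 + t ^ 2 * s)⁻¹) 1 0 (-s) := by
  have h0 (t : ℝ) : 1 + t ^ 2 * s ≠ 0 := by positivity
  have hd (t : ℝ) : HasDerivAt (fun t : ℝ => 1 + t ^ 2 * s) (2 * t * s) t := by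
    simpa using ((hasDerivAt_pow 2 t).mul_const s).const_add 1
  have hi (t : ℝ) := (hd t).inv (h0 t)
  refine ⟨fun t => -(2 * t * s) / (1 + t ^ 2 * s) ^ 2, hi, by simp, by simp, ?_⟩
  have h1 : HasDerivAt (fun t : ℝ => -(2 * t * s)) (-(2 * s)) 0 := by
    exact (((hasDerivAt_id (0 : ℝ)).const_mul 2).mul_const s).neg.congr_deriv (by ring)
  refine (h1.div ((hd 0).pow 2) (pow_ne_zero 2 (h0 0))).congr_deriv ?_
  simp

theorem congr (hf : HasJet f c₀ c₁ c₂) (h : g = f) (h₁ : d₁ = c₁) (h₂ : d₂ = c₂) :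
    HasJet g c₀ d₁ d₂ := by
  rwa [h, h₁, h₂]

theorem eq_of_hasDerivAt {f' : ℝ → ℝ} {d : ℝ} (hf : HasJet f c₀ c₁ c₂)
    (h : ∀ t, HasDerivAt f (f' t) t) (h' : HasDerivAt f' d 0) : f' 0 = c₁ ∧ d = 2 * c₂ := by
  obtain ⟨f'', h1, h2, h3, h4⟩ := hf
  obtain rfl : f' = f'' := funext fun t => (h t).unique (h1 t)
  exact ⟨h3, h'.unique h4⟩

end HasJet

variable {E : Type*} [NormedAddCommGroup E] [NormedSpace ℝ E]

/-- The first two derivatives of a bilinear form at the origin can be computed on lines. -/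
theorem fderiv_eq_of_hasJet {g : E → E →L[ℝ] E →L[ℝ] ℝ} (hg : ContDiff ℝ ∞ g) {y u v : E}
    {c₀ c₁ c₂ : ℝ} (h : HasJet (fun t => g (t • y) u v) c₀ c₁ c₂) :
    fderiv ℝ g 0 y u v = c₁ ∧ fderiv ℝ (fderiv ℝ g) 0 y y u v = 2 * c₂ := by
  have hl (t : ℝ) : HasDerivAt (fun t : ℝ => t • y) y t := by
    simpa using (hasDerivAt_id t).smul_const y
  have hg1 : Differentiable ℝ g := hg.differentiable (by simp)
  have hg2 : Differentiable ℝ (fderiv ℝ g) :=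
    ((contDiff_infty_iff_fderiv.1 hg).2).differentiable (by simp)
  have h1 (t : ℝ) : HasDerivAt (fun t : ℝ => g (t • y) u v) (fderiv ℝ g (t • y) y u v) t := by
    have e0 : HasDerivAt (fun t : ℝ => g (t • y)) (fderiv ℝ g (t • y) y) t :=
      (hg1 (t • y)).hasFDerivAt.comp_hasDerivAt t (hl t)
    have e1 : HasDerivAt (fun t : ℝ => g (t • y) u) (fderiv ℝ g (t • y) y u) t :=
      (ContinuousLinearMap.apply ℝ (E →L[ℝ] ℝ) u).hasFDerivAt.comp_hasDerivAt t e0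
    exact (ContinuousLinearMap.apply ℝ ℝ v).hasFDerivAt.comp_hasDerivAt t e1
  have h2 : HasDerivAt (fun t : ℝ => fderiv ℝ g (t • y) y u v)
      (fderiv ℝ (fderiv ℝ g) 0 y y u v) 0 := by
    have e0 : HasDerivAt (fun t : ℝ => fderiv ℝ g (t • y)) (fderiv ℝ (fderiv ℝ g) 0 y) 0 := by
      have := (hg2 ((0 : ℝ) • y)).hasFDerivAt.comp_hasDerivAt (0 : ℝ) (hl 0)
      rwa [zero_smul] at this
    have e1 : HasDerivAt (fun t : ℝ => fderiv ℝ g (t • y) y) (fderiv ℝ (fderiv ℝ g) 0 y y) 0 :=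
      (ContinuousLinearMap.apply ℝ (E →L[ℝ] E →L[ℝ] ℝ) y).hasFDerivAt.comp_hasDerivAt 0 e0
    have e2 : HasDerivAt (fun t : ℝ => fderiv ℝ g (t • y) y u)
        (fderiv ℝ (fderiv ℝ g) 0 y y u) 0 :=
      (ContinuousLinearMap.apply ℝ (E →L[ℝ] ℝ) u).hasFDerivAt.comp_hasDerivAt 0 e1
    exact (ContinuousLinearMap.apply ℝ ℝ v).hasFDerivAt.comp_hasDerivAt 0 e2
  have := h.eq_of_hasDerivAt h1 h2
  simpa using this

/-- Polarization in the first two arguments. -/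
theorem apply_add_add_of_symm (T : E →L[ℝ] E →L[ℝ] E →L[ℝ] E →L[ℝ] ℝ) {y y' : E}
    (h : T y y' = T y' y) (u v : E) :
    T (y + y') (y + y') u v = T y y u v + T y' y' u v + 2 * T y y' u v := by
  simp only [map_add, add_apply, ← h]
  ring

end Jets

/-! ### The 2-jet of a homogeneous metric at the base point -/

section LocalJet

variable {K : Type*} [NormedDivisionRing K] [InnerProductSpace ℝ K]
  [IsScalarTower ℝ K K] [SMulCommClass ℝ K K] [FiniteDimensional ℝ K]
  {n m : ℕ} [NeZero n] [NeZero m]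

theorem conj_add (x y : K) : conj (x + y) = conj x + conj y := by
  simp only [conj, inner_add_right, mul_add, add_smul]
  abel

theorem herm_add_left (u v x : Vec K n) : herm (u + v) x = herm u x + herm v x := by
  simp [herm, conj_add, add_mul, Finset.sum_add_distrib]

theorem herm_add_smul (p x : Vec K n) (t : ℝ) :
    herm (e₀ K n + t • p) x = x 0 + t • herm p x := by
  rw [herm_add_left, herm_e₀, herm_smul_left]

theorem inner_e₀ (p : Vec K n) : ⟪e₀ K n, p⟫ = ⟪1, p 0⟫ := by
  have := inner_rmul (e₀ K n) p 1
  rwa [rmul_one, herm_e₀] at this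

/-- There is no linear term, as `p` is orthogonal to `e₀`. -/
theorem norm_add_smul_sq {p : Vec K n} (hp : ⟪1, p 0⟫ = 0) (t : ℝ) :
    ‖e₀ K n + t • p‖ ^ 2 = 1 + t ^ 2 * ‖p‖ ^ 2 := by
  rw [norm_add_sq_real, inner_smul_right, inner_e₀, hp, norm_e₀, norm_smul, mul_pow]
  simp

/-- The bilinear form whose symmetrization in `p`, `p'` is the second derivative of the homogeneous
metric at the base point; the arguments are ambient vectors. -/
def quadForm (a b c : ℝ) (p p' q q' : Vec K n × Vec K m) : ℝ :=
  a * (-(⟪p.1, p'.1⟫ * ⟪q.1, q'.1⟫) - ⟪herm p.1 q.1, herm p'.1 q'.1⟫) +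
    b * (-(⟪p.2, p'.2⟫ * ⟪q.2, q'.2⟫) - ⟪herm p.2 q.2, herm p'.2 q'.2⟫ +
      2 * ⟪p.2, p'.2⟫ * ⟪q.2 0, q'.2 0⟫) +
    c * (⟪(Im K).orthogonalProjectionOnto (herm p.2 q.2 - herm p.1 q.1),
        (Im K).orthogonalProjectionOnto (herm p'.2 q'.2 - herm p'.1 q'.1)⟫ -
      2 * ⟪p.2, p'.2⟫ * ⟪(Im K).orthogonalProjectionOnto (q.2 0),
        (Im K).orthogonalProjectionOnto (q'.2 0)⟫)

/-- The first derivative of the homogeneous metric at the base point. -/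
def linForm (b c : ℝ) (p q q' : Vec K n × Vec K m) : ℝ :=
  b * -(⟪q.2 0, herm p.2 q'.2⟫ + ⟪herm p.2 q.2, q'.2 0⟫) +
    c * (⟪(Im K).orthogonalProjectionOnto (q.2 0),
        (Im K).orthogonalProjectionOnto (herm p.2 q'.2 - herm p.1 q'.1)⟫ +
      ⟪(Im K).orthogonalProjectionOnto (herm p.2 q.2 - herm p.1 q.1),
        (Im K).orthogonalProjectionOnto (q'.2 0)⟫)

/-- The `2`-jet of `localForm` along lines through the origin. -/
theorem hasJet_localForm (a b c : ℝ) (y u v : Model K n m) :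
    ∃ c₀, HasJet (fun t => localForm a b c (t • y) u v) c₀
      (linForm b c (dlift y) (dlift u) (dlift v))
      (quadForm a b c (dlift y) (dlift y) (dlift u) (dlift v)) := by
  have hl (t : ℝ) : lift (t • y) = (e₀ K n + t • (dlift y).1, e₀ K m + t • (dlift y).2) := by
    rw [lift_eq, map_smul]
    rfl
  have n1 (t : ℝ) : ‖(lift (t • y)).1‖ ^ 2 = 1 + t ^ 2 * ‖(dlift y).1‖ ^ 2 := by
    rw [hl]; exact norm_add_smul_sq (by simp) t
  have n2 (t : ℝ) : ‖(lift (t • y)).2‖ ^ 2 = 1 + t ^ 2 * ‖(dlift y).2‖ ^ 2 := by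
    rw [hl]; exact norm_add_smul_sq (by simp [inner_one_im]) t
  have k1 (t : ℝ) (w : Model K n m) : herm (lift (t • y)).1 (dlift w).1 =
      t • herm (dlift y).1 (dlift w).1 := by
    rw [hl, herm_add_smul, dlift_fst_zero, zero_add]
  have k2 (t : ℝ) (w : Model K n m) : herm (lift (t • y)).2 (dlift w).2 =
      (dlift w).2 0 + t • herm (dlift y).2 (dlift w).2 := by
    rw [hl, herm_add_smul]
  have j1 := HasJet.inv_one_add (‖(dlift y).1‖ ^ 2) (by positivity)
  have j2 := HasJet.inv_one_add (‖(dlift y).2‖ ^ 2) (by positivity)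
  have jt := HasJet.id
  simp only [localForm, n1, n2, k1, k2]
  set P := (Im K).orthogonalProjectionOnto
  set A := herm (dlift y).1 (dlift u).1
  set A' := herm (dlift y).1 (dlift v).1
  set C := herm (dlift y).2 (dlift u).2
  set C' := herm (dlift y).2 (dlift v).2
  set γ := (dlift u).2 0
  set γ' := (dlift v).2 0
  -- the three summands of `localForm`, expanded in powers of `t` and of the inverse square norms
  have key := (((HasJet.const a).mul ((j1.mul (.const ⟪(dlift u).1, (dlift v).1⟫)).sub
    (((j1.mul j1).mul (jt.mul jt)).mul (.const ⟪A, A'⟫)))).add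
    ((HasJet.const b).mul ((j2.mul (.const ⟪(dlift u).2, (dlift v).2⟫)).sub
      ((j2.mul j2).mul (((HasJet.const ⟪γ, γ'⟫).add (jt.mul (.const (⟪γ, C'⟫ + ⟪C, γ'⟫)))).add
        ((jt.mul jt).mul (.const ⟪C, C'⟫))))))).add
    ((HasJet.const c).mul ((((j2.mul j2).mul (((HasJet.const ⟪P γ, P γ'⟫).add
        (jt.mul (.const (⟪P γ, P C'⟫ + ⟪P C, P γ'⟫)))).add
          ((jt.mul jt).mul (.const ⟪P C, P C'⟫)))).sub
      ((j1.mul j2).mul ((jt.mul (.const (⟪P γ, P A'⟫ + ⟪P A, P γ'⟫))).add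
        ((jt.mul jt).mul (.const (⟪P C, P A'⟫ + ⟪P A, P C'⟫)))))).add
      ((j1.mul j1).mul ((jt.mul jt).mul (.const ⟪P A, P A'⟫)))))
  refine ⟨_, key.congr ?_ ?_ ?_⟩
  · funext t
    simp only [map_sub, map_add, map_smul, inner_sub_left, inner_sub_right, inner_add_left,
      inner_add_right, real_inner_smul_left, real_inner_smul_right]
    ring
  · simp only [linForm, map_sub, inner_sub_left, inner_sub_right]
    ring
  · simp only [quadForm, map_sub, inner_sub_left, inner_sub_right, real_inner_self_eq_norm_sq]
    ring

variable (a b c : ℝ)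

theorem fderiv_localMetric_zero (y u v : Model K n m) :
    fderiv ℝ (localMetric K n m a b c) 0 y u v =
      linForm b c (dlift y) (dlift u) (dlift v) := by
  obtain ⟨c₀, h⟩ := hasJet_localForm a b c y u v
  simp only [← localMetric_apply] at h
  exact (fderiv_eq_of_hasJet (contDiff_localMetric a b c) h).1

theorem quadForm_add_add (p p' q q' : Vec K n × Vec K m) :
    quadForm a b c (p + p') (p + p') q q' = quadForm a b c p p q q' + quadForm a b c p' p' q q' +
      (quadForm a b c p p' q q' + quadForm a b c p' p q q') := by
  simp only [quadForm, Prod.fst_add, Prod.snd_add, herm_add_left, map_sub, map_add, inner_sub_left,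
    inner_sub_right, inner_add_left, inner_add_right]
  ring

/-- The second derivative is the polarization of its values on the diagonal. -/
theorem fderiv_fderiv_localMetric_zero (y y' u v : Model K n m) :
    fderiv ℝ (fderiv ℝ (localMetric K n m a b c)) 0 y y' u v =
      quadForm a b c (dlift y) (dlift y') (dlift u) (dlift v) +
        quadForm a b c (dlift y') (dlift y) (dlift u) (dlift v) := by
  have hg : ContDiff ℝ ∞ (localMetric K n m a b c) := contDiff_localMetric a b c
  have hd (y : Model K n m) : fderiv ℝ (fderiv ℝ (localMetric K n m a b c)) 0 y y u v =
      2 * quadForm a b c (dlift y) (dlift y) (dlift u) (dlift v) := by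
    obtain ⟨c₀, h⟩ := hasJet_localForm a b c y u v
    simp only [← localMetric_apply] at h
    exact (fderiv_eq_of_hasJet hg h).2
  have hs : fderiv ℝ (fderiv ℝ (localMetric K n m a b c)) 0 y y' =
      fderiv ℝ (fderiv ℝ (localMetric K n m a b c)) 0 y' y :=
    ((contDiff_infty.1 hg 2).contDiffAt.isSymmSndFDerivAt (by simp)).eq y y'
  have h := hd (y + y')
  rw [map_add dlift, quadForm_add_add] at h
  have h1 := hd y
  have h2 := hd y'
  have e : fderiv ℝ (fderiv ℝ (localMetric K n m a b c)) 0 (y + y') (y + y') u v =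
      fderiv ℝ (fderiv ℝ (localMetric K n m a b c)) 0 y y u v +
      fderiv ℝ (fderiv ℝ (localMetric K n m a b c)) 0 y' y' u v +
      2 * fderiv ℝ (fderiv ℝ (localMetric K n m a b c)) 0 y y' u v :=
    apply_add_add_of_symm _ hs u v
  linarith

end LocalJet

/-! ### Identities for the Hermitian product -/

section HermIdentities

variable {K : Type*} [NormedDivisionRing K] [InnerProductSpace ℝ K]
  [IsScalarTower ℝ K K] [SMulCommClass ℝ K K] [FiniteDimensional ℝ K]
  {n m : ℕ} [NeZero n] [NeZero m]

/-- The adjoint of right multiplication by `t` is right multiplication by `conj t`. -/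
theorem inner_mul_add_inner_mul (a b t : K) : ⟪a * t, b⟫ + ⟪a, b * t⟫ = 2 * ⟪1, t⟫ * ⟪a, b⟫ := by
  have h1 := inner_mul_mul_right a b (1 + t)
  have h2 := inner_mul_mul_right a b t
  rw [norm_add_sq_real, norm_one] at h1
  simp only [mul_add, mul_one, inner_add_left, inner_add_right] at h1
  linarith

theorem inner_mul_im (a b : K) (c : Im K) : ⟪a * c, b⟫ = -⟪a, b * c⟫ := by
  have := inner_mul_add_inner_mul a b (c : K)
  rw [inner_one_im] at this
  linarith

theorem inner_one_herm (u x : Vec K n) : ⟪1, herm u x⟫ = ⟪u, x⟫ := by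
  rw [← inner_rmul, rmul_one]

/-- The Hermitian symmetry. It is checked on real inner products, where it says that right
multiplication by imaginary scalars is skew-symmetric. -/
theorem herm_comm (u x : Vec K n) : herm x u = conj (herm u x) := by
  refine ext_inner_left ℝ fun t => ?_
  have h : ⟪rmul x t, u⟫ + ⟪rmul u t, x⟫ = 2 * ⟪1, t⟫ * ⟪u, x⟫ := by
    rw [real_inner_comm]
    simp only [PiLp.inner_apply, rmul, Finset.mul_sum, ← Finset.sum_add_distrib]
    refine Finset.sum_congr rfl fun i _ => ?_
    rw [add_comm, inner_mul_add_inner_mul]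
  rw [conj, inner_sub_right, inner_smul_right, inner_one_herm, ← inner_rmul, ← inner_rmul,
    real_inner_comm 1 t]
  linarith

/-- The inner product of imaginary parts. -/
theorem inner_proj_im (x y : K) : ⟪(Im K).orthogonalProjectionOnto x,
    (Im K).orthogonalProjectionOnto y⟫ = ⟪x, y⟫ - ⟪1, x⟫ * ⟪1, y⟫ := by
  have h : ⟪⟪1, x⟫ • (1 : K) + (Im K).orthogonalProjectionOnto x,
      ⟪1, y⟫ • (1 : K) + (Im K).orthogonalProjectionOnto y⟫ = ⟪x, y⟫ := by
    rw [real_add_im, real_add_im]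
  rw [inner_add_left, inner_add_right, inner_add_right, inner_smul_left, inner_smul_left,
    inner_smul_right, inner_smul_right, inner_one_im,
    real_inner_comm (1 : K) ((Im K).orthogonalProjectionOnto x : K), inner_one_im,
    real_inner_self_eq_norm_sq, norm_one] at h
  rw [Submodule.coe_inner]
  simp only [conj_trivial] at h
  linarith

/-- The contribution of the second derivatives of the homogeneous metric to its curvature. -/
theorem quadForm_alternating (a b c : ℝ) {x x' : Vec K n} {y y' : Vec K m} (hy : ⟪1, y 0⟫ = 0)
    (hy' : ⟪1, y' 0⟫ = 0) :
    quadForm a b c (x, y) (x', y') (x, y) (x', y') + quadForm a b c (x', y') (x, y) (x, y) (x', y') -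
        2 * quadForm a b c (x, y) (x, y) (x', y') (x', y') =
      a * (‖x‖ ^ 2 * ‖x'‖ ^ 2 - 4 * ⟪x, x'⟫ ^ 2 + 3 * ‖herm x x'‖ ^ 2) +
        b * (‖y‖ ^ 2 * ‖y'‖ ^ 2 - 4 * ⟪y, y'⟫ ^ 2 + 3 * ‖herm y y'‖ ^ 2) -
        c * (3 * (‖herm y y' - herm x x'‖ ^ 2 - (⟪y, y'⟫ - ⟪x, x'⟫) ^ 2)) +
        4 * (b - c) * (⟪y, y'⟫ * ⟪y 0, y' 0⟫ - ‖y‖ ^ 2 * ‖y' 0‖ ^ 2) := by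
  simp only [quadForm, inner_proj_im, herm_comm x x', herm_comm y y', herm_self, conj, hy, hy',
    ← real_inner_self_eq_norm_sq (_ : K), inner_sub_left, inner_sub_right, inner_smul_left,
    inner_smul_right, inner_one_herm, conj_trivial]
  simp only [real_inner_self_eq_norm_sq, norm_one, real_inner_comm (herm y y') (herm x x'),
    real_inner_comm x x', real_inner_comm y y']
  ring

end HermIdentities

/-! ### The Christoffel symbols at the base point -/

section Christoffel

variable {K : Type*} [NormedDivisionRing K] [InnerProductSpace ℝ K]
  [IsScalarTower ℝ K K] [SMulCommClass ℝ K K] [FiniteDimensional ℝ K]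
  {n m : ℕ} [NeZero n] [NeZero m]

/-- The Christoffel symbols at the base point of the homogeneous metric. -/
def baseChristoffel (a b c : ℝ) (u v : Model K n m) : Model K n m :=
  (fun i => (-(c / a)) • (u.1 i * v.2.2 + v.1 i * u.2.2),
    fun i => ((c - b) / b) • (u.2.1 i * v.2.2 + v.2.1 i * u.2.2), 0)

theorem inner_coe_proj_im (c : Im K) (x : K) :
    ⟪(Im K).orthogonalProjectionOnto (c : K), (Im K).orthogonalProjectionOnto x⟫ = ⟪(c : K), x⟫ := by
  rw [inner_proj_im, inner_one_im, zero_mul, sub_zero]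

theorem inner_im_herm_dlift_fst (c : Im K) (u v : Model K n m) :
    ⟪(c : K), herm (dlift u).1 (dlift v).1⟫ = ∑ i, ⟪u.1 i * c, v.1 i⟫ := by
  rw [dlift_eq_emb, dlift_eq_emb, herm_emb, inner_sum]
  exact Finset.sum_congr rfl fun i _ => (inner_mul_left_eq _ _ _).symm

/-- The zeroth entries are imaginary, which accounts for the sign. -/
theorem herm_dlift_snd (u v : Model K n m) :
    herm (dlift u).2 (dlift v).2 = (∑ i, conj (u.2.1 i) * v.2.1 i) - (u.2.2 : K) * v.2.2 := by
  refine ext_inner_left ℝ fun t => ?_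
  have h := sum_ne_zero_add (fun i => ⟪t, conj ((dlift u).2 i) * (dlift v).2 i⟫)
  rw [herm, inner_sum, inner_sub_right, inner_sum]
  simp only [dlift_snd_coe, dlift_snd_zero, conj_im, neg_mul, inner_neg_right] at h
  linarith

theorem inner_im_herm_dlift_snd (c : Im K) (u v : Model K n m) :
    ⟪(c : K), herm (dlift u).2 (dlift v).2⟫ =
      ∑ i, ⟪u.2.1 i * c, v.2.1 i⟫ - ⟪(c : K), (u.2.2 : K) * v.2.2⟫ := by
  rw [herm_dlift_snd, inner_sub_right, inner_sum]
  congr 1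
  exact Finset.sum_congr rfl fun i _ => (inner_mul_left_eq _ _ _).symm

theorem linForm_dlift (b c : ℝ) (y u v : Model K n m) :
    linForm b c (dlift y) (dlift u) (dlift v) =
      (c - b) * (∑ i, ⟪y.2.1 i * u.2.2, v.2.1 i⟫ - ⟪(u.2.2 : K), (y.2.2 : K) * v.2.2⟫ +
        (∑ i, ⟪y.2.1 i * v.2.2, u.2.1 i⟫ - ⟪(v.2.2 : K), (y.2.2 : K) * u.2.2⟫)) -
      c * (∑ i, ⟪y.1 i * u.2.2, v.1 i⟫ + ∑ i, ⟪y.1 i * v.2.2, u.1 i⟫) := by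
  simp only [linForm, dlift_snd_zero]
  rw [real_inner_comm ((Im K).orthogonalProjectionOnto (v.2.2 : K)), inner_coe_proj_im,
    inner_coe_proj_im, real_inner_comm (v.2.2 : K), inner_sub_right, inner_sub_right,
    inner_im_herm_dlift_fst, inner_im_herm_dlift_fst, inner_im_herm_dlift_snd,
    inner_im_herm_dlift_snd]
  ring

/-- The Koszul formula at the base point. -/
theorem blockForm_baseChristoffel {a b : ℝ} (c : ℝ) (ha : a ≠ 0) (hb : b ≠ 0)
    (u v w : Model K n m) :
    blockForm K n m a b c (baseChristoffel a b c u v) w =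
      koszul (localMetric K n m a b c) 0 u v w := by
  have hF {l : ℕ} [NeZero l] (p q : {i : Fin l // i ≠ 0} → K) (z : Im K) :
      ∑ i, ⟪p i * z, q i⟫ = -∑ i, ⟪q i * z, p i⟫ := by
    rw [← Finset.sum_neg_distrib]
    exact Finset.sum_congr rfl fun i _ => by rw [inner_mul_im, real_inner_comm]
  have hI (x y z : Im K) : ⟪(x : K), (y : K) * z⟫ = -⟪(y : K), (x : K) * z⟫ := by
    rw [real_inner_comm, inner_mul_im]
  have hI' (x y z : Im K) : ⟪(x : K), (y : K) * z⟫ = -⟪(z : K), (y : K) * x⟫ := by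
    rw [real_inner_comm, inner_mul_left_eq, conj_im, neg_mul, inner_neg_right]
  -- the terms with three imaginary entries are alternating, and cancel
  have t1 := hI' v.2.2 u.2.2 w.2.2
  have t2 := hI u.2.2 v.2.2 w.2.2
  have t3 := hI' u.2.2 v.2.2 w.2.2
  have t4 := hI u.2.2 w.2.2 v.2.2
  have t5 := hI v.2.2 w.2.2 u.2.2
  rw [koszul_apply, fderiv_localMetric_zero, fderiv_localMetric_zero, fderiv_localMetric_zero,
    linForm_dlift, linForm_dlift, linForm_dlift, blockForm_apply]
  simp only [baseChristoffel, inner_smul_left, inner_add_left, conj_trivial, ← Finset.mul_sum,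
    Finset.sum_add_distrib, inner_zero_left]
  rw [hF w.1 u.1, hF w.1 v.1, hF w.2.1 u.2.1, hF w.2.1 v.2.1, hF v.1 u.1, hF v.2.1 u.2.1, t4, t5,
    ← neg_eq_iff_eq_neg.2 t3, t2, t1]
  field_simp
  ring

end Christoffel

/-! ### The curvature at the base point -/

section CurvatureTerm

variable {K : Type*} [NormedDivisionRing K] [InnerProductSpace ℝ K]
  [IsScalarTower ℝ K K] [SMulCommClass ℝ K K] [FiniteDimensional ℝ K]
  {n m : ℕ} [NeZero n] [NeZero m]

/-- The contribution of the vectors `u`, `v` to the scalar curvature at the base point, provided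
that the Christoffel symbols vanish at `(u, u)`. -/
def curvTerm (a b c : ℝ) (u v : Model K n m) : ℝ :=
  a * ((∑ i, ⟪u.1 i, u.1 i⟫) * (∑ i, ⟪v.1 i, v.1 i⟫) - 4 * (∑ i, ⟪u.1 i, v.1 i⟫) ^ 2 +
      3 * ‖∑ i, conj (u.1 i) * v.1 i‖ ^ 2) +
    b * ((∑ i, ⟪u.2.1 i, u.2.1 i⟫ + ⟪u.2.2, u.2.2⟫) * (∑ i, ⟪v.2.1 i, v.2.1 i⟫ + ⟪v.2.2, v.2.2⟫) -
      4 * (∑ i, ⟪u.2.1 i, v.2.1 i⟫ + ⟪u.2.2, v.2.2⟫) ^ 2 +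
      3 * ‖∑ i, conj (u.2.1 i) * v.2.1 i - (u.2.2 : K) * v.2.2‖ ^ 2) -
    c * (3 * (‖∑ i, conj (u.2.1 i) * v.2.1 i - (u.2.2 : K) * v.2.2 -
        ∑ i, conj (u.1 i) * v.1 i‖ ^ 2 -
      (∑ i, ⟪u.2.1 i, v.2.1 i⟫ + ⟪u.2.2, v.2.2⟫ - ∑ i, ⟪u.1 i, v.1 i⟫) ^ 2)) +
    4 * (b - c) * ((∑ i, ⟪u.2.1 i, v.2.1 i⟫ + ⟪u.2.2, v.2.2⟫) * ⟪u.2.2, v.2.2⟫ -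
      (∑ i, ⟪u.2.1 i, u.2.1 i⟫ + ⟪u.2.2, u.2.2⟫) * ‖v.2.2‖ ^ 2) +
    c ^ 2 / a * ∑ i, ‖u.1 i * v.2.2 + v.1 i * u.2.2‖ ^ 2 +
    (c - b) ^ 2 / b * ∑ i, ‖u.2.1 i * v.2.2 + v.2.1 i * u.2.2‖ ^ 2

theorem inner_dlift_fst (u v : Model K n m) :
    ⟪(dlift u).1, (dlift v).1⟫ = ∑ i, ⟪u.1 i, v.1 i⟫ := by
  have h := sum_ne_zero_add (fun i => ⟪(dlift u).1 i, (dlift v).1 i⟫)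
  simp only [dlift_fst_coe, dlift_fst_zero, inner_zero_left, sub_zero] at h
  rw [PiLp.inner_apply, h]

theorem inner_dlift_snd (u v : Model K n m) :
    ⟪(dlift u).2, (dlift v).2⟫ = ∑ i, ⟪u.2.1 i, v.2.1 i⟫ + ⟪u.2.2, v.2.2⟫ := by
  have h := sum_ne_zero_add (fun i => ⟪(dlift u).2 i, (dlift v).2 i⟫)
  simp only [dlift_snd_coe, dlift_snd_zero] at h
  rw [PiLp.inner_apply, h, Submodule.coe_inner, sub_add_cancel]

theorem blockForm_baseChristoffel_self {a b : ℝ} (c : ℝ) (ha : a ≠ 0) (hb : b ≠ 0)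
    (u v : Model K n m) :
    blockForm K n m a b c (baseChristoffel a b c u v) (baseChristoffel a b c u v) =
      c ^ 2 / a * ∑ i, ‖u.1 i * v.2.2 + v.1 i * u.2.2‖ ^ 2 +
        (c - b) ^ 2 / b * ∑ i, ‖u.2.1 i * v.2.2 + v.2.1 i * u.2.2‖ ^ 2 := by
  simp only [blockForm_apply, baseChristoffel, inner_smul_left, inner_smul_right, conj_trivial,
    ← Finset.mul_sum, real_inner_self_eq_norm_sq, inner_zero_left]
  field_simp
  ring

theorem localMetric_zero (a b c : ℝ) : localMetric K n m a b c 0 = blockForm K n m a b c :=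
  ContinuousLinearMap.ext fun u => ContinuousLinearMap.ext fun v => by
    rw [localMetric_apply, localForm_zero]

/-- `baseChristoffel` gives the Christoffel symbols, by nondegeneracy of the form at the base point.
-/
theorem christoffel_localMetric {a b : ℝ} (c : ℝ) (ha : a ≠ 0) (hb : b ≠ 0)
    (hinv : (localMetric K n m a b c 0).IsInvertible) (u v : Model K n m) :
    christoffel (localMetric K n m a b c) 0 u v = baseChristoffel a b c u v := by
  have h : localMetric K n m a b c 0 (baseChristoffel a b c u v) =
      koszul (localMetric K n m a b c) 0 u v := by
    refine ContinuousLinearMap.ext fun w => ?_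
    rw [localMetric_zero, blockForm_baseChristoffel c ha hb]
  rw [christoffel_apply, ← h, hinv.inverse_apply_self]

theorem quadForm_dlift_alternating (a b c : ℝ) (u v : Model K n m) :
    quadForm a b c (dlift u) (dlift v) (dlift u) (dlift v) +
        quadForm a b c (dlift v) (dlift u) (dlift u) (dlift v) -
        2 * quadForm a b c (dlift u) (dlift u) (dlift v) (dlift v) +
      (c ^ 2 / a * ∑ i, ‖u.1 i * v.2.2 + v.1 i * u.2.2‖ ^ 2 +
        (c - b) ^ 2 / b * ∑ i, ‖u.2.1 i * v.2.2 + v.2.1 i * u.2.2‖ ^ 2) = curvTerm a b c u v := by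
  have hq := quadForm_alternating a b c (x := (dlift u).1) (x' := (dlift v).1) (y := (dlift u).2)
    (y' := (dlift v).2) (by simp [inner_one_im]) (by simp [inner_one_im])
  simp only [Prod.mk.eta] at hq
  have h1 : herm (dlift u).1 (dlift v).1 = ∑ i, conj (u.1 i) * v.1 i := by
    rw [dlift_eq_emb, dlift_eq_emb, herm_emb]
  rw [hq, curvTerm, herm_dlift_snd, h1, ← real_inner_self_eq_norm_sq (dlift u).1,
    ← real_inner_self_eq_norm_sq (dlift v).1, ← real_inner_self_eq_norm_sq (dlift u).2,
    ← real_inner_self_eq_norm_sq (dlift v).2, inner_dlift_fst, inner_dlift_fst, inner_dlift_fst,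
    inner_dlift_snd, inner_dlift_snd, inner_dlift_snd, dlift_snd_zero, dlift_snd_zero,
    ← Submodule.coe_inner, Submodule.coe_norm]
  ring

/-- The summands in `scalarCurvatureAt_eq` for the homogeneous metric. -/
theorem curvature_summand {a b : ℝ} (c : ℝ) (ha : a ≠ 0) (hb : b ≠ 0)
    (hinv : (localMetric K n m a b c 0).IsInvertible) {u : Model K n m}
    (hu : baseChristoffel a b c u u = 0) (v : Model K n m) :
    fderiv ℝ (fderiv ℝ (localMetric K n m a b c)) 0 u v u v -
        fderiv ℝ (fderiv ℝ (localMetric K n m a b c)) 0 u u v v +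
        localMetric K n m a b c 0 (christoffel (localMetric K n m a b c) 0 u v)
          (christoffel (localMetric K n m a b c) 0 u v) -
        localMetric K n m a b c 0 (christoffel (localMetric K n m a b c) 0 u u)
          (christoffel (localMetric K n m a b c) 0 v v) = curvTerm a b c u v := by
  rw [christoffel_localMetric c ha hb hinv u v, christoffel_localMetric c ha hb hinv u u, hu,
    fderiv_fderiv_localMetric_zero, fderiv_fderiv_localMetric_zero, ← two_mul,
    ← quadForm_dlift_alternating, ← blockForm_baseChristoffel_self c ha hb, localMetric_zero,
    map_zero, zero_apply, sub_zero]

end CurvatureTerm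

/-! ### The curvature on the standard basis -/

section Basis

variable (K : Type*) [NormedDivisionRing K] [InnerProductSpace ℝ K]
  [IsScalarTower ℝ K K] [SMulCommClass ℝ K K] [FiniteDimensional ℝ K]
  (n m : ℕ) [NeZero n] [NeZero m]

/-- The index set of the standard real basis of `K ^ (n - 1)`. -/
abbrev BlockIndex : Type := (_ : {i : Fin n // i ≠ 0}) × Fin (Module.finrank ℝ K)

/-- The standard real basis of the model space. -/
def modelBasis : Module.Basis
    (BlockIndex K n ⊕ (BlockIndex K m ⊕ Fin (Module.finrank ℝ (Im K)))) ℝ (Model K n m) :=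
  (Pi.basis fun _ => (stdOrthonormalBasis ℝ K).toBasis).prod
    ((Pi.basis fun _ => (stdOrthonormalBasis ℝ K).toBasis).prod
      (stdOrthonormalBasis ℝ (Im K)).toBasis)

variable {K n m}

theorem modelBasis_inl (p : BlockIndex K n) :
    modelBasis K n m (.inl p) = (Pi.single p.1 (stdOrthonormalBasis ℝ K p.2), 0, 0) := by
  simp [modelBasis, Module.Basis.prod_apply]
  rfl

theorem modelBasis_inr_inl (p : BlockIndex K m) :
    modelBasis K n m (.inr (.inl p)) = (0, Pi.single p.1 (stdOrthonormalBasis ℝ K p.2), 0) := by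
  simp [modelBasis, Module.Basis.prod_apply]

theorem modelBasis_inr_inr (s : Fin (Module.finrank ℝ (Im K))) :
    modelBasis K n m (.inr (.inr s)) = (0, 0, stdOrthonormalBasis ℝ (Im K) s) := by
  simp [modelBasis, Module.Basis.prod_apply]

theorem sum_inner_single (p q : BlockIndex K n) :
    ∑ k, ⟪(Pi.single p.1 (stdOrthonormalBasis ℝ K p.2) : {i : Fin n // i ≠ 0} → K) k,
      (Pi.single q.1 (stdOrthonormalBasis ℝ K q.2) : {i : Fin n // i ≠ 0} → K) k⟫ =
      if p = q then 1 else 0 := by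
  obtain ⟨i, s⟩ := p
  obtain ⟨j, t⟩ := q
  rw [Finset.sum_eq_single i (fun k _ hk => by simp [Pi.single_apply, hk]) (by simp)]
  by_cases h : i = j
  · subst h
    simp [orthonormal_iff_ite.1 (stdOrthonormalBasis ℝ K).orthonormal]
  · simp [h]

theorem norm_sum_conj_single (p q : BlockIndex K n) :
    ‖∑ k, conj ((Pi.single p.1 (stdOrthonormalBasis ℝ K p.2) : {i : Fin n // i ≠ 0} → K) k) *
      (Pi.single q.1 (stdOrthonormalBasis ℝ K q.2) : {i : Fin n // i ≠ 0} → K) k‖ ^ 2 =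
      if p.1 = q.1 then 1 else 0 := by
  obtain ⟨i, s⟩ := p
  obtain ⟨j, t⟩ := q
  have hc (x : K) : ‖conj x‖ = ‖x‖ := by
    rcases eq_or_ne x 0 with rfl | hx
    · simp [conj]
    · have h := congrArg norm (conj_mul_self x)
      rw [norm_mul, norm_smul, norm_one, mul_one, norm_pow, norm_norm, sq] at h
      exact mul_right_cancel₀ (norm_ne_zero_iff.2 hx) h
  rw [Finset.sum_eq_single i (fun k _ hk => by simp [Pi.single_apply, hk, conj]) (by simp)]
  by_cases h : i = j
  · subst h
    simp [hc]
  · simp [h]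

theorem sum_norm_single_mul (p : BlockIndex K n) (z : K) :
    ∑ k, ‖(Pi.single p.1 (stdOrthonormalBasis ℝ K p.2) : {i : Fin n // i ≠ 0} → K) k * z‖ ^ 2 =
      ‖z‖ ^ 2 := by
  rw [Finset.sum_eq_single p.1 (fun k _ hk => by simp [hk]) (by simp)]
  simp

theorem conj_zero : conj (0 : K) = 0 := by simp [conj]

variable (a b c : ℝ)

theorem norm_coe_basis_im (s : Fin (Module.finrank ℝ (Im K))) :
    ‖(stdOrthonormalBasis ℝ (Im K) s : K)‖ = 1 :=
  (stdOrthonormalBasis ℝ (Im K)).norm_eq_one s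

theorem inner_basis_im (s t : Fin (Module.finrank ℝ (Im K))) :
    ⟪stdOrthonormalBasis ℝ (Im K) s, stdOrthonormalBasis ℝ (Im K) t⟫ = if s = t then 1 else 0 :=
  orthonormal_iff_ite.1 (stdOrthonormalBasis ℝ (Im K)).orthonormal s t

/-- Within the first two blocks the term depends on whether the two basis vectors are equal, and on
whether they lie in the same `K`-line. -/
theorem curvTerm_inl_inl (p q : BlockIndex K n) :
    curvTerm a b c (modelBasis K n m (.inl p)) (modelBasis K n m (.inl q)) =
      a + 3 * (a - c) * (if p.1 = q.1 then 1 else 0) +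
        (3 * c - 4 * a) * (if p = q then 1 else 0) := by
  simp only [curvTerm, modelBasis_inl, sum_inner_single]
  simp [conj_zero, norm_sum_conj_single]
  split_ifs <;> ring

theorem curvTerm_inr_inl_inr_inl (p q : BlockIndex K m) :
    curvTerm a b c (modelBasis K n m (.inr (.inl p))) (modelBasis K n m (.inr (.inl q))) =
      b + 3 * (b - c) * (if p.1 = q.1 then 1 else 0) +
        (3 * c - 4 * b) * (if p = q then 1 else 0) := by
  simp only [curvTerm, modelBasis_inr_inl, sum_inner_single]
  simp [conj_zero, norm_sum_conj_single]
  split_ifs <;> ring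

theorem curvTerm_inr_inr_inr_inr (s t : Fin (Module.finrank ℝ (Im K))) :
    curvTerm a b c (modelBasis K n m (.inr (.inr s))) (modelBasis K n m (.inr (.inr t))) =
      c - c * (if s = t then 1 else 0) := by
  simp only [curvTerm, modelBasis_inr_inr, inner_basis_im]
  simp [conj_zero, norm_coe_basis_im]
  split_ifs <;> ring

theorem curvTerm_inl_inr_inl (p : BlockIndex K n) (q : BlockIndex K m) :
    curvTerm a b c (modelBasis K n m (.inl p)) (modelBasis K n m (.inr (.inl q))) = 0 := by
  simp [curvTerm, modelBasis_inl, modelBasis_inr_inl, conj_zero]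

theorem curvTerm_inr_inl_inl (p : BlockIndex K m) (q : BlockIndex K n) :
    curvTerm a b c (modelBasis K n m (.inr (.inl p))) (modelBasis K n m (.inl q)) = 0 := by
  simp [curvTerm, modelBasis_inl, modelBasis_inr_inl, conj_zero]

theorem curvTerm_inl_inr_inr (p : BlockIndex K n) (s : Fin (Module.finrank ℝ (Im K))) :
    curvTerm a b c (modelBasis K n m (.inl p)) (modelBasis K n m (.inr (.inr s))) = c ^ 2 / a := by
  simp only [curvTerm, modelBasis_inl, modelBasis_inr_inr]
  simp only [Submodule.coe_zero, mul_zero, add_zero, sum_norm_single_mul]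
  simp [conj_zero, norm_coe_basis_im]

theorem curvTerm_inr_inr_inl (p : BlockIndex K n) (s : Fin (Module.finrank ℝ (Im K))) :
    curvTerm a b c (modelBasis K n m (.inr (.inr s))) (modelBasis K n m (.inl p)) = c ^ 2 / a := by
  simp only [curvTerm, modelBasis_inl, modelBasis_inr_inr]
  simp only [Submodule.coe_zero, mul_zero, zero_add, sum_norm_single_mul]
  simp [conj_zero, norm_coe_basis_im]

variable {b}

/-- The asymmetry with `curvTerm_inr_inr_inr_inl` comes from the coordinates: only the sum of the
two terms is intrinsic. -/
theorem curvTerm_inr_inl_inr_inr (hb : b ≠ 0) (p : BlockIndex K m)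
    (s : Fin (Module.finrank ℝ (Im K))) :
    curvTerm a b c (modelBasis K n m (.inr (.inl p))) (modelBasis K n m (.inr (.inr s))) =
      c ^ 2 / b + 2 * c - 2 * b := by
  simp only [curvTerm, modelBasis_inr_inl, modelBasis_inr_inr, sum_inner_single]
  simp only [Submodule.coe_zero, mul_zero, add_zero, sum_norm_single_mul]
  simp [conj_zero, norm_coe_basis_im]
  field_simp
  ring

theorem curvTerm_inr_inr_inr_inl (hb : b ≠ 0) (p : BlockIndex K m)
    (s : Fin (Module.finrank ℝ (Im K))) :
    curvTerm a b c (modelBasis K n m (.inr (.inr s))) (modelBasis K n m (.inr (.inl p))) =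
      c ^ 2 / b - 2 * c + 2 * b := by
  simp only [curvTerm, modelBasis_inr_inl, modelBasis_inr_inr, sum_inner_single]
  simp only [Submodule.coe_zero, mul_zero, zero_add, sum_norm_single_mul]
  simp [conj_zero, norm_coe_basis_im]
  field_simp
  ring

end Basis

/-! ### The scalar curvature of a homogeneous metric -/

section ScalarCurvature

/-- A version of `scalarCurvatureAt_eq` with the summands replaced by given values. -/
theorem scalarCurvatureAt_eq_of_summand {E : Type*} [NormedAddCommGroup E] [NormedSpace ℝ E]
    [FiniteDimensional ℝ E] {g : E → E →L[ℝ] E →L[ℝ] ℝ} {x : E} {ι : Type*} [Fintype ι]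
    [DecidableEq ι] (hg : ContDiffAt ℝ 2 g x) (hs : ∀ y u v, g y u v = g y v u)
    (e : Module.Basis ι ℝ E) (l : ι → ℝ) (hl : ∀ i, l i ≠ 0)
    (hB : ∀ i j, g x (e i) (e j) = if i = j then l i else 0) (T : ι → ι → ℝ)
    (hT : ∀ i j, fderiv ℝ (fderiv ℝ g) x (e i) (e j) (e i) (e j) -
      fderiv ℝ (fderiv ℝ g) x (e i) (e i) (e j) (e j) +
      g x (christoffel g x (e i) (e j)) (christoffel g x (e i) (e j)) -
      g x (christoffel g x (e i) (e i)) (christoffel g x (e j) (e j)) = T i j) :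
    scalarCurvatureAt g x = ∑ i, ∑ j, (l i)⁻¹ * (l j)⁻¹ * T i j := by
  simp only [scalarCurvatureAt_eq hg hs e l hl hB, hT]

variable {K : Type*} [NormedDivisionRing K] [InnerProductSpace ℝ K]
  [IsScalarTower ℝ K K] [SMulCommClass ℝ K K] [FiniteDimensional ℝ K]
  {n m : ℕ} [NeZero n] [NeZero m]

/-- Each basis vector shares its `K`-line with `dim K` basis vectors. -/
theorem sum_block (x y z : ℝ) (p : BlockIndex K n) :
    ∑ q : BlockIndex K n, (x + y * (if p.1 = q.1 then 1 else 0) + z * (if p = q then 1 else 0)) =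
      Fintype.card (BlockIndex K n) * x + Module.finrank ℝ K * y + z := by
  have h1 : ∑ q : BlockIndex K n, (if p.1 = q.1 then (1 : ℝ) else 0) = Module.finrank ℝ K := by
    rw [Fintype.sum_sigma, Finset.sum_comm]
    simp
  rw [Finset.sum_add_distrib, Finset.sum_add_distrib, ← Finset.mul_sum, ← Finset.mul_sum, h1,
    Finset.sum_ite_eq]
  simp [mul_comm]

theorem card_blockIndex : Fintype.card (BlockIndex K n) = (n - 1) * Module.finrank ℝ K := by
  rw [Fintype.card_sigma]
  simp [Fintype.card_subtype_compl]

theorem finrank_im : Module.finrank ℝ (Im K) = Module.finrank ℝ K - 1 := by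
  have h := Submodule.finrank_add_finrank_orthogonal (ℝ ∙ (1 : K))
  rw [finrank_span_singleton one_ne_zero] at h
  exact Nat.eq_sub_of_add_eq' h

/-- The standard basis is orthogonal for the homogeneous metrics. -/
theorem localMetric_modelBasis (a b c : ℝ)
    (i j : BlockIndex K n ⊕ (BlockIndex K m ⊕ Fin (Module.finrank ℝ (Im K)))) :
    localMetric K n m a b c 0 (modelBasis K n m i) (modelBasis K n m j) =
      if i = j then Sum.elim (fun _ => a) (Sum.elim (fun _ => b) fun _ => c) i else 0 := by
  rw [localMetric_zero, blockForm_apply]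
  rcases i with p | p | p <;> rcases j with q | q | q <;>
    simp only [modelBasis_inl, modelBasis_inr_inl, modelBasis_inr_inr, sum_inner_single,
      inner_basis_im] <;> simp

/-- No basis vector has nonzero entries both in the imaginary block and in another one. -/
theorem baseChristoffel_modelBasis (a b c : ℝ)
    (i : BlockIndex K n ⊕ (BlockIndex K m ⊕ Fin (Module.finrank ℝ (Im K)))) :
    baseChristoffel a b c (modelBasis K n m i) (modelBasis K n m i) = 0 := by
  rcases i with p | p | p <;>
    simp [baseChristoffel, modelBasis_inl, modelBasis_inr_inl, modelBasis_inr_inr] <;>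
      exact ⟨rfl, rfl⟩

theorem sum_elim_ne_zero {a b c : ℝ} (ha : a ≠ 0) (hb : b ≠ 0) (hc : c ≠ 0)
    (i : BlockIndex K n ⊕ (BlockIndex K m ⊕ Fin (Module.finrank ℝ (Im K)))) :
    Sum.elim (fun _ => a) (Sum.elim (fun _ => b) fun _ => c) i ≠ 0 := by
  rcases i with p | p | p <;> assumption

theorem scalarCurvatureAt_localMetric_eq_sum {a b c : ℝ} (ha : a ≠ 0) (hb : b ≠ 0) (hc : c ≠ 0) :
    scalarCurvatureAt (localMetric K n m a b c) 0 = ∑ i, ∑ j,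
      (Sum.elim (fun _ => a) (Sum.elim (fun _ => b) fun _ => c) i)⁻¹ *
        (Sum.elim (fun _ => a) (Sum.elim (fun _ => b) fun _ => c) j)⁻¹ *
        curvTerm a b c (modelBasis K n m i) (modelBasis K n m j) := by
  have hl := sum_elim_ne_zero (K := K) (n := n) (m := m) ha hb hc
  have hinv := isInvertible_of_orthogonal (modelBasis K n m) _ _ hl (localMetric_modelBasis a b c)
  have hg : ContDiff ℝ ∞ (localMetric K n m a b c) := contDiff_localMetric a b c
  exact scalarCurvatureAt_eq_of_summand
    (contDiff_infty.1 hg 2).contDiffAt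
    (localMetric_symm a b c) (modelBasis K n m) _ hl (localMetric_modelBasis a b c) _
    fun i j => curvature_summand c ha hb hinv (baseChristoffel_modelBasis a b c i) _

/-- Summation of the curvature terms over the pairs of blocks. For `r = k - 1` the coefficients of
`c / a ^ 2` and `c / b ^ 2` become `N₁ * r` and `N₂ * r`. -/
theorem sum_curvTerm {a b c : ℝ} (ha : a ≠ 0) (hb : b ≠ 0) (hc : c ≠ 0) {N₁ N₂ k r : ℝ}
    (hN₁ : (Fintype.card (BlockIndex K n) : ℝ) = N₁)
    (hN₂ : (Fintype.card (BlockIndex K m) : ℝ) = N₂) (hk : (Module.finrank ℝ K : ℝ) = k)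
    (hr : (Module.finrank ℝ (Im K) : ℝ) = r) :
    ∑ i, ∑ j, (Sum.elim (fun _ => a) (Sum.elim (fun _ => b) fun _ => c) i)⁻¹ *
        (Sum.elim (fun _ => a) (Sum.elim (fun _ => b) fun _ => c) j)⁻¹ *
        curvTerm a b c (modelBasis K n m i) (modelBasis K n m j) =
      N₁ * (N₁ + 3 * k - 4) / a + N₂ * (N₂ + 3 * k - 4) / b + r * (r - 1) / c -
        c * (N₁ * (3 * (k - 1) - 2 * r) / a ^ 2 + N₂ * (3 * (k - 1) - 2 * r) / b ^ 2) := by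
  simp only [Fintype.sum_sum_type, Sum.elim_inl, Sum.elim_inr, curvTerm_inl_inl,
    curvTerm_inr_inl_inr_inl, curvTerm_inr_inr_inr_inr, curvTerm_inl_inr_inl, curvTerm_inr_inl_inl,
    curvTerm_inl_inr_inr, curvTerm_inr_inr_inl, curvTerm_inr_inl_inr_inr a c hb,
    curvTerm_inr_inr_inr_inl a c hb, ← Finset.mul_sum, sum_block]
  simp only [Finset.sum_const, Finset.card_univ, nsmul_eq_mul, Finset.sum_sub_distrib,
    Finset.sum_ite_eq, Finset.mem_univ, if_true, ← Finset.mul_sum, Fintype.card_fin, hN₁, hN₂,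
    hk, hr]
  field_simp
  ring

end ScalarCurvature

/-! ### The space of invariant metrics of positive scalar curvature -/

section Contractible

/-- A retract of a contractible space is contractible: `Ψ` is the inclusion and `Φ` the retraction.
-/
theorem contractibleSpace_of_section {P X : Type*} [TopologicalSpace P] [TopologicalSpace X]
    [ContractibleSpace P] (Φ : C(P, X)) (Ψ : C(X, P)) (h : ∀ x, Φ (Ψ x) = x) :
    ContractibleSpace X := by
  rw [contractible_iff_id_nullhomotopic]
  have h1 : (Φ.comp (ContinuousMap.id P)).Nullhomotopic :=
    ContinuousMap.Nullhomotopic.comp_right (id_nullhomotopic P) Φ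
  have h2 := ContinuousMap.Nullhomotopic.comp_left h1 Ψ
  rwa [show (Φ.comp (ContinuousMap.id P)).comp Ψ = ContinuousMap.id X from
    ContinuousMap.ext h] at h2

variable (K : Type*) [NormedDivisionRing K] [InnerProductSpace ℝ K]
  [IsScalarTower ℝ K K] [SMulCommClass ℝ K K] [FiniteDimensional ℝ K]
  (n m : ℕ) [NeZero n] [NeZero m]

/-- The real dimension of the block `K ^ (n - 1)` of the model space. -/
def blockDim : ℝ := (n - 1 : ℕ) * Module.finrank ℝ K

/-- `c` times the scalar curvature of the homogeneous metric with the parameters `a`, `b`, `c`, as a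
function of `s = c / a` and `t = c / b`. -/
def scaledCurvature (s t : ℝ) : ℝ :=
  blockDim K n * (blockDim K n + 3 * Module.finrank ℝ K - 4) * s +
    blockDim K m * (blockDim K m + 3 * Module.finrank ℝ K - 4) * t +
    (Module.finrank ℝ K - 1) * (Module.finrank ℝ K - 2) -
    (blockDim K n * (Module.finrank ℝ K - 1) * s ^ 2 +
      blockDim K m * (Module.finrank ℝ K - 1) * t ^ 2)

/-- The parameters `(c, c / a, c / b)` of the homogeneous metrics of positive scalar curvature. -/
def pscParams : Set (ℝ × ℝ × ℝ) :=
  {t | 0 < t.1 ∧ 0 < t.2.1 ∧ 0 < t.2.2 ∧ 0 < scaledCurvature K n m t.2.1 t.2.2}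

theorem one_le_finrank : (1 : ℝ) ≤ Module.finrank ℝ K := by
  exact_mod_cast Module.finrank_pos (R := ℝ) (M := K)

/-- The scalar curvature of a homogeneous metric. `M` fibers over the product of two projective
spaces, with fiber the unit scalars: the two linear terms of `scaledCurvature` come from the
projective spaces, the constant term from the fiber, and the quadratic term is the negative
contribution of the fibration. -/
theorem scalarCurvatureAt_localMetric {a b c : ℝ} (ha : a ≠ 0) (hb : b ≠ 0) (hc : c ≠ 0) :
    scalarCurvatureAt (localMetric K n m a b c) 0 = scaledCurvature K n m (c / a) (c / b) / c := by
  have hcard (l : ℕ) [NeZero l] : (Fintype.card (BlockIndex K l) : ℝ) = blockDim K l := by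
    rw [card_blockIndex, Nat.cast_mul, blockDim]
  have hr : (Module.finrank ℝ (Im K) : ℝ) = Module.finrank ℝ K - 1 := by
    rw [finrank_im, Nat.cast_sub Module.finrank_pos, Nat.cast_one]
  rw [scalarCurvatureAt_localMetric_eq_sum ha hb hc, sum_curvTerm ha hb hc (hcard n) (hcard m) rfl
    hr, scaledCurvature]
  field_simp
  ring

/-- In the parameters `s = c / a` and `t = c / b`, the condition on the scalar curvature is that a
concave quadratic function be positive. -/
theorem convex_pscParams : Convex ℝ (pscParams K n m) := by
  have hk := one_le_finrank K
  have hN (l : ℕ) : 0 ≤ blockDim K l * (Module.finrank ℝ K - 1) := by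
    unfold blockDim
    have : (0 : ℝ) ≤ Module.finrank ℝ K - 1 := by linarith
    positivity
  rintro ⟨c, s, t⟩ ⟨h1, h2, h3, h4⟩ ⟨c', s', t'⟩ ⟨k1, k2, k3, k4⟩ x y hx hy hxy
  have hcomb (u v : ℝ) (hu : 0 < u) (hv : 0 < v) : 0 < x * u + y * v := by
    rcases hx.eq_or_lt with rfl | hx
    · obtain rfl : y = 1 := by linarith
      simpa using hv
    · have := mul_pos hx hu
      have := mul_nonneg hy hv.le
      linarith
  refine ⟨hcomb _ _ h1 k1, hcomb _ _ h2 k2, hcomb _ _ h3 k3, ?_⟩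
  refine (hcomb _ _ h4 k4).trans_le ?_
  obtain rfl : y = 1 - x := by linarith
  have e (u v : ℝ) : x * u ^ 2 + (1 - x) * v ^ 2 - (x * u + (1 - x) * v) ^ 2 =
      x * (1 - x) * (u - v) ^ 2 := by ring
  -- the deviation of `scaledCurvature` from its linear interpolation, by `e`
  have p1 := mul_nonneg (hN n) (mul_nonneg (mul_nonneg hx hy) (sq_nonneg (s - s')))
  have p2 := mul_nonneg (hN m) (mul_nonneg (mul_nonneg hx hy) (sq_nonneg (t - t')))
  rw [← e] at p1 p2
  simp only [scaledCurvature, Prod.fst_add, Prod.snd_add, Prod.smul_fst, Prod.smul_snd, smul_eq_mul]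
  nlinarith

variable {K n m}

/-- The scalar curvature is constant, since the expression of the metric is the same in all
preferred charts. -/
theorem scalarCurvature_of_inner_eq {g : Metrics (Model K n m) (M K n m)} {a b c : ℝ} (ha : a ≠ 0)
    (hb : b ≠ 0) (hc : c ≠ 0)
    (hg : ∀ p, (g.inner p : Model K n m →L[ℝ] Model K n m →L[ℝ] ℝ) = blockForm K n m a b c)
    (p : M K n m) : scalarCurvature g p = scaledCurvature K n m (c / a) (c / b) / c := by
  rw [scalarCurvature, inChart_eq_localMetric hg, chartAt_self,
    scalarCurvatureAt_localMetric K n m ha hb hc]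

variable (K n m) in
/-- The homogeneous metric with given parameters. -/
def paramMetric (t : pscParams K n m) :
    InvariantPscMetrics (Model K n m) (M K n m) (PG K n m) :=
  ⟨homMetric K n m (div_pos t.2.1 t.2.2.1) (div_pos t.2.1 t.2.2.2.1) t.2.1,
    isInvariant_of_inner_eq fun _ => rfl, fun p => by
      have h1 := t.2.1
      have h2 := t.2.2.1
      have h3 := t.2.2.2.1
      rw [scalarCurvature_of_inner_eq (div_pos h1 h2).ne' (div_pos h1 h3).ne' h1.ne' (fun _ => rfl),
        div_div_cancel₀ h1.ne', div_div_cancel₀ h1.ne']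
      exact div_pos t.2.2.2.2 h1⟩

/-- The homogeneous metrics depend linearly on `a`, `b`, `c`. -/
theorem localMetric_eq_add_smul (a b c : ℝ) (y : Model K n m) :
    localMetric K n m a b c y = a • localMetric K n m 1 0 0 y + b • localMetric K n m 0 1 0 y +
      c • localMetric K n m 0 0 1 y := by
  refine ContinuousLinearMap.ext fun u => ContinuousLinearMap.ext fun v => ?_
  simp only [add_apply, smul_apply, localMetric_apply, localForm, smul_eq_mul]
  ring

theorem continuous_paramMetric : Continuous (paramMetric K n m) := by
  refine Continuous.subtype_mk (continuous_metrics_of_inChart_eq (ι := Fin 3) _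
    ![fun t : pscParams K n m => t.1.1 / t.1.2.1, fun t => t.1.1 / t.1.2.2, fun t => t.1.1] ?_
    ![localMetric K n m 1 0 0, localMetric K n m 0 1 0, localMetric K n m 0 0 1] ?_ ?_) _
  · intro i
    fin_cases i
    · exact Continuous.div (by fun_prop) (by fun_prop) fun t => t.2.2.1.ne'
    · exact Continuous.div (by fun_prop) (by fun_prop) fun t => t.2.2.2.1.ne'
    · exact continuous_fst.comp continuous_subtype_val
  · intro i
    fin_cases i
    · exact contDiff_localMetric 1 0 0
    · exact contDiff_localMetric 0 1 0
    · exact contDiff_localMetric 0 0 1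
  · intro t p
    rw [inChart_eq_localMetric (fun _ => rfl)]
    funext y
    rw [localMetric_eq_add_smul, Fin.sum_univ_three]
    rfl

/-- The form which an invariant metric induces at the base point can be read off from any preferred
chart. -/
theorem inChart_zero_eq {g : Metrics (Model K n m) (M K n m)} (hg : IsInvariant (PG K n m) g)
    (p : M K n m) : inChart g p 0 = formAt g (basePoint K n m) := by
  rw [inChart_eq_localMetric (formAt_eq_blockForm hg), localMetric_zero, ← formAt_eq_blockForm hg]

theorem continuous_formAt_basePoint :
    Continuous fun g : InvariantPscMetrics (Model K n m) (M K n m) (PG K n m) =>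
      formAt g.1 (basePoint K n m) := by
  have h : (0 : Model K n m) ∈ (chartAt (Model K n m) (basePoint K n m)).target := by
    rw [← chartAt_self (basePoint K n m)]
    exact mem_chart_target _ _
  have h1 := (continuous_inChart_apply (X := M K n m) _ h).comp (continuous_subtype_val
    (p := fun g : Metrics (Model K n m) (M K n m) => IsInvariant (PG K n m) g ∧
      ∀ p, 0 < scalarCurvature g p))
  refine h1.congr fun g => inChart_zero_eq g.2.1 _

/-- The parameters of an invariant metric of positive scalar curvature, read off from the metric at
the base point. -/
def metricParam (g : InvariantPscMetrics (Model K n m) (M K n m) (PG K n m)) : pscParams K n m :=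
  ⟨(coef₃ (formAt g.1 (basePoint K n m)),
    coef₃ (formAt g.1 (basePoint K n m)) / coef₁ (formAt g.1 (basePoint K n m)),
    coef₃ (formAt g.1 (basePoint K n m)) / coef₂ (formAt g.1 (basePoint K n m))), by
    have h1 := coef₁_pos fun u hu => formAt_pos g.1 (basePoint K n m) (u := u) hu
    have h2 := coef₂_pos fun u hu => formAt_pos g.1 (basePoint K n m) (u := u) hu
    have h3 := coef₃_pos fun u hu => formAt_pos g.1 (basePoint K n m) (u := u) hu
    refine ⟨h3, div_pos h3 h1, div_pos h3 h2, ?_⟩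
    have h := g.2.2 (basePoint K n m)
    rw [scalarCurvature_of_inner_eq h1.ne' h2.ne' h3.ne' (formAt_eq_blockForm g.2.1)] at h
    exact (div_pos_iff_of_pos_right h3).1 h⟩

theorem continuous_metricParam : Continuous (metricParam (K := K) (n := n) (m := m)) := by
  have h0 := continuous_formAt_basePoint (K := K) (n := n) (m := m)
  have h1 := continuous_coef₁.comp h0
  have h2 := continuous_coef₂.comp h0
  have h3 := continuous_coef₃.comp h0
  refine Continuous.subtype_mk (h3.prodMk ((h3.div h1 fun g => ?_).prodMk (h3.div h2 fun g => ?_))) _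
  · exact (coef₁_pos fun u hu => formAt_pos g.1 (basePoint K n m) (u := u) hu).ne'
  · exact (coef₂_pos fun u hu => formAt_pos g.1 (basePoint K n m) (u := u) hu).ne'

/-- An invariant metric is determined by its parameters. (The converse fails if a block is zero, as
the parameter of this block is then immaterial.) -/
theorem paramMetric_metricParam (g : InvariantPscMetrics (Model K n m) (M K n m) (PG K n m)) :
    paramMetric K n m (metricParam g) = g := by
  have h1 := coef₁_pos fun u hu => formAt_pos g.1 (basePoint K n m) (u := u) hu
  have h2 := coef₂_pos fun u hu => formAt_pos g.1 (basePoint K n m) (u := u) hu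
  have h3 := coef₃_pos fun u hu => formAt_pos g.1 (basePoint K n m) (u := u) hu
  have hf (p : M K n m) : formAt (paramMetric K n m (metricParam g)).1 p = formAt g.1 p := by
    rw [formAt_eq_blockForm g.2.1]
    have e1 := div_div_cancel₀ (b := coef₁ (formAt g.1 (basePoint K n m))) h3.ne'
    have e2 := div_div_cancel₀ (b := coef₂ (formAt g.1 (basePoint K n m))) h3.ne'
    exact congrArg₂ (fun a b => blockForm K n m a b (coef₃ (formAt g.1 (basePoint K n m)))) e1 e2
  refine Subtype.ext ?_
  have hext (g g' : Metrics (Model K n m) (M K n m)) (h : ∀ p, formAt g p = formAt g' p) :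
      g = g' := by
    obtain ⟨_, _⟩ := g
    obtain ⟨_, _⟩ := g'
    congr 1
    exact funext h
  exact hext _ _ hf

variable (K n m) in
/-- The space of invariant metrics of positive scalar curvature is a retract of a convex set, which
is nonempty if it contains the metric with the parameters `a = b = c = 1`. -/
theorem contractibleSpace_invariantPscMetrics (h : 0 < scaledCurvature K n m 1 1) :
    ContractibleSpace (InvariantPscMetrics (Model K n m) (M K n m) (PG K n m)) := by
  have : ContractibleSpace (pscParams K n m) :=
    (convex_pscParams K n m).contractibleSpace ⟨(1, 1, 1), one_pos, one_pos, one_pos, h⟩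
  exact contractibleSpace_of_section ⟨_, continuous_paramMetric⟩ ⟨_, continuous_metricParam⟩
    paramMetric_metricParam

end Contractible

end PscQuotient

end

theorem mainTheorem11 (n m : ℕ) [NeZero n] [NeZero m] :
    (3 ≤ n → 3 ≤ m → ContractibleSpace
      (PscQuotient.InvariantPscMetrics (PscQuotient.Model ℝ n m) (PscQuotient.M ℝ n m)
        (PscQuotient.PG ℝ n m))) ∧
    (2 ≤ n → 2 ≤ m → ContractibleSpace
      (PscQuotient.InvariantPscMetrics (PscQuotient.Model ℂ n m) (PscQuotient.M ℂ n m)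
        (PscQuotient.PG ℂ n m))) ∧
    (1 ≤ n → 1 ≤ m → ContractibleSpace
      (PscQuotient.InvariantPscMetrics (PscQuotient.Model ℍ[ℝ] n m) (PscQuotient.M ℍ[ℝ] n m)
        (PscQuotient.PG ℍ[ℝ] n m))) := by
  -- For `N = k (n - 1)` and `N' = k (m - 1)`, the scaled curvature at `(1, 1)` is `N (N + 2 k - 3)
  -- + N' (N' + 2 k - 3) + (k - 1) (k - 2)`.
  have hcast (l : ℕ) (hl : 1 ≤ l) : ((l - 1 : ℕ) : ℝ) = l - 1 := by
    rw [Nat.cast_sub hl, Nat.cast_one]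
  refine ⟨fun hn hm => ?_, fun hn hm => ?_, fun hn hm => ?_⟩ <;>
    refine PscQuotient.contractibleSpace_invariantPscMetrics _ n m ?_ <;>
    rw [PscQuotient.scaledCurvature, PscQuotient.blockDim, PscQuotient.blockDim,
      hcast n (by omega), hcast m (by omega)]
  · have h1 : (3 : ℝ) ≤ n := by exact_mod_cast hn
    have h2 : (3 : ℝ) ≤ m := by exact_mod_cast hm
    rw [Module.finrank_self]
    push_cast
    nlinarith
  · have h1 : (2 : ℝ) ≤ n := by exact_mod_cast hn
    have h2 : (2 : ℝ) ≤ m := by exact_mod_cast hm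
    rw [Complex.finrank_real_complex]
    push_cast
    nlinarith
  · have h1 : (1 : ℝ) ≤ n := by exact_mod_cast hn
    have h2 : (1 : ℝ) ≤ m := by exact_mod_cast hm
    rw [Quaternion.finrank_eq_four]
    push_cast
    nlinarith
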